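/- **Setting.** Let $d\ge 1$, $\alpha\in(0,1]$, and equip $\mathbb R^d$ with the Euclidean norm. *Forms.* An oriented $k$-simplex $\sigma=[v_0,\dots,v_k]$ is the convex hull of affinely independent points $v_0,\dots,v_k\in\mathbb R^d$ together with an ordering of them up to even permutations; $-\sigma$ denotes the opposite orientation. A subdivision of $\sigma$ is a finite family of $k$-simplices, with the orientation of $\sigma$, whose union is $\sigma$ and whose pairwise intersections have zero $k$-dimensional Hausdorff measure. $\Omega^d$ is the space of real functions $A$ on oriented $d$-simplices such that $A(-\sigma)=-A(\sigma)$, $A(\sigma)=\sum_{\tau\in\mathcal K}A(\tau)$ for every subdivision $\mathcal K$ of $\sigma$, and $(v_0,\dots,v_d)\mapsto A[v_0,\dots,v_d]$ (set to $0$ on affinely dependent tuples) is Borel. For a $d$-simplex $\sigma$ let $$h_\sigma=\min_F\,\sup_{x\in\sigma}\operatorname{dist}(x,\langle F\rangle),\qquad \mathbf m_\alpha(\sigma)=\max_F \operatorname{Vol}^{d-1}(F)\,h_\sigma^{\alpha},$$ where $F$ runs over the boundary faces of $\sigma$, $\langle F\rangle$ is the hyperplane containing $F$, and $\operatorname{Vol}^{d-1}$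 is the $(d-1)$-dimensional Hausdorff measure. Let $$\|A\|_{\alpha}=\sup\{|A(\sigma)|/\mathbf m_\alpha(\sigma):\operatorname{diam}\sigma\le 1\},\qquad \Omega^d_{\alpha,0}=\{A\in\Omega^d:\|A\|_\alpha<\infty\}.$$ (In general $\|A\|_{\alpha,0}=\|A\|_\alpha+\|\partial A\|_0$, where $\partial A(\sigma)=A(\partial\sigma)$; in top degree the second term vanishes.) *Distributions.* $C^{\alpha-1}$ is the space of distributions $F$ on $\mathbb R^d$ with $$\|F\|_{C^{\alpha-1}}=\sup_{x\in\mathbb R^d}\ \sup_{\lambda\in(0,1]}\ \sup_{\psi}\ \lambda^{1-\alpha}\,|F(\psi_x^\lambda)|<\infty,\qquad \psi_x^\lambda(y)=\lambda^{-d}\psi\big((y-x)/\lambda\big),$$ where $\psi$ runs over smooth functions supported in the closed unit ball with $|\psi|\le1$ and $|D\psi|\le 1$. *The map $\pi$.* For $A\in\Omega^d_{\alpha,0}$ and $\psi\in C_c^\infty(\mathbb R^d)$ put $$\langle\pi A,\psi\rangle=(-1)^d\int_{\mathbb R^d}A\big([0,v_1]\times\cdots\times[0,v_d]\big)\,\partial_1\cdots\partial_d\psi(v)\,dv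 ,$$ where the oriented box $[0,v_1]\times\cdots\times[0,v_d]$ is viewed as a sum of oriented simplices triangulating it, each negative coordinate $v_i$ reverses its orientation, and degenerate boxes count as $0$. **Proposition 6.2.** For every $A\in\Omega^d_{\alpha,0}$ and $\psi\in C_c^\infty(\mathbb R^d)$ the integral above converges absolutely, and $\pi$ is a linear bijection from $\Omega^d_{\alpha,0}$ onto $C^{\alpha-1}$. It is bounded with bounded inverse: there is a constant $C$, depending only on $d$ and $\alpha$, such that $$\|\pi A\|_{C^{\alpha-1}}\le C\,\|A\|_{\alpha}\quad\text{and}\quad \|\pi^{-1}F\|_{\alpha}\le C\,\|F\|_{C^{\alpha-1}}$$ for all $A\in\Omega^d_{\alpha,0}$ and $F\in C^{\alpha-1}$. -/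

import Mathlib

open MeasureTheory Set
open scoped ENNReal NNReal Distributions LineDeriv

noncomputable section

namespace HolderForms

/-- The ambient space `ℝ^d` with its Euclidean norm. -/
abbrev E (d : ℕ) : Type := EuclideanSpace ℝ (Fin d)

/-- A vertex list `(v_0, …, v_k)`. When it is affinely independent it represents the oriented
`k`-simplex `[v_0, …, v_k]`; two lists represent the same oriented simplex exactly when they differ
by an even permutation. -/
abbrev Vertices (d k : ℕ) : Type := Fin (k + 1) → E d

/-- The underlying set of the simplex with vertices `v_0, …, v_k`. -/
def hull {d k : ℕ} (v : Vertices d k) : Set (E d) := convexHull ℝ (range v)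

/-- For affinely independent lists spanning the same `k`-plane: the two orderings induce the same
orientation of that plane, i.e. the change of basis between the edge vectors has positive
determinant. -/
def SameOrientation {d k : ℕ} (v w : Vertices d k) : Prop :=
  ∃ M : Matrix (Fin k) (Fin k) ℝ, 0 < M.det ∧
    ∀ i : Fin k, w i.succ - w 0 = ∑ j : Fin k, M i j • (v j.succ - v 0)

/-- The oriented `k`-simplices `w_0, …, w_{N-1}` form a subdivision of the oriented `k`-simplex
`v`: they are non-overlapping, cover `v`, and carry the orientation of `v`. -/
structure IsSubdivision {d k N : ℕ} (v : Vertices d k) (w : Fin N → Vertices d k) : Prop where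
  affineIndependent : ∀ n, AffineIndependent ℝ (w n)
  sameOrientation : ∀ n, SameOrientation v (w n)
  nonoverlapping : ∀ m n, m ≠ n → μHE[k] (hull (w m) ∩ hull (w n)) = 0
  iUnion_eq : ⋃ n, hull (w n) = hull v

/-- `Ω^k`: measurable additive functions on oriented `k`-simplices of `ℝ^d`, as functions of the
vertex list (extended by `0` to affinely dependent lists). -/
def Cochain (d k : ℕ) : Submodule ℝ (Vertices d k → ℝ) where
  carrier := {A | Measurable A ∧
    (∀ v, ¬ AffineIndependent ℝ v → A v = 0) ∧
    (∀ (v : Vertices d k) (s : Equiv.Perm (Fin (k + 1))),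
      A (v ∘ s) = ((Equiv.Perm.sign s : ℤ) : ℝ) * A v) ∧
    (∀ (v : Vertices d k), AffineIndependent ℝ v →
      ∀ (N : ℕ) (w : Fin N → Vertices d k), IsSubdivision v w → A v = ∑ n, A (w n))}
  zero_mem' := ⟨measurable_const, by simp, by simp, by simp⟩
  add_mem' := by
    rintro A B ⟨a1, a2, a3, a4⟩ ⟨b1, b2, b3, b4⟩
    refine ⟨a1.add b1, fun v hv => ?_, fun v s => ?_, fun v hv N w hw => ?_⟩
    · simp [a2 v hv, b2 v hv]
    · simp [a3 v s, b3 v s, mul_add]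
    · simp [a4 v hv N w hw, b4 v hv N w hw, Finset.sum_add_distrib]
  smul_mem' := by
    rintro c A ⟨a1, a2, a3, a4⟩
    refine ⟨a1.const_smul c, fun v hv => ?_, fun v s => ?_, fun v hv N w hw => ?_⟩
    · simp [a2 v hv]
    · simp [a3 v s, mul_left_comm]
    · simp [a4 v hv N w hw, Finset.mul_sum]

/-- The vertices of the boundary face opposite to the `i`-th vertex. -/
def faceVertices {d k : ℕ} (v : Vertices d k) (i : Fin (k + 1)) : Fin k → E d :=
  v ∘ i.succAbove

/-- `h_σ`: the least, over boundary faces `F`, of the largest distance of a point of `σ` to the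
plane through `F`. -/
def height {d k : ℕ} (v : Vertices d k) : ℝ≥0∞ :=
  ⨅ i : Fin (k + 1), ⨆ x ∈ hull v,
    Metric.infEDist x (affineSpan ℝ (range (faceVertices v i)) : Set (E d))

/-- The `α`-mass of a `k`-simplex (`k ≥ 1`, `0 ≤ α`):
`max_F Vol^{k-1}(F) * h_σ ^ α` for `α ≠ 0`, and `1` for `α = 0`. -/
def mass {d k : ℕ} (α : ℝ) (v : Vertices d k) : ℝ≥0∞ :=
  if α = 0 then 1
  else (⨆ i : Fin (k + 1), μHE[k - 1] (convexHull ℝ (range (faceVertices v i)))) * height v ^ α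

/-- `‖A‖_α`: the supremum of `|A(σ)| / mass_α(σ)` over oriented `k`-simplices of diameter at
most `1`. -/
def growthNorm {d k : ℕ} (α : ℝ) (A : Vertices d k → ℝ) : ℝ≥0∞ :=
  ⨆ v : Vertices d k, ⨆ _ : AffineIndependent ℝ v ∧ Metric.diam (hull v) ≤ 1,
    ‖A v‖ₑ / mass α v

open Classical in
/-- The coboundary `(∂A)(σ) = A(∂σ)` of a function on oriented `k`-simplices. -/
def coboundary {d k : ℕ} (A : Vertices d k → ℝ) : Vertices d (k + 1) → ℝ := fun v =>
  if AffineIndependent ℝ v then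
    ∑ i : Fin (k + 2), (-1) ^ (i : ℕ) * A (faceVertices v i)
  else 0

/-- `‖A‖_{α,β} = ‖A‖_α + ‖∂A‖_β`. -/
def formNorm {d k : ℕ} (α β : ℝ) (A : Vertices d k → ℝ) : ℝ≥0∞ :=
  growthNorm α A + growthNorm β (coboundary A)

lemma growthNorm_zero {d k : ℕ} (α : ℝ) : growthNorm α (0 : Vertices d k → ℝ) = 0 := by
  simp [growthNorm]

lemma le_growthNorm {d k : ℕ} {α : ℝ} {A : Vertices d k → ℝ} {v : Vertices d k}
    (hv : AffineIndependent ℝ v ∧ Metric.diam (hull v) ≤ 1) :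
    ‖A v‖ₑ / mass α v ≤ growthNorm α A :=
  le_iSup_of_le v (le_iSup_of_le hv le_rfl)

lemma growthNorm_add {d k : ℕ} (α : ℝ) (A B : Vertices d k → ℝ) :
    growthNorm α (A + B) ≤ growthNorm α A + growthNorm α B := by
  refine iSup₂_le fun v hv => ?_
  refine le_trans (ENNReal.div_le_div_right (enorm_add_le (A v) (B v)) _) ?_
  rw [ENNReal.add_div]
  exact add_le_add (le_growthNorm hv) (le_growthNorm hv)

lemma growthNorm_smul {d k : ℕ} (α c : ℝ) (A : Vertices d k → ℝ) :
    growthNorm α (c • A) ≤ ‖c‖ₑ * growthNorm α A := by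
  refine iSup₂_le fun v hv => ?_
  rw [Pi.smul_apply, smul_eq_mul, enorm_mul, mul_div_assoc]
  exact mul_le_mul_right (le_growthNorm hv) _

lemma coboundary_zero {d k : ℕ} : coboundary (0 : Vertices d k → ℝ) = 0 := by
  funext v; simp [coboundary]

lemma coboundary_add {d k : ℕ} (A B : Vertices d k → ℝ) :
    coboundary (A + B) = coboundary A + coboundary B := by
  funext v
  by_cases h : AffineIndependent ℝ v <;>
    simp [coboundary, h, mul_add, Finset.sum_add_distrib]

lemma coboundary_smul {d k : ℕ} (c : ℝ) (A : Vertices d k → ℝ) :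
    coboundary (c • A) = c • coboundary A := by
  funext v
  by_cases h : AffineIndependent ℝ v <;>
    simp [coboundary, h, Finset.mul_sum, mul_left_comm]

/-- `Ω^k_{α,β}`: the elements of `Ω^k` with `‖A‖_{α,β} < ∞`. -/
def HolderForm (d k : ℕ) (α β : ℝ) : Submodule ℝ (Vertices d k → ℝ) where
  carrier := {A | A ∈ Cochain d k ∧ formNorm α β A < ⊤}
  zero_mem' := ⟨Submodule.zero_mem _, by simp [formNorm, growthNorm_zero, coboundary_zero]⟩
  add_mem' := by
    rintro A B ⟨hA, hA'⟩ ⟨hB, hB'⟩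
    refine ⟨Submodule.add_mem _ hA hB, ?_⟩
    rw [formNorm, ENNReal.add_lt_top] at hA' hB' ⊢
    refine ⟨(growthNorm_add α A B).trans_lt (ENNReal.add_lt_top.2 ⟨hA'.1, hB'.1⟩), ?_⟩
    rw [coboundary_add]
    exact (growthNorm_add β _ _).trans_lt (ENNReal.add_lt_top.2 ⟨hA'.2, hB'.2⟩)
  smul_mem' := by
    rintro c A ⟨hA, hA'⟩
    refine ⟨Submodule.smul_mem _ c hA, ?_⟩
    rw [formNorm, ENNReal.add_lt_top] at hA' ⊢
    refine ⟨(growthNorm_smul α c A).trans_lt (ENNReal.mul_lt_top enorm_lt_top hA'.1), ?_⟩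
    rw [coboundary_smul]
    exact (growthNorm_smul β c _).trans_lt (ENNReal.mul_lt_top enorm_lt_top hA'.2)

/-- The vertices `p_0 = w, p_1, …, p_d = u` of the simplex, indexed by a permutation `s`, in the
standard triangulation of the box with opposite corners `w` and `u`: the coordinates are moved from
`w` to `u` one after the other, in the order `s 0, s 1, …`. -/
def boxVertices {d : ℕ} (w u : E d) (s : Equiv.Perm (Fin d)) : Vertices d d := fun j =>
  WithLp.toLp 2 fun c => if (s.symm c : ℕ) < (j : ℕ) then u c else w c

/-- The value of `A` on the oriented box `[w_1, u_1] × ⋯ × [w_d, u_d]`, viewed as a chain through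
its standard triangulation. The sign of `s` makes each piece positively oriented when `w ≤ u`
coordinatewise; each coordinate with `u_i < w_i` reverses the orientation of the box, and a
degenerate box has value `0`. -/
def boxValue {d : ℕ} (A : Vertices d d → ℝ) (w u : E d) : ℝ :=
  ∑ s : Equiv.Perm (Fin d), ((Equiv.Perm.sign s : ℤ) : ℝ) * A (boxVertices w u s)

/-- Distributions on `ℝ^d`. -/
abbrev Distr (d : ℕ) : Type := 𝓓'((⊤ : TopologicalSpace.Opens (E d)), ℝ)

/-- Test functions `C_c^∞(ℝ^d)`. -/
abbrev Test (d : ℕ) : Type := 𝓓((⊤ : TopologicalSpace.Opens (E d)), ℝ)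

/-- The mixed partial derivative `∂_1 ⋯ ∂_d ψ`. -/
def mixedDeriv {d : ℕ} (ψ : Test d) : Test d :=
  ∂^{fun i : Fin d => (EuclideanSpace.single i (1 : ℝ) : E d)} ψ

/-- `φ = l^{-d} ψ((· - x)/l)` for some smooth `ψ` supported in the closed unit ball with
`‖ψ‖_{C^1} ≤ 1`. -/
def IsRescaledTest {d : ℕ} (x : E d) (l : ℝ) (φ : Test d) : Prop :=
  ∃ ψ : Test d, tsupport ψ ⊆ Metric.closedBall 0 1 ∧
    (∀ y, |ψ y| ≤ 1) ∧ (∀ y, ‖fderiv ℝ ψ y‖ ≤ 1) ∧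
    ∀ y, φ y = (l ^ d)⁻¹ * ψ (l⁻¹ • (y - x))

/-- The norm of `C^a`, `-1 < a ≤ 0`: the supremum of `|F(ψ_x^l)| / l ^ a` over `x ∈ ℝ^d`,
`l ∈ (0, 1]` and normalised `ψ`. -/
def distrNorm {d : ℕ} (a : ℝ) (F : Distr d) : ℝ≥0∞ :=
  ⨆ (x : E d) (l : ℝ) (φ : Test d), ⨆ _ : 0 < l ∧ l ≤ 1 ∧ IsRescaledTest x l φ,
    ‖F φ‖ₑ / ENNReal.ofReal (l ^ a)

lemma le_distrNorm {d : ℕ} {a : ℝ} {F : Distr d} {x : E d} {l : ℝ} {φ : Test d}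
    (h : 0 < l ∧ l ≤ 1 ∧ IsRescaledTest x l φ) :
    ‖F φ‖ₑ / ENNReal.ofReal (l ^ a) ≤ distrNorm a F :=
  le_iSup_of_le x (le_iSup_of_le l (le_iSup₂_of_le φ h le_rfl))

lemma distrNorm_le {d : ℕ} {a : ℝ} {F : Distr d} {C : ℝ≥0∞}
    (h : ∀ (x : E d) (l : ℝ) (φ : Test d), (0 < l ∧ l ≤ 1 ∧ IsRescaledTest x l φ) →
      ‖F φ‖ₑ / ENNReal.ofReal (l ^ a) ≤ C) : distrNorm a F ≤ C :=
  iSup_le fun x => iSup_le fun l => iSup₂_le fun φ hφ => h x l φ hφ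

/-- `C^a`, `-1 < a ≤ 0`: the distributions on `ℝ^d` with `‖F‖_{C^a} < ∞`. -/
def HolderDistr (d : ℕ) (a : ℝ) : Submodule ℝ (Distr d) where
  carrier := {F | distrNorm a F < ⊤}
  zero_mem' := lt_of_le_of_lt (distrNorm_le (C := 0) fun x l φ _ => by simp) (by simp)
  add_mem' := by
    intro F G hF hG
    refine lt_of_le_of_lt (distrNorm_le (C := distrNorm a F + distrNorm a G) ?_)
      (ENNReal.add_lt_top.2 ⟨hF, hG⟩)
    intro x l φ h
    refine le_trans (ENNReal.div_le_div_right (enorm_add_le (F φ) (G φ)) _) ?_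
    rw [ENNReal.add_div]
    exact add_le_add (le_distrNorm h) (le_distrNorm h)
  smul_mem' := by
    intro c F hF
    refine lt_of_le_of_lt (distrNorm_le (C := ‖c‖ₑ * distrNorm a F) ?_)
      (ENNReal.mul_lt_top enorm_lt_top hF)
    intro x l φ h
    change ‖c * F φ‖ₑ / _ ≤ _
    rw [enorm_mul, mul_div_assoc]
    exact mul_le_mul_right (le_distrNorm h) _

end HolderForms

end

open HolderForms

/-!
In top degree the coboundary vanishes, so the norm on forms is the growth norm `‖A‖_α`, and a form
should be thought of as `σ ↦ ∫_σ F` for a distribution `F` of regularity `α - 1`. The map of the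
theorem sends `A` to the mixed derivative `F` of its primitive `v ↦ A([0, v])`; its inverse
integrates `F` over simplices.

*Cochains as functionals on indicator functions.* A cochain respects every linear relation that
holds almost everywhere between indicator functions of simplices, because finitely many simplices
have a common subdivision, obtained by cutting a big simplex along all their facet hyperplanes
(`linearCombination_posVal_eq_zero`). Thus values on boxes are additive and may be computed from any
decomposition. In particular a cochain of finite growth norm is locally bounded on boxes
(`exists_boxValue_bound`), which gives the absolute convergence of the integrals, and integrating by
differences shows that the values on the cubes of side `ε`, integrated against `ψ`, are `ε ^ d` times
the distribution applied to an average of `ψ` (`integral_cube_mul`).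

*Injectivity.* If the distribution vanishes, so do the values on almost all cubes. Decomposing a
simplex along a grid of mesh `ε`, only the `O(ε ^ (1 - d))` cells at the boundary contribute, and
each contributes `O(ε ^ (d - 1 + α))`, so the value on the simplex is `O(ε ^ α)`
(`posVal_eq_zero_of_cubes`).

*Boundedness.* The normalised cube integrals `ε ^ (-d) ∫ A([v, v + ε]) ψ(v) dv` converge to the value
of the distribution. Halving `ε` changes them by `O(ε ^ α / l)` for a test function at scale `l`,
which is summable over the dyadic scales below `l` (`distrNorm_toDistr_le`).

*The inverse.* Let `F` have regularity `α - 1` and let `K` be a convex body with inradius at least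
`r ≤ 1`. The regularisations of the indicator function of `K` at scales `2⁻ⁿ` and `2⁻ⁿ⁻¹` differ only
in a boundary layer of volume `O(2⁻ⁿ vol K / r)`, where a partition of unity at scale `2⁻ⁿ` bounds
the pairing with `F` by the volume times `2⁻ⁿ ^ (α - 1)` (`abs_apply_le_volume`). As `α > 0` the
integrals over `K` converge, with limit of size `O(vol K * r ^ (α - 1))` (`exists_tendsto_regInt`).
For a simplex of height `h` one may take `r = h / (d + 1)`, and `vol K ≤ max Vol^{d-1}(F) * h`, so
the bound is of the order of the `α`-mass (`growthNorm_ofDistr_le`). Finally, the distribution of the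
cochain so obtained is `F`: its cube integrals are averages of `F` over translates of `ψ`
(`toDistr_ofDistr`).
-/

noncomputable section

namespace HolderForms

variable {d : ℕ}

/-! ### Simplices of full dimension -/

/-- The barycentric frame of a nondegenerate `d`-simplex of `ℝ^d`. -/
def simplexBasis (v : Vertices d d) (h : AffineIndependent ℝ v) :
    AffineBasis (Fin (d + 1)) ℝ (E d) :=
  ⟨v, h, by rw [h.affineSpan_eq_top_iff_card_eq_finrank_add_one]; simp⟩

@[simp] lemma coe_simplexBasis (v : Vertices d d) (h : AffineIndependent ℝ v) :
    ⇑(simplexBasis v h) = v := rfl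

lemma hull_eq_coord (v : Vertices d d) (h : AffineIndependent ℝ v) :
    hull v = {x | ∀ i, 0 ≤ (simplexBasis v h).coord i x} :=
  (simplexBasis v h).convexHull_eq_nonneg_coord

lemma convex_hull {k : ℕ} (v : Vertices d k) : Convex ℝ (hull v) := convex_convexHull ℝ _

lemma isCompact_hull {k : ℕ} (v : Vertices d k) : IsCompact (hull v) :=
  (finite_range v).isCompact_convexHull ℝ

lemma measurableSet_hull {k : ℕ} (v : Vertices d k) : MeasurableSet (hull v) :=
  (isCompact_hull v).measurableSet

lemma vertex_mem_hull {k : ℕ} (v : Vertices d k) (i : Fin (k + 1)) : v i ∈ hull v :=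
  subset_convexHull ℝ _ (mem_range_self i)

lemma hull_comp_perm {k : ℕ} (v : Vertices d k) (s : Equiv.Perm (Fin (k + 1))) :
    hull (v ∘ s) = hull v := by
  simp [hull, EquivLike.range_comp]

lemma hull_subset_iff {k : ℕ} (v : Vertices d k) {K : Set (E d)} (hK : Convex ℝ K) :
    hull v ⊆ K ↔ ∀ i, v i ∈ K :=
  ⟨fun h i => h (vertex_mem_hull v i), fun h => convexHull_min (range_subset_iff.2 h) hK⟩

lemma nonempty_interior_hull (v : Vertices d d) (h : AffineIndependent ℝ v) :
    (interior (hull v)).Nonempty := by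
  rw [hull, ← coe_simplexBasis v h,
    (convex_convexHull ℝ _).interior_nonempty_iff_affineSpan_eq_top, affineSpan_convexHull]
  exact (simplexBasis v h).tot

lemma hull_subset_closure_interior (v : Vertices d d) (h : AffineIndependent ℝ v) :
    hull v ⊆ closure (interior (hull v)) := by
  rw [(convex_hull v).closure_interior_eq_closure_of_nonempty_interior (nonempty_interior_hull v h)]
  exact subset_closure

lemma volume_hull_pos (v : Vertices d d) (h : AffineIndependent ℝ v) :
    0 < volume (hull v) :=
  (isOpen_interior.measure_pos volume (nonempty_interior_hull v h)).trans_le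
    (measure_mono interior_subset)

lemma volume_hull_of_not_affineIndependent (v : Vertices d d) (h : ¬ AffineIndependent ℝ v) :
    volume (hull v) = 0 := by
  refine measure_mono_null (convexHull_subset_affineSpan _) ?_
  refine Measure.addHaar_affineSubspace _ _ fun ht => h ?_
  rw [affineIndependent_iff_le_finrank_vectorSpan ℝ v (n := d) (by simp)]
  rw [AffineSubspace.affineSpan_eq_top_iff_vectorSpan_eq_top_of_nonempty ℝ _ _
    (range_nonempty v)] at ht
  rw [ht]; simp

/-- The zero set of a nonzero affine function is a null set. -/
lemma ae_affine_ne_zero (l : E d →ᵃ[ℝ] ℝ) (hl : l ≠ 0) : ∀ᵐ x : E d, l x ≠ 0 := by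
  have : {x | l x = 0} = ((AffineSubspace.mk' (0 : ℝ) ⊥).comap l : Set (E d)) := by
    ext x; simp [AffineSubspace.mem_mk']
  rw [ae_iff]
  simp only [not_not, this]
  refine Measure.addHaar_affineSubspace _ _ fun ht => hl ?_
  ext x
  have hx : x ∈ (AffineSubspace.mk' (0 : ℝ) ⊥).comap l := by rw [ht]; trivial
  simpa [AffineSubspace.mem_mk'] using hx

/-! ### Orientation -/

/-- The determinant of the edge vectors of a `d`-simplex issuing from its first vertex. -/
def edgeDet (v : Vertices d d) : ℝ :=
  Matrix.det (Matrix.of fun i j : Fin d => v i.succ j - v 0 j)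

/-- In this form, permuting the vertices permutes the rows of the matrix. -/
lemma edgeDet_eq_bordered (v : Vertices d d) :
    edgeDet v = Matrix.det (Matrix.of fun i : Fin (d + 1) =>
      (Fin.cons 1 (fun j => v i j) : Fin (d + 1) → ℝ)) := by
  rw [Matrix.det_eq_of_forall_row_eq_smul_add_const (B := Matrix.of fun i : Fin (d + 1) =>
    (Fin.cons (if i = 0 then 1 else 0) (fun j => if i = 0 then v 0 j else v i j - v 0 j) :
      Fin (d + 1) → ℝ)) (fun i => if i = 0 then 0 else 1) 0 (by simp)]
  · rw [Matrix.det_succ_column_zero, Fin.sum_univ_succ]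
    simp [edgeDet, Matrix.submatrix]
  · intro i j
    refine Fin.cases ?_ (fun j => ?_) j <;> by_cases hi : i = 0 <;> simp [hi]

lemma edgeDet_comp_perm (v : Vertices d d) (s : Equiv.Perm (Fin (d + 1))) :
    edgeDet (v ∘ s) = ((Equiv.Perm.sign s : ℤ) : ℝ) * edgeDet v := by
  rw [edgeDet_eq_bordered, edgeDet_eq_bordered, ← Matrix.det_permute]
  rfl

lemma affineIndependent_iff_edgeDet (v : Vertices d d) :
    AffineIndependent ℝ v ↔ edgeDet v ≠ 0 := by
  rw [affineIndependent_iff_linearIndependent_vsub ℝ v 0, edgeDet, ← isUnit_iff_ne_zero,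
    ← Matrix.isUnit_iff_isUnit_det, ← Matrix.linearIndependent_rows_iff_isUnit,
    ← linearIndependent_equiv (finSuccAboveEquiv (0 : Fin (d + 1))),
    ← LinearMap.linearIndependent_iff (WithLp.linearEquiv 2 ℝ (Fin d → ℝ)).toLinearMap
      (LinearEquiv.ker _)]
  rfl

lemma measurable_edgeDet : Measurable (edgeDet : Vertices d d → ℝ) := by
  refine Continuous.measurable ?_
  refine Continuous.matrix_det ?_
  fun_prop

lemma sameOrientation_of_edgeDet {v w : Vertices d d} (h : 0 < edgeDet w * edgeDet v) :
    SameOrientation v w := by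
  set V : Matrix (Fin d) (Fin d) ℝ := Matrix.of fun i j : Fin d => v i.succ j - v 0 j with hV
  set W : Matrix (Fin d) (Fin d) ℝ := Matrix.of fun i j : Fin d => w i.succ j - w 0 j with hW
  have hv : V.det ≠ 0 := fun h0 => by
    have : edgeDet v = 0 := h0
    simp [this] at h
  refine ⟨W * V⁻¹, ?_, fun i => ?_⟩
  · rw [Matrix.det_mul, Matrix.det_nonsing_inv, Ring.inverse_eq_inv']
    have : 0 < W.det * V.det := h
    have h2 : W.det * V.det⁻¹ = (W.det * V.det) * (V.det⁻¹) ^ 2 := by field_simp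
    rw [h2]; positivity
  · have h3 : W * V⁻¹ * V = W := by
      rw [Matrix.mul_assoc, Matrix.nonsing_inv_mul _ (isUnit_iff_ne_zero.2 hv), Matrix.mul_one]
    ext j
    have h4 := congrFun (congrFun h3 i) j
    rw [Matrix.mul_apply] at h4
    have h5 : W i j = w i.succ j - w 0 j := rfl
    simp only [PiLp.sub_apply, WithLp.ofLp_sum, WithLp.ofLp_smul, Finset.sum_apply, Pi.smul_apply,
      WithLp.ofLp_sub, Pi.sub_apply, smul_eq_mul]
    rw [← h5, ← h4]
    rfl

lemma sameOrientation_edgeDet {v w : Vertices d d} (h : SameOrientation v w) :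
    ∃ r : ℝ, 0 < r ∧ edgeDet w = r * edgeDet v := by
  obtain ⟨M, hM, h⟩ := h
  refine ⟨M.det, hM, ?_⟩
  rw [edgeDet, edgeDet, ← Matrix.det_mul]
  congr 1
  ext i j
  have := congrArg (fun x : E d => x j) (h i)
  simp only [PiLp.sub_apply, WithLp.ofLp_sum, WithLp.ofLp_smul, Finset.sum_apply, Pi.smul_apply,
      WithLp.ofLp_sub, Pi.sub_apply, smul_eq_mul] at this
  simp [Matrix.mul_apply, this]

/-- The value of a cochain on a simplex with its positive orientation. -/
def posVal (A : Vertices d d → ℝ) (v : Vertices d d) : ℝ := (SignType.sign (edgeDet v) : ℝ) * A v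

lemma abs_posVal (A : Vertices d d → ℝ) {v : Vertices d d} (h : AffineIndependent ℝ v) :
    |posVal A v| = |A v| := by
  rw [affineIndependent_iff_edgeDet] at h
  rcases lt_or_gt_of_ne h with h | h <;> simp [posVal, h]

lemma posVal_of_not (A : Vertices d d → ℝ) {v : Vertices d d} (h : ¬ AffineIndependent ℝ v) :
    posVal A v = 0 := by
  rw [affineIndependent_iff_edgeDet, not_not] at h
  simp [posVal, h]

lemma eq_zero_of_mem_cochain {A : Vertices d d → ℝ} (hA : A ∈ Cochain d d) {v : Vertices d d}
    (h : ¬ AffineIndependent ℝ v) : A v = 0 := hA.2.1 v h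

lemma eq_sign_mul_posVal {A : Vertices d d → ℝ} (hA : A ∈ Cochain d d) (v : Vertices d d) :
    A v = (SignType.sign (edgeDet v) : ℝ) * posVal A v := by
  by_cases h : AffineIndependent ℝ v
  · rw [affineIndependent_iff_edgeDet] at h
    rcases lt_or_gt_of_ne h with h | h <;> simp [posVal, h]
  · rw [eq_zero_of_mem_cochain hA h, posVal_of_not A h, mul_zero]

lemma sign_intCast_mul (z : ℤˣ) (x : ℝ) : (SignType.sign (((z : ℤ) : ℝ) * x) : ℝ) =
    ((z : ℤ) : ℝ) * (SignType.sign x : ℝ) := by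
  rcases Int.units_eq_one_or z with h | h <;> simp [h, Left.sign_neg]

lemma posVal_comp_perm {A : Vertices d d → ℝ} (hA : A ∈ Cochain d d) (v : Vertices d d)
    (s : Equiv.Perm (Fin (d + 1))) : posVal A (v ∘ s) = posVal A v := by
  rw [posVal, posVal, edgeDet_comp_perm, hA.2.2.1, sign_intCast_mul]
  have : ((Equiv.Perm.sign s : ℤ) : ℝ) * ((Equiv.Perm.sign s : ℤ) : ℝ) = 1 := by
    rcases Int.units_eq_one_or (Equiv.Perm.sign s) with h | h <;> simp [h]
  linear_combination (SignType.sign (edgeDet v) : ℝ) * A v * this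

/-! ### Indicator functions of simplices -/

/-- The indicator function of a simplex. -/
def ind (v : Vertices d d) : E d → ℝ := (hull v).indicator 1

lemma ind_apply_of_mem {v : Vertices d d} {x : E d} (h : x ∈ hull v) : ind v x = 1 := by
  simp [ind, h]

lemma ind_apply_of_notMem {v : Vertices d d} {x : E d} (h : x ∉ hull v) : ind v x = 0 := by
  simp [ind, h]

lemma ind_nonneg (v : Vertices d d) (x : E d) : 0 ≤ ind v x :=
  indicator_nonneg (fun _ _ => zero_le_one) x

lemma list_sum_map_eq {α : Type*} (L : List α) (f : α → ℝ) :
    (L.map f).sum = ∑ n : Fin L.length, f (L.get n) := by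
  rw [← List.sum_ofFn]
  congr 1
  exact (List.ofFn_getElem_eq_map L f).symm

lemma list_sum_ind_apply (L : List (Vertices d d)) (x : E d) :
    (L.map ind).sum x = (L.map fun w => ind w x).sum := by
  induction L with
  | nil => rfl
  | cons a L ih => simp [ih]

lemma list_sum_ind_eq_zero {L : List (Vertices d d)} {x : E d} (h : ∀ w ∈ L, x ∉ hull w) :
    (L.map ind).sum x = 0 := by
  rw [list_sum_ind_apply]
  refine List.sum_eq_zero fun y hy => ?_
  obtain ⟨w, hw, rfl⟩ := List.mem_map.1 hy
  exact ind_apply_of_notMem (h w hw)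

lemma exists_oriented (hd : 1 ≤ d) {v w : Vertices d d} (hv : AffineIndependent ℝ v)
    (hw : AffineIndependent ℝ w) : ∃ s : Equiv.Perm (Fin (d + 1)), SameOrientation v (w ∘ s) := by
  rw [affineIndependent_iff_edgeDet] at hv hw
  rcases lt_or_gt_of_ne (mul_ne_zero hw hv) with h | h
  · refine ⟨Equiv.swap 0 1, sameOrientation_of_edgeDet ?_⟩
    have h01 : (0 : Fin (d + 1)) ≠ 1 := by
      obtain ⟨e, rfl⟩ := Nat.exists_eq_add_of_le' hd
      exact zero_ne_one
    rw [edgeDet_comp_perm, Equiv.Perm.sign_swap h01]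
    push_cast
    linarith
  · exact ⟨1, sameOrientation_of_edgeDet h⟩

/-- A cochain is additive over every decomposition of a simplex into simplices whose indicator
functions add up almost everywhere. -/
lemma posVal_eq_sum (hd : 1 ≤ d) {A : Vertices d d → ℝ} (hA : A ∈ Cochain d d) {v : Vertices d d}
    (hv : AffineIndependent ℝ v) (L : List (Vertices d d))
    (hL : ∀ w ∈ L, AffineIndependent ℝ w ∧ hull w ⊆ hull v)
    (hsum : (L.map ind).sum =ᵐ[volume] ind v) :
    posVal A v = (L.map (posVal A)).sum := by
  have hmem : ∀ n : Fin L.length, L.get n ∈ L := fun n => List.get_mem L n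
  choose s hs using fun n : Fin L.length => exists_oriented hd hv (hL _ (hmem n)).1
  have hge : ∀ (x : E d) (m n : Fin L.length), m ≠ n → x ∈ hull (L.get m) → x ∈ hull (L.get n) →
      2 ≤ (L.map ind).sum x := by
    intro x m n hmn hm hn
    rw [list_sum_ind_apply, list_sum_map_eq]
    have h2 := Finset.sum_le_sum_of_subset_of_nonneg (Finset.subset_univ {m, n})
      (f := fun n => ind (L.get n) x) (fun i _ _ => ind_nonneg _ x)
    rw [Finset.sum_pair hmn] at h2
    rw [ind_apply_of_mem hm, ind_apply_of_mem hn] at h2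
    linarith
  have hsub : IsSubdivision v fun n => L.get n ∘ s n := by
    refine ⟨fun n => ?_, hs, fun m n hmn => ?_, ?_⟩
    · exact (affineIndependent_equiv (s n)).2 (hL _ (hmem n)).1
    · rw [hull_comp_perm, hull_comp_perm, EuclideanSpace.euclideanHausdorffMeasure_eq_volume]
      refine measure_mono_null (fun x hx => ?_) (ae_iff.1 hsum)
      intro h
      have h1 := hge x m n hmn hx.1 hx.2
      have h3 : ind v x ≤ 1 := indicator_le_self' (fun _ _ => zero_le_one) x
      linarith
    · simp only [hull_comp_perm]
      refine subset_antisymm (iUnion_subset fun n => (hL _ (hmem n)).2) ?_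
      have hcl : IsClosed (⋃ n, hull (L.get n)) :=
        isClosed_iUnion_of_finite fun n => (isCompact_hull _).isClosed
      refine (hull_subset_closure_interior v hv).trans (closure_minimal ?_ hcl)
      have hopen : IsOpen (interior (hull v) \ ⋃ n, hull (L.get n)) :=
        isOpen_interior.sdiff hcl
      rw [← sdiff_eq_empty]
      refine (hopen.measure_eq_zero_iff volume).1 ?_
      refine measure_mono_null (fun x hx => ?_) (ae_iff.1 hsum)
      intro h
      rw [ind_apply_of_mem (interior_subset hx.1), list_sum_ind_eq_zero] at h
      · exact zero_ne_one h
      · intro w hw hxw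
        obtain ⟨n, rfl⟩ := List.get_of_mem hw
        exact hx.2 (mem_iUnion.2 ⟨n, hxw⟩)
  have h := hA.2.2.2 v hv _ _ hsub
  rw [posVal, h, Finset.mul_sum, list_sum_map_eq]
  refine Finset.sum_congr rfl fun n _ => ?_
  rw [← posVal_comp_perm hA _ (s n)]
  obtain ⟨r, hr, h2⟩ := sameOrientation_edgeDet (hs n)
  simp only [posVal]
  simp only [Function.comp_def] at h2 ⊢
  rw [h2, sign_mul, sign_pos hr, one_mul]

/-! ### Cutting simplices by hyperplanes -/

lemma real_lineMap (a b t : ℝ) : AffineMap.lineMap a b t = (1 - t) * a + t * b := by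
  rw [AffineMap.lineMap_apply_module, smul_eq_mul, smul_eq_mul]

lemma affineIndependent_update_lineMap {v : Vertices d d} (hv : AffineIndependent ℝ v)
    {i j : Fin (d + 1)} (hij : i ≠ j) {t : ℝ} (ht : t < 1) :
    AffineIndependent ℝ (Function.update v i (AffineMap.lineMap (v i) (v j) t)) := by
  set b := simplexBasis v hv
  refine AffineIndependent.affineIndependent_update_of_notMem_affineSpan hv fun hp => ?_
  have hle : affineSpan ℝ (v '' {x | x ≠ i}) ≤
      (AffineSubspace.mk' (0 : ℝ) ⊥).comap (b.coord i) := by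
    rw [affineSpan_le]
    rintro _ ⟨k, hk, rfl⟩
    have : b.coord i (v k) = 0 := b.coord_apply_ne (Ne.symm hk)
    simp [AffineSubspace.mem_mk', this]
  have h := hle hp
  have h1 : b.coord i (v i) = 1 := b.coord_apply_eq i
  have h2 : b.coord i (v j) = 0 := b.coord_apply_ne hij
  rw [AffineSubspace.mem_comap, AffineMap.apply_lineMap, h1, h2, real_lineMap,
    AffineSubspace.mem_mk'] at h
  simp at h
  linarith

/-- Moving the `i`-th vertex along the edge towards the `j`-th one leaves the part of the simplex on
one side of the hyperplane through the new vertex and the vertices other than `i` and `j`. -/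
lemma mem_hull_update_lineMap {v : Vertices d d} (hv : AffineIndependent ℝ v)
    {i j : Fin (d + 1)} (hij : i ≠ j) {t : ℝ} (ht0 : 0 ≤ t) (ht : t < 1) (x : E d) :
    x ∈ hull (Function.update v i (AffineMap.lineMap (v i) (v j) t)) ↔
      x ∈ hull v ∧ t * (simplexBasis v hv).coord i x ≤ (1 - t) * (simplexBasis v hv).coord j x := by
  set b := simplexBasis v hv
  have hbi : ∀ m, b.coord m (v m) = 1 := fun m => b.coord_apply_eq m
  have hbn : ∀ m k, m ≠ k → b.coord m (v k) = 0 := fun m k h => b.coord_apply_ne h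
  rw [hull_eq_coord v hv]
  constructor
  · have hconv : Convex ℝ
        {x | (∀ k, 0 ≤ b.coord k x) ∧ t * b.coord i x ≤ (1 - t) * b.coord j x} := by
      intro x hx y hy a c ha hc hac
      refine ⟨fun k => ?_, ?_⟩
      · rw [Convex.combo_affine_apply hac]
        have := hx.1 k; have := hy.1 k
        simp only [smul_eq_mul]; positivity
      · rw [Convex.combo_affine_apply hac, Convex.combo_affine_apply hac]
        simp only [smul_eq_mul]
        nlinarith [hx.2, hy.2]
    refine fun hx => (hull_subset_iff _ hconv).2 (fun k => ?_) hx
    by_cases hk : k = i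
    · subst hk
      rw [Function.update_self]
      simp only [mem_ofPred_eq, AffineMap.apply_lineMap, real_lineMap]
      refine ⟨fun m => ?_, ?_⟩
      · by_cases hmk : m = k
        · subst hmk; rw [hbi, hbn _ _ hij]; linarith
        · rw [hbn _ _ hmk]
          by_cases hmj : m = j
          · subst hmj; rw [hbi]; linarith
          · rw [hbn _ _ hmj]; simp
      · rw [hbi, hbi, hbn _ _ hij, hbn _ _ hij.symm]; linarith
    · rw [Function.update_of_ne hk]
      have hnn : ∀ m, 0 ≤ b.coord m (v k) := fun m => by
        by_cases h : m = k
        · subst h; rw [hbi]; exact zero_le_one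
        · rw [hbn _ _ h]
      refine ⟨hnn, ?_⟩
      rw [hbn _ _ (Ne.symm hk), mul_zero]
      exact mul_nonneg (by linarith) (hnn j)
  · rintro ⟨hx, hle⟩
    set p := AffineMap.lineMap (v i) (v j) t with hp
    set c := t * b.coord i x / (1 - t) with hc
    have h1t : 0 < 1 - t := by linarith
    set w : Fin (d + 1) → ℝ := fun k =>
      b.coord k x + ((if k = i then c else 0) - (if k = j then c else 0)) with hw
    have hsum1 : ∑ k, w k = 1 := by
      simp only [hw, Finset.sum_add_distrib, Finset.sum_sub_distrib, Finset.sum_ite_eq',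
        Finset.mem_univ, if_true, sub_self, add_zero]
      exact b.sum_coord_apply_eq_one x
    have hc0 : 0 ≤ c := div_nonneg (mul_nonneg ht0 (hx i)) h1t.le
    have hnn : ∀ k ∈ Finset.univ, 0 ≤ w k := by
      intro k _
      simp only [hw]
      by_cases hk : k = j
      · subst hk
        rw [if_neg (Ne.symm hij), if_pos rfl]
        have : c ≤ b.coord k x := by rw [hc, div_le_iff₀ h1t]; linarith
        linarith
      · rw [if_neg hk]
        have := hx k
        split_ifs <;> linarith
    have hmem := (convex_hull (Function.update v i p)).sum_mem hnn hsum1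
      (fun k _ => vertex_mem_hull _ k)
    convert hmem using 1
    have hupd : ∀ k, Function.update v i p k = v k + (if k = i then p - v i else 0) := by
      intro k
      by_cases hk : k = i
      · subst hk; simp
      · simp [hk]
    have hpv : p - v i = t • (v j - v i) := by
      rw [hp, AffineMap.lineMap_apply]; simp
    simp only [hupd, smul_add, Finset.sum_add_distrib, hw, add_smul, sub_smul, smul_ite, smul_zero,
      ite_smul, zero_smul, Finset.sum_ite_eq', Finset.sum_sub_distrib, Finset.mem_univ, if_true,
      if_neg hij]
    have hxx : ∑ k, b.coord k x • v k = x := b.linear_combination_coord_eq_self x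
    rw [hxx, hpv]
    have hct : (b.coord i x + c) * t = c := by
      rw [hc]; field_simp; ring
    rw [sub_zero, ← add_smul, smul_smul, hct, smul_sub]
    abel

/-- A list of nondegenerate simplices inside `hull v` whose indicator functions add up to that of
`hull v` almost everywhere. -/
def Refines (v : Vertices d d) (L : List (Vertices d d)) : Prop :=
  (∀ w ∈ L, AffineIndependent ℝ w ∧ hull w ⊆ hull v) ∧ (L.map ind).sum =ᵐ[volume] ind v

lemma Refines.refl {v : Vertices d d} (hv : AffineIndependent ℝ v) : Refines v [v] :=
  ⟨by simp [hv], by simp⟩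

lemma ae_flatMap {L : List (Vertices d d)} {f : Vertices d d → List (Vertices d d)}
    {g : Vertices d d → E d → ℝ}
    (h : ∀ w ∈ L, ((f w).map ind).sum =ᵐ[volume] g w) :
    ((L.flatMap f).map ind).sum =ᵐ[volume] (L.map g).sum := by
  induction L with
  | nil => simp
  | cons a L ih =>
    simp only [List.flatMap_cons, List.map_append, List.sum_append, List.map_cons, List.sum_cons]
    exact (h a (by simp)).add (ih fun w hw => h w (by simp [hw]))

lemma Refines.flatMap {v : Vertices d d} {L : List (Vertices d d)} (hL : Refines v L)
    {f : Vertices d d → List (Vertices d d)} (h : ∀ w ∈ L, Refines w (f w)) :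
    Refines v (L.flatMap f) := by
  refine ⟨fun w hw => ?_, (ae_flatMap fun w hw => (h w hw).2).trans hL.2⟩
  obtain ⟨u, hu, hwu⟩ := List.mem_flatMap.1 hw
  exact ⟨((h u hu).1 w hwu).1, ((h u hu).1 w hwu).2.trans (hL.1 u hu).2⟩

lemma length_flatMap_le {α : Type*} {L : List α} {f : α → List α} {K N : ℕ}
    (hL : L.length ≤ K) (h : ∀ w ∈ L, (f w).length ≤ N) : (L.flatMap f).length ≤ K * N := by
  refine le_trans ?_ (Nat.mul_le_mul_right N hL)
  rw [List.length_flatMap]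
  refine (List.sum_le_card_nsmul _ N ?_).trans (by simp)
  intro x hx
  obtain ⟨w, hw, rfl⟩ := List.mem_map.1 hx
  exact h w hw

/-- A point in the interior of an edge splits a simplex in two. -/
lemma refines_edge {v : Vertices d d} (hv : AffineIndependent ℝ v)
    {i j : Fin (d + 1)} (hij : i ≠ j) {t : ℝ} (ht0 : 0 < t) (ht : t < 1) :
    Refines v [Function.update v i (AffineMap.lineMap (v i) (v j) t),
      Function.update v j (AffineMap.lineMap (v i) (v j) t)] := by
  set b := simplexBasis v hv
  have hrw : AffineMap.lineMap (v i) (v j) t = AffineMap.lineMap (v j) (v i) (1 - t) := by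
    rw [AffineMap.lineMap_apply_one_sub]
  have h1 := fun x => mem_hull_update_lineMap hv hij ht0.le ht x
  have h2 := fun x => mem_hull_update_lineMap hv hij.symm (t := 1 - t) (by linarith) (by linarith) x
  rw [← hrw] at h2
  simp only [sub_sub_cancel] at h2
  refine ⟨?_, ?_⟩
  · simp only [List.mem_cons, List.not_mem_nil, or_false, forall_eq_or_imp, forall_eq]
    refine ⟨⟨affineIndependent_update_lineMap hv hij ht, fun x hx => ((h1 x).1 hx).1⟩,
      ?_, fun x hx => ((h2 x).1 hx).1⟩
    rw [hrw]
    exact affineIndependent_update_lineMap hv hij.symm (by linarith)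
  · have hne : t • b.coord i - (1 - t) • b.coord j ≠ 0 := by
      intro h0
      have := DFunLike.congr_fun h0 (v i)
      have h3 : b.coord i (v i) = 1 := b.coord_apply_eq i
      have h4 : b.coord j (v i) = 0 := b.coord_apply_ne hij.symm
      simp [h3, h4] at this
      exact ht0.ne' this
    filter_upwards [ae_affine_ne_zero _ hne] with x hx
    have hx' : t * b.coord i x ≠ (1 - t) * b.coord j x := by
      intro h; apply hx; simp [h]
    simp only [List.map_cons, List.map_nil, List.sum_cons, List.sum_nil, add_zero, Pi.add_apply]
    by_cases hxv : x ∈ hull v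
    · rw [ind_apply_of_mem hxv]
      rcases lt_or_gt_of_ne hx' with h | h
      · rw [ind_apply_of_mem ((h1 x).2 ⟨hxv, h.le⟩), ind_apply_of_notMem, add_zero]
        exact fun hh => absurd ((h2 x).1 hh).2 (not_le.2 h)
      · rw [ind_apply_of_mem ((h2 x).2 ⟨hxv, h.le⟩), ind_apply_of_notMem, zero_add]
        exact fun hh => absurd ((h1 x).1 hh).2 (not_le.2 h)
    · rw [ind_apply_of_notMem hxv, ind_apply_of_notMem fun h => hxv ((h1 x).1 h).1,
        ind_apply_of_notMem fun h => hxv ((h2 x).1 h).1, add_zero]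

/-- An affine function has constant sign on a set. -/
def OneSided (l : E d →ᵃ[ℝ] ℝ) (K : Set (E d)) : Prop :=
  (∀ x ∈ K, 0 ≤ l x) ∨ ∀ x ∈ K, l x ≤ 0

lemma OneSided.mono {l : E d →ᵃ[ℝ] ℝ} {K K' : Set (E d)} (h : OneSided l K) (hK : K' ⊆ K) :
    OneSided l K' :=
  h.imp (fun h x hx => h x (hK hx)) fun h x hx => h x (hK hx)

lemma convex_affine_nonneg (l : E d →ᵃ[ℝ] ℝ) : Convex ℝ {x | 0 ≤ l x} :=
  (convex_Ici (0 : ℝ)).affine_preimage l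

lemma convex_affine_nonpos (l : E d →ᵃ[ℝ] ℝ) : Convex ℝ {x | l x ≤ 0} :=
  (convex_Iic (0 : ℝ)).affine_preimage l

/-- A simplex is cut by a hyperplane into simplices on either side of it: splitting an edge that
crosses the hyperplane at its crossing point lowers the number of vertices off the hyperplane. -/
lemma exists_cut_aux (l : E d →ᵃ[ℝ] ℝ) (n : ℕ) : ∀ v : Vertices d d, AffineIndependent ℝ v →
    (Finset.univ.filter fun k => l (v k) ≠ 0).card ≤ n →
    ∃ L, Refines v L ∧ L.length ≤ 2 ^ n ∧ ∀ w ∈ L, OneSided l (hull w) := by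
  induction n with
  | zero =>
    intro v hv hn
    refine ⟨[v], Refines.refl hv, by simp, ?_⟩
    simp only [List.mem_singleton, forall_eq]
    left
    refine (hull_subset_iff v (convex_affine_nonneg l)).2 fun i => ?_
    have := Finset.card_eq_zero.1 (Nat.le_zero.1 hn)
    rw [Finset.filter_eq_empty_iff] at this
    have := this (Finset.mem_univ i)
    rw [not_not] at this
    simp [this]
  | succ n ih =>
    intro v hv hn
    by_cases hpos : ∀ k, 0 ≤ l (v k)
    · refine ⟨[v], Refines.refl hv, by simp [Nat.one_le_two_pow], ?_⟩
      simp only [List.mem_singleton, forall_eq]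
      exact Or.inl ((hull_subset_iff v (convex_affine_nonneg l)).2 hpos)
    by_cases hneg : ∀ k, l (v k) ≤ 0
    · refine ⟨[v], Refines.refl hv, by simp [Nat.one_le_two_pow], ?_⟩
      simp only [List.mem_singleton, forall_eq]
      exact Or.inr ((hull_subset_iff v (convex_affine_nonpos l)).2 hneg)
    push Not at hpos hneg
    obtain ⟨j, hj⟩ := hpos
    obtain ⟨i, hi⟩ := hneg
    have hij : i ≠ j := by rintro rfl; linarith
    -- the parameter at which the edge from `v i` to `v j` meets the hyperplane
    set t := l (v i) / (l (v i) - l (v j)) with ht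
    have hden : 0 < l (v i) - l (v j) := by linarith
    have ht0 : 0 < t := div_pos hi hden
    have ht1 : t < 1 := by rw [ht, div_lt_one hden]; linarith
    have hlp : l (AffineMap.lineMap (v i) (v j) t) = 0 := by
      rw [AffineMap.apply_lineMap, AffineMap.lineMap_apply]
      simp only [vsub_eq_sub, smul_eq_mul, vadd_eq_add, ht]
      field_simp; ring
    have hcard : ∀ m, l (v m) ≠ 0 → (Finset.univ.filter fun k =>
        l (Function.update v m (AffineMap.lineMap (v i) (v j) t) k) ≠ 0).card ≤ n := by
      intro m hm
      have hlt : (Finset.univ.filter fun k =>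
        l (Function.update v m (AffineMap.lineMap (v i) (v j) t) k) ≠ 0).card <
          (Finset.univ.filter fun k => l (v k) ≠ 0).card := by
        refine Finset.card_lt_card (Finset.ssubset_iff_of_subset ?_ |>.2 ⟨m, by simpa using hm, ?_⟩)
        · intro k hk
          simp only [Finset.mem_filter, Finset.mem_univ, true_and] at hk ⊢
          by_cases hkm : k = m
          · subst hkm; exact hm
          · rwa [Function.update_of_ne hkm] at hk
        · simp [hlp]
      omega
    have href := refines_edge hv hij ht0 ht1
    obtain ⟨L1, h11, h12, h13⟩ := ih _ (href.1 _ (by simp)).1 (hcard i hi.ne')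
    obtain ⟨L2, h21, h22, h23⟩ := ih _ (href.1 (Function.update v j _) (by simp)).1 (hcard j hj.ne)
    refine ⟨L1 ++ L2, ⟨?_, ?_⟩, ?_, ?_⟩
    · intro w hw
      rcases List.mem_append.1 hw with h | h
      · exact ⟨(h11.1 w h).1, (h11.1 w h).2.trans (href.1 _ (by simp)).2⟩
      · exact ⟨(h21.1 w h).1, (h21.1 w h).2.trans (href.1 (Function.update v j _) (by simp)).2⟩
    · rw [List.map_append, List.sum_append]
      refine (h11.2.add h21.2).trans ?_
      have := href.2
      simpa using this
    · rw [List.length_append, pow_succ]; omega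
    · intro w hw
      rcases List.mem_append.1 hw with h | h
      exacts [h13 w h, h23 w h]

lemma exists_cut (l : E d →ᵃ[ℝ] ℝ) {v : Vertices d d} (hv : AffineIndependent ℝ v) :
    ∃ L, Refines v L ∧ L.length ≤ 2 ^ (d + 1) ∧ ∀ w ∈ L, OneSided l (hull w) :=
  exists_cut_aux l (d + 1) v hv ((Finset.card_le_univ _).trans (by simp))

/-- Every simplex has a refinement all of whose members lie on one side of each of finitely many
hyperplanes. -/
lemma exists_refines_oneSided {v : Vertices d d} (hv : AffineIndependent ℝ v)
    (ls : List (E d →ᵃ[ℝ] ℝ)) :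
    ∃ L, Refines v L ∧ ∀ w ∈ L, ∀ l ∈ ls, OneSided l (hull w) := by
  induction ls with
  | nil => exact ⟨[v], Refines.refl hv, by simp⟩
  | cons l ls ih =>
    obtain ⟨L, h1, h2⟩ := ih
    choose! f hf using fun (w : Vertices d d) (hw : AffineIndependent ℝ w) => exists_cut l hw
    refine ⟨L.flatMap f, h1.flatMap fun w hw => (hf w (h1.1 w hw).1).1, fun w hw m hm => ?_⟩
    obtain ⟨u, hu, hwu⟩ := List.mem_flatMap.1 hw
    have h3 := hf u (h1.1 u hu).1
    rcases List.mem_cons.1 hm with rfl | h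
    · exact h3.2.2 w hwu
    · exact (h2 u hu m h).mono (h3.1.1 w hwu).2

/-- The intersection of a simplex with finitely many half-spaces is a union of boundedly many
nonoverlapping simplices. -/
lemma exists_decomp_inter {v : Vertices d d} (hv : AffineIndependent ℝ v)
    (ls : List (E d →ᵃ[ℝ] ℝ)) (hls : ∀ l ∈ ls, l ≠ 0) :
    ∃ L : List (Vertices d d), L.length ≤ (2 ^ (d + 1)) ^ ls.length ∧
      (∀ w ∈ L, AffineIndependent ℝ w ∧ hull w ⊆ hull v ∩ {x | ∀ l ∈ ls, 0 ≤ l x}) ∧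
      (L.map ind).sum =ᵐ[volume] (hull v ∩ {x | ∀ l ∈ ls, 0 ≤ l x}).indicator 1 := by
  classical
  induction ls with
  | nil => exact ⟨[v], by simp, by simp [hv], by simp [ind]⟩
  | cons l ls ih =>
    obtain ⟨L, h1, h2, h3⟩ := ih fun m hm => hls m (by simp [hm])
    choose! f hf using fun (w : Vertices d d) (hw : AffineIndependent ℝ w) => exists_cut l hw
    set g : Vertices d d → List (Vertices d d) := fun w =>
      (f w).filter fun u => decide (∀ x ∈ hull u, 0 ≤ l x) with hg
    refine ⟨L.flatMap g, ?_, fun w hw => ?_, ?_⟩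
    · rw [List.length_cons, pow_succ]
      refine length_flatMap_le h1 fun w hw => ?_
      exact (List.length_filter_le _ _).trans (hf w (h2 w hw).1).2.1
    · obtain ⟨u, hu, hwu⟩ := List.mem_flatMap.1 hw
      simp only [hg, List.mem_filter, decide_eq_true_eq] at hwu
      have h4 := (hf u (h2 u hu).1).1.1 w hwu.1
      refine ⟨h4.1, fun x hx => ⟨((h2 u hu).2 (h4.2 hx)).1, ?_⟩⟩
      simp only [List.mem_cons, forall_eq_or_imp, mem_ofPred_eq]
      exact ⟨hwu.2 x hx, ((h2 u hu).2 (h4.2 hx)).2⟩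
    · have h5 : ∀ w ∈ L, ((g w).map ind).sum =ᵐ[volume]
          fun x => if 0 ≤ l x then ind w x else 0 := by
        intro w hw
        have h6 := hf w (h2 w hw).1
        filter_upwards [h6.1.2, ae_affine_ne_zero l (hls l (by simp))] with x hx hlx
        rw [← hx]
        by_cases hl : 0 ≤ l x
        · rw [if_pos hl, list_sum_ind_apply, list_sum_ind_apply]
          simp only [hg]
          have : ∀ u ∈ f w, ind u x = if (∀ x ∈ hull u, 0 ≤ l x) then ind u x else 0 := by
            intro u hu
            split_ifs with h
            · rfl
            · refine ind_apply_of_notMem fun hxu => ?_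
              rcases h6.2.2 u hu with h7 | h7
              · exact h h7
              · exact hlx (le_antisymm (h7 x hxu) hl)
          rw [List.map_congr_left this, List.sum_map_ite]
          simp
        · rw [if_neg hl]
          refine list_sum_ind_eq_zero fun u hu hxu => ?_
          simp only [hg, List.mem_filter, decide_eq_true_eq] at hu
          exact hl (hu.2 x hxu)
      refine (ae_flatMap h5).trans ?_
      filter_upwards [h3] with x hx
      have h8 : (L.map fun (w : Vertices d d) (x : E d) => if 0 ≤ l x then ind w x else 0).sum x =
          if 0 ≤ l x then (L.map ind).sum x else 0 := by
        clear h1 h2 h3 h5 hx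
        induction L with
        | nil => simp
        | cons a L ih =>
          simp only [List.map_cons, List.sum_cons, Pi.add_apply, ih]
          split_ifs <;> simp
      rw [h8, hx]
      simp only [indicator, mem_inter_iff, mem_ofPred_eq, List.mem_cons, forall_eq_or_imp,
        Pi.one_apply]
      split_ifs <;> tauto

/-! ### Cochains respect linear relations between indicator functions -/

/-- Arbitrarily large simplices exist. -/
lemma exists_hull_superset {K : Set (E d)} (hK : Bornology.IsBounded K) :
    ∃ v : Vertices d d, AffineIndependent ℝ v ∧ K ⊆ hull v := by
  set v₀ : Vertices d d := Fin.cons 0 fun i => EuclideanSpace.single i 1 with hv₀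
  have h₀ : AffineIndependent ℝ v₀ := by
    rw [affineIndependent_iff_edgeDet]
    have : (Matrix.of fun i j : Fin d => v₀ i.succ j - v₀ 0 j) = 1 := by
      ext i j
      simp [hv₀, Matrix.one_apply, eq_comm]
    rw [edgeDet, this, Matrix.det_one]
    exact one_ne_zero
  obtain ⟨c, hc⟩ := nonempty_interior_hull v₀ h₀
  obtain ⟨r, hr, hball⟩ := Metric.isOpen_iff.1 isOpen_interior c hc
  obtain ⟨R, hR, hKR⟩ := hK.subset_ball_lt 0 c
  have hne : R / r ≠ 0 := (div_pos hR hr).ne'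
  refine ⟨AffineMap.homothety c (R / r) ∘ v₀, h₀.map' _ ?_, ?_⟩
  · intro x y hxy
    simpa [AffineMap.homothety_apply, hR.ne', hr.ne'] using hxy
  · rw [hull, range_comp, ← AffineMap.image_convexHull]
    intro x hx
    refine ⟨AffineMap.homothety c (r / R) x, interior_subset (hball ?_), ?_⟩
    · have := hKR hx
      rw [Metric.mem_ball, dist_eq_norm] at this ⊢
      simp only [AffineMap.homothety_apply, vsub_eq_sub, vadd_eq_add, add_sub_cancel_right,
        norm_smul, Real.norm_eq_abs, abs_of_pos (div_pos hr hR)]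
      calc r / R * ‖x - c‖ < r / R * R := by gcongr
        _ = r := by field_simp
    · simp only [AffineMap.homothety_apply, vsub_eq_sub, vadd_eq_add, add_sub_cancel_right,
        smul_smul]
      rw [div_mul_div_comm, mul_comm, div_self (mul_pos hr hR).ne']
      simp

lemma sum_map_filter {α : Type*} (L : List α) (p : α → Prop) [DecidablePred p] (f : α → ℝ) :
    ((L.filter fun a => decide (p a)).map f).sum = (L.map fun a => if p a then f a else 0).sum := by
  rw [List.sum_map_ite]; simp

/-- A cochain extends to a linear functional on the span of the indicator functions of simplices,
taken up to null sets. -/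
theorem linearCombination_posVal_eq_zero (hd : 1 ≤ d) {A : Vertices d d → ℝ} (hA : A ∈ Cochain d d)
    (c : Vertices d d →₀ ℝ) (h : Finsupp.linearCombination ℝ ind c =ᵐ[volume] 0) :
    Finsupp.linearCombination ℝ (posVal A) c = 0 := by
  classical
  set S := c.support.filter fun v => AffineIndependent ℝ v with hS
  have hSA : ∀ v ∈ S, AffineIndependent ℝ v := fun v hv => (Finset.mem_filter.1 hv).2
  -- the barycentric coordinates of the simplices involved
  set co : Vertices d d → Fin (d + 1) → (E d →ᵃ[ℝ] ℝ) := fun v i =>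
    if hv : AffineIndependent ℝ v then (simplexBasis v hv).coord i else 0 with hco
  have hmem : ∀ v ∈ S, ∀ x, x ∈ hull v ↔ ∀ i, 0 ≤ co v i x := by
    intro v hv x
    simp only [hco, dif_pos (hSA v hv), hull_eq_coord v (hSA v hv), mem_ofPred_eq]
  have hcone : ∀ v ∈ S, ∀ i, co v i ≠ 0 := by
    intro v hv i h0
    have h1 := (simplexBasis v (hSA v hv)).coord_apply_eq i
    simp only [hco, dif_pos (hSA v hv)] at h0
    simp [h0] at h1
  -- a big simplex, cut into pieces none of which crosses a facet hyperplane of these simplices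
  obtain ⟨T, hT, hTs⟩ := exists_hull_superset (d := d) (K := ⋃ v ∈ S, hull v)
    ((Bornology.isBounded_biUnion S.finite_toSet).2 fun v _ => (isCompact_hull v).isBounded)
  obtain ⟨L, hL, hside⟩ := exists_refines_oneSided hT
    (S.toList.flatMap fun v => (List.finRange (d + 1)).map (co v))
  replace hside : ∀ w ∈ L, ∀ v ∈ S, ∀ i, OneSided (co v i) (hull w) := fun w hw v hv i =>
    hside w hw _ (List.mem_flatMap.2 ⟨v, by simpa using hv, List.mem_map.2 ⟨i, by simp, rfl⟩⟩)
  -- each piece is contained in, or almost disjoint from, each of the simplices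
  have hgood : ∀ᵐ x : E d, ∀ v ∈ S, ∀ w ∈ L, x ∈ hull w → (x ∈ hull v ↔ hull w ⊆ hull v) := by
    have h1 : ∀ᵐ x : E d, ∀ v ∈ S, ∀ i, co v i x ≠ 0 := by
      rw [Filter.eventually_all_finset]
      intro v hv
      rw [ae_all_iff]
      exact fun i => ae_affine_ne_zero _ (hcone v hv i)
    filter_upwards [h1] with x hx v hv w hw hxw
    refine ⟨fun hxv y hy => (hmem v hv y).2 fun i => ?_, fun hwv => hwv hxw⟩
    rcases hside w hw v hv i with h2 | h2
    · exact h2 y hy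
    · exact absurd (le_antisymm (h2 x hxw) ((hmem v hv x).1 hxv i)) (hx v hv i)
  have hval : ∀ v ∈ S, posVal A v =
      (L.map fun w => if hull w ⊆ hull v then posVal A w else 0).sum := by
    intro v hv
    rw [← sum_map_filter]
    refine posVal_eq_sum hd hA (hSA v hv) _ (fun w hw => ?_) ?_
    · simp only [List.mem_filter, decide_eq_true_eq] at hw
      exact ⟨(hL.1 w hw.1).1, hw.2⟩
    · filter_upwards [hgood, hL.2] with x hx hLx
      by_cases hxv : x ∈ hull v
      · rw [ind_apply_of_mem hxv, ← ind_apply_of_mem (hTs (mem_biUnion hv hxv)), ← hLx,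
          list_sum_ind_apply, list_sum_ind_apply, sum_map_filter]
        congr 1
        refine List.map_congr_left fun w hw => ?_
        split_ifs with hwv
        · rfl
        · exact (ind_apply_of_notMem fun hxw => hwv ((hx v hv w hw hxw).1 hxv)).symm
      · rw [ind_apply_of_notMem hxv]
        refine list_sum_ind_eq_zero fun w hw hxw => ?_
        simp only [List.mem_filter, decide_eq_true_eq] at hw
        exact hxv (hw.2 hxw)
  -- evaluate the relation at a generic point of the piece `w`
  have hcoef : ∀ w ∈ L, ∑ v ∈ S, c v * (if hull w ⊆ hull v then 1 else 0) = 0 := by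
    intro w hw
    have hfreq := (frequently_ae_mem_iff (μ := (volume : Measure (E d)))).2
      (volume_hull_pos w (hL.1 w hw).1).ne'
    have hind : ∀ᵐ x : E d, ∀ v ∈ c.support \ S, ind v x = 0 := by
      rw [Filter.eventually_all_finset]
      intro v hv
      rw [Finset.mem_sdiff, hS, Finset.mem_filter, not_and] at hv
      have := volume_hull_of_not_affineIndependent v (hv.2 hv.1)
      filter_upwards [measure_eq_zero_iff_ae_notMem.1 this] with x hx
      exact ind_apply_of_notMem hx
    obtain ⟨x, hxw, hx1, hx2, hx3⟩ := (hfreq.and_eventually (hgood.and (hind.and h))).exists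
    rw [Finsupp.linearCombination_apply, Finsupp.sum, Finset.sum_apply,
      ← Finset.sum_subset (Finset.filter_subset (fun v => AffineIndependent ℝ v) c.support)] at hx3
    · rw [Pi.zero_apply] at hx3
      refine (Finset.sum_congr rfl fun v hv => ?_).trans hx3
      simp only [Pi.smul_apply, smul_eq_mul]
      congr 1
      split_ifs with hwv
      · exact (ind_apply_of_mem (hwv hxw)).symm
      · exact (ind_apply_of_notMem fun hxv => hwv ((hx1 v hv w hw hxw).1 hxv)).symm
    · intro v hv hv'
      simp [hx2 v (Finset.mem_sdiff.2 ⟨hv, hv'⟩)]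
  rw [Finsupp.linearCombination_apply, Finsupp.sum,
    ← Finset.sum_subset (Finset.filter_subset (fun v => AffineIndependent ℝ v) c.support)]
  · calc ∑ v ∈ S, c v • posVal A v
        = ∑ v ∈ S, ∑ n : Fin L.length,
            posVal A (L.get n) * (c v * (if hull (L.get n) ⊆ hull v then 1 else 0)) := by
          refine Finset.sum_congr rfl fun v hv => ?_
          rw [hval v hv, list_sum_map_eq, smul_eq_mul, Finset.mul_sum]
          refine Finset.sum_congr rfl fun n _ => ?_
          split_ifs <;> ring
      _ = 0 := by
          rw [Finset.sum_comm]
          refine Finset.sum_eq_zero fun n _ => ?_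
          rw [← Finset.mul_sum, hcoef _ (List.get_mem L n), mul_zero]
  · intro v hv hv'
    rw [posVal_of_not A, smul_zero]
    intro hAI
    exact hv' (Finset.mem_filter.2 ⟨hv, hAI⟩)

/-! ### Oriented boxes and their standard triangulation -/

lemma sign_prod {ι : Type*} (s : Finset ι) (f : ι → ℝ) :
    (SignType.sign (∏ i ∈ s, f i) : ℝ) = ∏ i ∈ s, (SignType.sign (f i) : ℝ) := by
  classical
  induction s using Finset.induction_on with
  | empty => simp
  | insert a s ha ih => rw [Finset.prod_insert ha, Finset.prod_insert ha, sign_mul,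
      SignType.coe_mul, ih]

lemma boxVertices_apply (w u : E d) (s : Equiv.Perm (Fin d)) (j : Fin (d + 1)) (c : Fin d) :
    boxVertices w u s j c = if (s.symm c : ℕ) < (j : ℕ) then u c else w c := rfl

lemma edgeDet_boxVertices (w u : E d) (s : Equiv.Perm (Fin d)) :
    edgeDet (boxVertices w u s) = ((Equiv.Perm.sign s : ℤ) : ℝ) * ∏ i, (u i - w i) := by
  set T : Matrix (Fin d) (Fin d) ℝ := Matrix.of fun i k => if k ≤ i then 1 else 0 with hT
  have h : (Matrix.of fun i j : Fin d => boxVertices w u s i.succ j - boxVertices w u s 0 j) =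
      Matrix.of fun i j => (u j - w j) * (T.submatrix id s.symm) i j := by
    ext i j
    simp only [Matrix.of_apply, boxVertices_apply, Matrix.submatrix_apply, hT, id, Fin.val_succ,
      Fin.val_zero, Nat.not_lt_zero, if_false, Fin.le_def, Nat.lt_succ_iff]
    split_ifs <;> simp
  have hTdet : T.det = 1 := by
    rw [Matrix.det_of_isLowerTriangular]
    · simp [hT]
    · intro i j hij
      simp only [OrderDual.toDual_lt_toDual] at hij
      simp [hT, hij]
  rw [edgeDet, h, Matrix.det_mul_row, Matrix.det_permute', hTdet, Equiv.Perm.sign_symm]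
  ring

lemma boxValue_eq_posVal {A : Vertices d d → ℝ} (hA : A ∈ Cochain d d) (w u : E d) :
    boxValue A w u = ∑ s : Equiv.Perm (Fin d),
      (SignType.sign (∏ i, (u i - w i)) : ℝ) * posVal A (boxVertices w u s) := by
  refine Finset.sum_congr rfl fun s _ => ?_
  rw [eq_sign_mul_posVal hA (boxVertices w u s), edgeDet_boxVertices, sign_intCast_mul]
  have : ((Equiv.Perm.sign s : ℤ) : ℝ) * ((Equiv.Perm.sign s : ℤ) : ℝ) = 1 := by
    rcases Int.units_eq_one_or (Equiv.Perm.sign s) with h | h <;> simp [h]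
  linear_combination (SignType.sign (∏ i, (u i - w i)) : ℝ) * posVal A (boxVertices w u s) * this

/-- The standard triangulation of an oriented box as a formal combination of simplices. -/
def boxChain (w u : E d) : Vertices d d →₀ ℝ :=
  ∑ s : Equiv.Perm (Fin d),
    Finsupp.single (boxVertices w u s) (SignType.sign (∏ i, (u i - w i)) : ℝ)

lemma boxValue_eq_linearCombination {A : Vertices d d → ℝ} (hA : A ∈ Cochain d d) (w u : E d) :
    boxValue A w u = Finsupp.linearCombination ℝ (posVal A) (boxChain w u) := by
  simp [boxChain, boxValue_eq_posVal hA, map_sum, Finsupp.linearCombination_single]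

/-- The Heaviside function jumping at `a`. -/
def step (a x : ℝ) : ℝ := if a < x then 1 else 0

/-- The signed indicator function of the oriented box with opposite corners `w` and `u`. -/
def boxFun (w u : E d) (x : E d) : ℝ := ∏ i, (step (w i) (x i) - step (u i) (x i))

/-- The affine coordinate that equals `0` at `w` and `1` at `u` in direction `i`. -/
def relCoord (w u : E d) (i : Fin d) : E d →ᵃ[ℝ] ℝ :=
  (u i - w i)⁻¹ • ((EuclideanSpace.proj i : E d →L[ℝ] ℝ).toLinearMap.toAffineMap -
    AffineMap.const ℝ (E d) (w i))

lemma relCoord_apply (w u : E d) (i : Fin d) (x : E d) :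
    relCoord w u i x = (x i - w i) / (u i - w i) := by
  simp [relCoord, div_eq_inv_mul]

lemma relCoord_boxVertices {w u : E d} (h : ∀ i, u i ≠ w i) (s : Equiv.Perm (Fin d))
    (j : Fin (d + 1)) (c : Fin d) :
    relCoord w u c (boxVertices w u s j) = if (s.symm c : ℕ) < (j : ℕ) then 1 else 0 := by
  rw [relCoord_apply, boxVertices_apply]
  have := sub_ne_zero.2 (h c)
  split_ifs <;> simp [this]

lemma sum_range_ite_sub (τ : ℕ → ℝ) (k n : ℕ) (hk : k < n) :
    ∑ j ∈ Finset.range n, (if k < j then τ j - τ (j + 1) else 0) = τ (k + 1) - τ n := by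
  induction n with
  | zero => omega
  | succ n ih =>
    rw [Finset.sum_range_succ]
    rcases Nat.lt_succ_iff_lt_or_eq.1 hk with h | h
    · rw [ih h, if_pos h]; ring
    · subst h
      rw [if_neg (lt_irrefl _), Finset.sum_eq_zero]
      · simp
      · intro j hj
        rw [if_neg]
        have := Finset.mem_range.1 hj
        omega

lemma mem_hull_boxVertices {w u : E d} (h : ∀ i, u i ≠ w i) (s : Equiv.Perm (Fin d)) (x : E d) :
    x ∈ hull (boxVertices w u s) ↔ (∀ i, 0 ≤ relCoord w u i x ∧ relCoord w u i x ≤ 1) ∧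
      Antitone fun k => relCoord w u (s k) x := by
  constructor
  · have hconv : Convex ℝ {x | (∀ i, 0 ≤ relCoord w u i x ∧ relCoord w u i x ≤ 1) ∧
        Antitone fun k => relCoord w u (s k) x} := by
      intro x hx y hy a c ha hc hac
      refine ⟨fun i => ?_, fun k l hkl => ?_⟩
      · rw [Convex.combo_affine_apply hac]
        have h1 := hx.1 i
        have h2 := hy.1 i
        simp only [smul_eq_mul]
        constructor
        · have := mul_nonneg ha h1.1
          have := mul_nonneg hc h2.1
          linarith
        · nlinarith
      · simp only []
        rw [Convex.combo_affine_apply hac, Convex.combo_affine_apply hac]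
        have h1 := hx.2 hkl
        have h2 := hy.2 hkl
        simp only [smul_eq_mul] at h1 h2 ⊢
        nlinarith
    refine fun hx => (hull_subset_iff _ hconv).2 (fun j => ?_) hx
    refine ⟨fun i => ?_, fun k l hkl => ?_⟩
    · rw [relCoord_boxVertices h]; split_ifs <;> simp
    · simp only [relCoord_boxVertices h, Equiv.symm_apply_apply]
      have : (k : ℕ) ≤ l := hkl
      split_ifs <;> first | omega | simp
  · rintro ⟨h1, h2⟩
    set τ : ℕ → ℝ := fun n => match n with
      | 0 => 1
      | k + 1 => if hk : k < d then relCoord w u (s ⟨k, hk⟩) x else 0 with hτ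
    have hτ0 : τ 0 = 1 := rfl
    have hτs : ∀ k (hk : k < d), τ (k + 1) = relCoord w u (s ⟨k, hk⟩) x := fun k hk => by
      simp [hτ, hk]
    have hτd : τ (d + 1) = 0 := by simp [hτ]
    have hanti : ∀ j : Fin (d + 1), 0 ≤ τ j - τ (j + 1) := by
      rintro ⟨j, hj⟩
      simp only []
      rcases Nat.lt_succ_iff_lt_or_eq.1 hj with hjd | rfl
      · rw [hτs j hjd]
        cases j with
        | zero => rw [hτ0]; linarith [(h1 (s ⟨0, hjd⟩)).2]
        | succ k =>
          rw [hτs k (by omega)]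
          have := h2 (show (⟨k, by omega⟩ : Fin d) ≤ ⟨k + 1, hjd⟩ by simp [Fin.le_def])
          simp only [] at this
          linarith
      · rw [hτd]
        cases j with
        | zero => rw [hτ0]; norm_num
        | succ k => rw [hτs k (by omega)]; linarith [(h1 (s ⟨k, by omega⟩)).1]
    have hsum : ∑ j : Fin (d + 1), (τ j - τ (j + 1)) = 1 := by
      rw [Fin.sum_univ_eq_sum_range (fun j => τ j - τ (j + 1)), Finset.sum_range_sub', hτ0, hτd,
        sub_zero]
    have hmem := (convex_hull (boxVertices w u s)).sum_mem (fun j _ => hanti j) hsum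
      (fun j _ => vertex_mem_hull _ j)
    convert hmem using 1
    ext c
    simp only [WithLp.ofLp_sum, WithLp.ofLp_smul, Finset.sum_apply, Pi.smul_apply, smul_eq_mul,
      boxVertices_apply]
    have h3 : ∀ j : Fin (d + 1), (τ j - τ (j + 1)) *
        (if (s.symm c : ℕ) < (j : ℕ) then u c else w c) = (τ j - τ (j + 1)) * w c +
        (u c - w c) * (if (s.symm c : ℕ) < (j : ℕ) then τ j - τ (j + 1) else 0) := by
      intro j; split_ifs <;> ring
    rw [Finset.sum_congr rfl fun j _ => h3 j, Finset.sum_add_distrib, ← Finset.sum_mul, hsum,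
      ← Finset.mul_sum, Fin.sum_univ_eq_sum_range
        (fun j => if (s.symm c : ℕ) < j then τ j - τ (j + 1) else 0),
      sum_range_ite_sub _ _ _ (by omega), hτd, hτs _ (s.symm c).2, relCoord_apply]
    have := sub_ne_zero.2 (h c)
    simp only [Fin.eta, Equiv.apply_symm_apply, sub_zero]
    field_simp
    ring

lemma sign_mul_ite_eq_step_sub {a b x : ℝ} (h : b ≠ a) (hxa : x ≠ a) (hxb : x ≠ b) :
    (SignType.sign (b - a) : ℝ) * (if 0 ≤ (x - a) / (b - a) ∧ (x - a) / (b - a) ≤ 1 then 1 else 0) =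
      step a x - step b x := by
  rcases lt_or_gt_of_ne h with hlt | hlt
  · have hd : b - a < 0 := sub_neg.2 hlt
    rw [sign_neg hd]
    simp only [step, div_nonneg_iff, div_le_one_of_neg hd]
    rcases lt_or_gt_of_ne hxa with h3 | h3 <;> rcases lt_or_gt_of_ne hxb with h4 | h4
    · rw [if_neg (by rintro ⟨_, h⟩; linarith), if_neg (by linarith), if_neg (by linarith)]; simp
    · rw [if_pos ⟨Or.inr ⟨by linarith, by linarith⟩, by linarith⟩, if_neg (by linarith),
        if_pos (by linarith)]; simp
    · linarith
    · rw [if_neg (by rintro ⟨h | h, _⟩ <;> linarith [h.1, h.2]), if_pos (by linarith),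
        if_pos (by linarith)]; simp
  · have hd : 0 < b - a := sub_pos.2 hlt
    rw [sign_pos hd]
    simp only [step, div_nonneg_iff, div_le_one hd]
    rcases lt_or_gt_of_ne hxa with h3 | h3 <;> rcases lt_or_gt_of_ne hxb with h4 | h4
    · rw [if_neg (by rintro ⟨h | h, _⟩ <;> linarith [h.1, h.2]), if_neg (by linarith),
        if_neg (by linarith)]; simp
    · linarith
    · rw [if_pos ⟨Or.inl ⟨by linarith, by linarith⟩, by linarith⟩, if_pos (by linarith),
        if_neg (by linarith)]; simp
    · rw [if_neg (by rintro ⟨_, h⟩; linarith), if_pos (by linarith), if_pos (by linarith)]; simp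

lemma sum_antitone_perm {θ : Fin d → ℝ} (hθ : Function.Injective θ) [∀ s : Equiv.Perm (Fin d),
    Decidable (Antitone fun k => θ (s k))] :
    ∑ s : Equiv.Perm (Fin d), (if Antitone fun k => θ (s k) then (1 : ℝ) else 0) = 1 := by
  have h : ∀ s : Equiv.Perm (Fin d), (Antitone fun k => θ (s k)) ↔
      s = Tuple.sort fun i => - θ i := by
    intro s
    rw [Tuple.eq_sort_iff]
    constructor
    · intro h
      refine ⟨fun i j hij => neg_le_neg (h hij), fun i j hij he => ?_⟩
      exact absurd (s.injective (hθ (neg_injective he))) hij.ne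
    · intro h i j hij
      exact neg_le_neg_iff.1 (h.1 hij)
  simp only [h]
  rw [Finset.sum_ite_eq']
  simp

/-- Almost every point of a box lies in exactly one simplex of the standard triangulation: the one
whose permutation sorts the relative coordinates of the point. -/
lemma ae_linearCombination_boxChain (w u : E d) :
    Finsupp.linearCombination ℝ ind (boxChain w u) =ᵐ[volume] boxFun w u := by
  classical
  have hcomb : ∀ x, Finsupp.linearCombination ℝ ind (boxChain w u) x =
      (∏ i, (SignType.sign (u i - w i) : ℝ)) * ∑ s, ind (boxVertices w u s) x := by
    intro x
    simp only [boxChain, map_sum, Finsupp.linearCombination_single, Finset.sum_apply,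
      Pi.smul_apply, smul_eq_mul, Finset.mul_sum, sign_prod]
  by_cases h : ∀ i, u i ≠ w i
  swap
  · push Not at h
    obtain ⟨i, hi⟩ := h
    refine Filter.Eventually.of_forall fun x => ?_
    rw [hcomb, boxFun, Finset.prod_eq_zero (Finset.mem_univ i) (by simp [hi]),
      Finset.prod_eq_zero (Finset.mem_univ i) (by simp [hi]), zero_mul]
  set θ := relCoord w u with hθ
  set p : Fin d → E d := fun i => w + EuclideanSpace.single i (u i - w i) with hp
  have hpi : ∀ i, θ i (p i) = 1 := fun i => by
    have := sub_ne_zero.2 (h i)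
    simp [hθ, relCoord_apply, hp, this]
  have hpn : ∀ i j, j ≠ i → θ j (p i) = 0 := fun i j hij => by
    simp [hθ, relCoord_apply, hp, hij]
  have h0 : ∀ᵐ x : E d, ∀ i, θ i x ≠ 0 := by
    rw [ae_all_iff]
    refine fun i => ae_affine_ne_zero _ fun h0 => ?_
    have := hpi i
    simp [h0] at this
  have h1 : ∀ᵐ x : E d, ∀ i, θ i x ≠ 1 := by
    rw [ae_all_iff]
    intro i
    have := ae_affine_ne_zero (θ i - AffineMap.const ℝ (E d) 1) fun h0 => by
      have := DFunLike.congr_fun h0 w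
      simp [hθ, relCoord_apply] at this
    filter_upwards [this] with x hx h1
    exact hx (by simp [h1])
  have h2 : ∀ᵐ x : E d, ∀ i j, i ≠ j → θ i x ≠ θ j x := by
    rw [ae_all_iff]; intro i
    rw [ae_all_iff]; intro j
    by_cases hij : i = j
    · simp [hij]
    have := ae_affine_ne_zero (θ i - θ j) fun h0 => by
      have := DFunLike.congr_fun h0 (p i)
      rw [AffineMap.coe_sub, Pi.sub_apply, hpi, hpn _ _ (Ne.symm hij)] at this
      simp at this
    filter_upwards [this] with x hx _ h1
    exact hx (by simp [h1])
  filter_upwards [h0, h1, h2] with x hx0 hx1 hx2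
  rw [hcomb]
  have hinj : Function.Injective fun i => θ i x := fun i j hij => by
    by_contra hne
    exact hx2 i j hne hij
  have hsum : ∑ s, ind (boxVertices w u s) x =
      ∏ i, (if 0 ≤ θ i x ∧ θ i x ≤ 1 then (1 : ℝ) else 0) := by
    rw [Finset.prod_ite_zero]
    simp only [Finset.mem_univ, true_imp_iff, Finset.prod_const_one, ind, indicator,
      mem_hull_boxVertices h, Pi.one_apply]
    split_ifs with hall
    · refine (Finset.sum_congr rfl fun s _ => ?_).trans (sum_antitone_perm hinj)
      exact if_congr (and_iff_right hall) rfl rfl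
    · refine Finset.sum_eq_zero fun s _ => if_neg fun hh => hall hh.1
  rw [hsum, boxFun, ← Finset.prod_mul_distrib]
  refine Finset.prod_congr rfl fun i _ => ?_
  have hx0 := hx0 i
  have hx1 := hx1 i
  have hi := h i
  simp only [hθ, relCoord_apply] at hx0 hx1 ⊢
  refine sign_mul_ite_eq_step_sub (h i) (fun h => hx0 (by simp [h])) fun h => hx1 ?_
  rw [h]
  exact div_self (sub_ne_zero.2 hi)

/-- Linear relations between signed indicator functions of boxes carry over to the values of a
cochain. -/
lemma sum_boxValue_eq_zero (hd : 1 ≤ d) {A : Vertices d d → ℝ} (hA : A ∈ Cochain d d)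
    {ι : Type*} (s : Finset ι) (c : ι → ℝ) (w u : ι → E d)
    (h : ∀ᵐ x : E d, ∑ k ∈ s, c k * boxFun (w k) (u k) x = 0) :
    ∑ k ∈ s, c k * boxValue A (w k) (u k) = 0 := by
  have h1 : ∀ᵐ x : E d, ∀ k ∈ s,
      Finsupp.linearCombination ℝ ind (boxChain (w k) (u k)) x = boxFun (w k) (u k) x := by
    rw [Filter.eventually_all_finset]
    exact fun k _ => ae_linearCombination_boxChain (w k) (u k)
  have h2 := linearCombination_posVal_eq_zero hd hA (∑ k ∈ s, c k • boxChain (w k) (u k)) (by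
    filter_upwards [h, h1] with x hx hx1
    simp only [map_sum, map_smul, Finset.sum_apply, Pi.smul_apply, smul_eq_mul, Pi.zero_apply]
    rw [← hx]
    exact Finset.sum_congr rfl fun k hk => by rw [hx1 k hk])
  simp only [map_sum, map_smul, smul_eq_mul, ← boxValue_eq_linearCombination hA] at h2
  exact h2

lemma boxFun_split (w u m : E d) (i : Fin d) (hw : ∀ j, j ≠ i → m j = w j) (x : E d)
    (n : E d) (hn : ∀ j, j ≠ i → n j = u j) (hmn : m i = n i) :
    boxFun w u x = boxFun w n x + boxFun m u x := by
  simp only [boxFun]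
  rw [← Finset.mul_prod_erase _ _ (Finset.mem_univ i), ← Finset.mul_prod_erase _
    (fun i => step (w i) (x i) - step (n i) (x i)) (Finset.mem_univ i),
    ← Finset.mul_prod_erase _ (fun i => step (m i) (x i) - step (u i) (x i)) (Finset.mem_univ i)]
  have h1 : ∏ j ∈ Finset.univ.erase i, (step (w j) (x j) - step (n j) (x j)) =
      ∏ j ∈ Finset.univ.erase i, (step (w j) (x j) - step (u j) (x j)) :=
    Finset.prod_congr rfl fun j hj => by rw [hn j (Finset.ne_of_mem_erase hj)]
  have h2 : ∏ j ∈ Finset.univ.erase i, (step (m j) (x j) - step (u j) (x j)) =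
      ∏ j ∈ Finset.univ.erase i, (step (w j) (x j) - step (u j) (x j)) :=
    Finset.prod_congr rfl fun j hj => by rw [hw j (Finset.ne_of_mem_erase hj)]
  rw [h1, h2, hmn]
  ring

/-- The value of a cochain on boxes is additive when a box is cut across one coordinate
direction. -/
lemma boxValue_split (hd : 1 ≤ d) {A : Vertices d d → ℝ} (hA : A ∈ Cochain d d)
    (w u m n : E d) (i : Fin d) (hw : ∀ j, j ≠ i → m j = w j)
    (hn : ∀ j, j ≠ i → n j = u j) (hmn : m i = n i) :
    boxValue A w u = boxValue A w n + boxValue A m u := by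
  have h := sum_boxValue_eq_zero hd hA Finset.univ ![1, -1, -1] ![w, w, m] ![u, n, u] (by
    refine Filter.Eventually.of_forall fun x => ?_
    simp only [Fin.sum_univ_three, Matrix.cons_val_zero, Matrix.cons_val_one, Matrix.cons_val_two,
      Matrix.head_cons, Matrix.tail_cons]
    rw [boxFun_split w u m i hw x n hn hmn]; ring)
  simp only [Fin.sum_univ_three, Matrix.cons_val_zero, Matrix.cons_val_one, Matrix.cons_val_two,
      Matrix.head_cons, Matrix.tail_cons] at h
  linarith

lemma measurable_boxVertices (s : Equiv.Perm (Fin d)) :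
    Measurable fun p : E d × E d => boxVertices p.1 p.2 s := by
  refine measurable_pi_lambda _ fun j => ?_
  refine Continuous.measurable ?_
  refine (PiLp.continuous_toLp 2 _).comp (continuous_pi fun c => ?_)
  split_ifs <;> fun_prop

lemma measurable_boxValue {A : Vertices d d → ℝ} (hA : Measurable A) {X : Type*}
    [MeasurableSpace X] {f g : X → E d} (hf : Measurable f) (hg : Measurable g) :
    Measurable fun x => boxValue A (f x) (g x) := by
  refine Finset.measurable_sum _ fun s _ => Measurable.const_mul ?_ _
  exact hA.comp ((measurable_boxVertices s).comp (hf.prodMk hg))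

/-! ### Height, mass and volume of a simplex -/

lemma euclideanHausdorffMeasure_le_of_subset_closedBall {n : ℕ} {S : Set (E d)}
    (hn : Module.finrank ℝ (vectorSpan ℝ S) = n) {p : E d} (hp : p ∈ S) {r : ℝ} (hr : 0 ≤ r)
    (hS : S ⊆ Metric.closedBall p r) :
    μHE[n] S ≤ ENNReal.ofReal (r ^ n) * volume (Metric.ball (0 : E n) 1) := by
  set W := vectorSpan ℝ S
  set e : W ≃ₗᵢ[ℝ] E n := ((stdOrthonormalBasis ℝ W).reindex (finCongr hn)).repr
  set f : E n → E d := fun y => (e.symm y : E d) + p with hf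
  have hiso : Isometry f := by
    refine Isometry.of_dist_eq fun x y => ?_
    simp only [hf, dist_add_right]
    rw [← Subtype.dist_eq, e.symm.isometry.dist_eq]
  have himg : f '' (f ⁻¹' S) = S := by
    refine image_preimage_eq_of_subset fun x hx => ?_
    refine ⟨e ⟨x - p, vsub_mem_vectorSpan ℝ hx hp⟩, ?_⟩
    simp [hf]
  rw [← himg, hiso.euclideanHausdorffMeasure_image,
    EuclideanSpace.euclideanHausdorffMeasure_eq_volume]
  have hsub : f ⁻¹' S ⊆ Metric.closedBall 0 r := by
    intro y hy
    have h1 := hS hy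
    have h2 : p = f 0 := by simp [hf]
    rw [Metric.mem_closedBall] at h1 ⊢
    rwa [h2, hiso.dist_eq] at h1
  refine (measure_mono hsub).trans ?_
  rw [Measure.addHaar_closedBall _ _ hr]
  simp

lemma finrank_vectorSpan_face {v : Vertices d d} (hd : 1 ≤ d) (hv : AffineIndependent ℝ v)
    (i : Fin (d + 1)) :
    Module.finrank ℝ (vectorSpan ℝ (convexHull ℝ (range (faceVertices v i)))) = d - 1 := by
  rw [← direction_affineSpan, affineSpan_convexHull, direction_affineSpan]
  have h : AffineIndependent ℝ (faceVertices v i) :=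
    hv.comp_embedding i.succAboveEmb
  exact h.finrank_vectorSpan (by simp; omega)

lemma face_subset_hull (v : Vertices d d) (i : Fin (d + 1)) :
    convexHull ℝ (range (faceVertices v i)) ⊆ hull v :=
  convexHull_mono (range_comp_subset_range _ _)

/-- The volume of the Euclidean unit ball of dimension `d - 1`. -/
def faceConst (d : ℕ) : ℝ := volume.real (Metric.ball (0 : E (d - 1)) 1)

lemma faceConst_nonneg (d : ℕ) : 0 ≤ faceConst d := measureReal_nonneg

lemma face_measure_le {v : Vertices d d} (hd : 1 ≤ d) (hv : AffineIndependent ℝ v)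
    (i : Fin (d + 1)) {x : E d} {r : ℝ} (hr : 0 ≤ r) (h : hull v ⊆ Metric.closedBall x r) :
    μHE[d - 1] (convexHull ℝ (range (faceVertices v i))) ≤
      ENNReal.ofReal ((2 * r) ^ (d - 1) * faceConst d) := by
  have hp : faceVertices v i ⟨0, hd⟩ ∈ convexHull ℝ (range (faceVertices v i)) :=
    subset_convexHull ℝ _ (mem_range_self _)
  refine (euclideanHausdorffMeasure_le_of_subset_closedBall (finrank_vectorSpan_face hd hv i) hp
    (r := 2 * r) (by positivity) fun y hy => ?_).trans_eq ?_
  · have h1 := h (face_subset_hull v i hy)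
    have h2 := h (face_subset_hull v i hp)
    rw [Metric.mem_closedBall] at *
    have := dist_triangle_right y (faceVertices v i ⟨0, hd⟩) x
    linarith
  · rw [ENNReal.ofReal_mul (by positivity), faceConst, ofReal_measureReal (by finiteness)]

lemma infEDist_face_le {v : Vertices d d} (hd : 1 ≤ d) (i : Fin (d + 1)) {x : E d}
    (hx : x ∈ hull v) :
    Metric.infEDist x (affineSpan ℝ (range (faceVertices v i)) : Set (E d)) ≤
      ENNReal.ofReal (Metric.diam (hull v)) := by
  have hp : faceVertices v i ⟨0, hd⟩ ∈ hull v :=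
    face_subset_hull v i (subset_convexHull ℝ _ (mem_range_self _))
  refine (Metric.infEDist_le_edist_of_mem
    (mem_affineSpan ℝ (mem_range_self (⟨0, hd⟩ : Fin d)))).trans ?_
  rw [edist_dist]
  exact ENNReal.ofReal_le_ofReal (Metric.dist_le_diam_of_mem (isCompact_hull v).isBounded hx hp)

lemma height_le_diam {v : Vertices d d} (hd : 1 ≤ d) :
    height v ≤ ENNReal.ofReal (Metric.diam (hull v)) :=
  (iInf_le _ 0).trans (iSup₂_le fun _ hx => infEDist_face_le hd 0 hx)

/-- A simplex contained in a ball of radius `r` has mass `O(r ^ (d - 1 + α))`. -/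
lemma mass_le {v : Vertices d d} (hd : 1 ≤ d) (hv : AffineIndependent ℝ v) {α : ℝ} (hα : 0 < α)
    {x : E d} {r : ℝ} (hr : 0 ≤ r) (h : hull v ⊆ Metric.closedBall x r) :
    mass α v ≤ ENNReal.ofReal ((2 * r) ^ (d - 1) * faceConst d * (2 * r) ^ α) := by
  rw [mass, if_neg hα.ne', ENNReal.ofReal_mul (mul_nonneg (by positivity) (faceConst_nonneg d)),
    ← ENNReal.ofReal_rpow_of_nonneg (by positivity) hα.le]
  refine mul_le_mul' (iSup_le fun i => face_measure_le hd hv i hr h)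
    (ENNReal.rpow_le_rpow ?_ hα.le)
  refine (height_le_diam hd).trans (ENNReal.ofReal_le_ofReal ?_)
  exact Metric.diam_le_of_subset_closedBall hr h

/-- The gradient of a barycentric coordinate. -/
lemma exists_coord_normal {v : Vertices d d} (hd : 1 ≤ d) (hv : AffineIndependent ℝ v)
    (i : Fin (d + 1)) : ∃ n : E d, n ≠ 0 ∧ ∀ x y,
      (simplexBasis v hv).coord i x - (simplexBasis v hv).coord i y = inner ℝ n (x - y) := by
  set b := simplexBasis v hv
  refine ⟨(InnerProductSpace.toDual ℝ (E d)).symm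
    (LinearMap.toContinuousLinearMap (b.coord i).linear), ?_, ?_⟩
  all_goals
    have h : ∀ x y, b.coord i x - b.coord i y = inner ℝ ((InnerProductSpace.toDual ℝ (E d)).symm
      (LinearMap.toContinuousLinearMap (b.coord i).linear)) (x - y) := by
      intro x y
      rw [InnerProductSpace.toDual_symm_apply]
      exact ((b.coord i).linearMap_vsub x y).symm
  · intro h0
    have h1 := h (v i) (v (i.succAbove ⟨0, hd⟩))
    have h2 : b.coord i (v i) = 1 := b.coord_apply_eq i
    have h3 : b.coord i (v (i.succAbove ⟨0, hd⟩)) = 0 :=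
      b.coord_apply_ne (Fin.succAbove_ne i _).symm
    rw [h0, h2, h3] at h1
    simp at h1
  · exact h

lemma sum_coord_smul {v : Vertices d d} (hv : AffineIndependent ℝ v) (i : Fin (d + 1)) (x : E d) :
    (simplexBasis v hv).coord i x • v i + ∑ j : Fin d,
      (simplexBasis v hv).coord (i.succAbove j) x • faceVertices v i j = x := by
  have := (simplexBasis v hv).linear_combination_coord_eq_self x
  rw [Fin.sum_univ_succAbove _ i] at this
  exact this

lemma sum_coord {v : Vertices d d} (hv : AffineIndependent ℝ v) (i : Fin (d + 1)) (x : E d) :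
    (simplexBasis v hv).coord i x + ∑ j : Fin d,
      (simplexBasis v hv).coord (i.succAbove j) x = 1 := by
  have := (simplexBasis v hv).sum_coord_apply_eq_one x
  rw [Fin.sum_univ_succAbove _ i] at this
  exact this

lemma mem_affineSpan_face_iff {v : Vertices d d} (hv : AffineIndependent ℝ v) (i : Fin (d + 1))
    (x : E d) : x ∈ affineSpan ℝ (range (faceVertices v i)) ↔
      (simplexBasis v hv).coord i x = 0 := by
  constructor
  · have hle : affineSpan ℝ (range (faceVertices v i)) ≤
        (AffineSubspace.mk' (0 : ℝ) ⊥).comap ((simplexBasis v hv).coord i) := by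
      rw [affineSpan_le]
      rintro _ ⟨k, rfl⟩
      have : (simplexBasis v hv).coord i (v (i.succAbove k)) = 0 :=
        (simplexBasis v hv).coord_apply_ne (Fin.succAbove_ne i k).symm
      simp [AffineSubspace.mem_mk', faceVertices, this]
    intro h
    simpa [AffineSubspace.mem_mk'] using hle h
  · intro h
    have h1 := sum_coord hv i x
    have h2 := sum_coord_smul hv i x
    rw [h, zero_add] at h1
    rw [h, zero_smul, zero_add] at h2
    have h3 := affineCombination_mem_affineSpan h1 (faceVertices v i)
    rw [Finset.affineCombination_eq_linear_combination _ _ _ h1, h2] at h3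
    exact h3

lemma infEDist_face_le_inv {v : Vertices d d} (hv : AffineIndependent ℝ v) (i : Fin (d + 1))
    {n : E d} (hn : n ≠ 0) (hn' : ∀ x y,
      (simplexBasis v hv).coord i x - (simplexBasis v hv).coord i y = inner ℝ n (x - y))
    {x : E d} (hx : x ∈ hull v) :
    Metric.infEDist x (affineSpan ℝ (range (faceVertices v i)) : Set (E d)) ≤
      ENNReal.ofReal (1 / ‖n‖) := by
  set b := simplexBasis v hv
  have hn0 : 0 < ‖n‖ := norm_pos_iff.2 hn
  set y := x - (b.coord i x / ‖n‖ ^ 2) • n with hy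
  have hbx0 : 0 ≤ b.coord i x := by
    rw [hull_eq_coord v hv] at hx; exact hx i
  have hbx1 : b.coord i x ≤ 1 := by
    have h1 := sum_coord hv i x
    have h2 : 0 ≤ ∑ j : Fin d, b.coord (i.succAbove j) x := by
      refine Finset.sum_nonneg fun j _ => ?_
      rw [hull_eq_coord v hv] at hx; exact hx _
    linarith
  have hmem : y ∈ affineSpan ℝ (range (faceVertices v i)) := by
    rw [mem_affineSpan_face_iff hv]
    have := hn' x y
    rw [hy, sub_sub_cancel, inner_smul_right, real_inner_self_eq_norm_sq,
      div_mul_cancel₀ _ (by positivity)] at this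
    rw [hy]; linarith
  refine (Metric.infEDist_le_edist_of_mem hmem).trans ?_
  rw [edist_dist]
  refine ENNReal.ofReal_le_ofReal ?_
  rw [dist_eq_norm, hy, sub_sub_cancel, norm_smul, Real.norm_eq_abs, abs_of_nonneg (by positivity)]
  calc b.coord i x / ‖n‖ ^ 2 * ‖n‖ = b.coord i x / ‖n‖ := by field_simp
    _ ≤ 1 / ‖n‖ := by gcongr

lemma inv_le_infEDist_face {v : Vertices d d} (hv : AffineIndependent ℝ v) (i : Fin (d + 1))
    {n : E d} (hn : n ≠ 0) (hn' : ∀ x y,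
      (simplexBasis v hv).coord i x - (simplexBasis v hv).coord i y = inner ℝ n (x - y)) :
    ENNReal.ofReal (1 / ‖n‖) ≤
      ⨆ x ∈ hull v, Metric.infEDist x (affineSpan ℝ (range (faceVertices v i)) : Set (E d)) := by
  refine le_iSup₂_of_le (v i) (vertex_mem_hull v i) ?_
  refine Metric.le_infEDist.2 fun y hy => ?_
  have hy0 := (mem_affineSpan_face_iff hv i y).1 hy
  have h1 := hn' (v i) y
  have h2 : (simplexBasis v hv).coord i (v i) = 1 := (simplexBasis v hv).coord_apply_eq i
  rw [h2, hy0, sub_zero] at h1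
  have h3 := real_inner_le_norm n (v i - y)
  rw [edist_dist, dist_eq_norm]
  refine ENNReal.ofReal_le_ofReal ?_
  rw [div_le_iff₀ (norm_pos_iff.2 hn), mul_comm]
  linarith

lemma height_pos {v : Vertices d d} (hd : 1 ≤ d) (hv : AffineIndependent ℝ v) : 0 < height v := by
  obtain ⟨i, hi⟩ := exists_eq_ciInf_of_finite (f := fun i : Fin (d + 1) => ⨆ x ∈ hull v,
    Metric.infEDist x (affineSpan ℝ (range (faceVertices v i)) : Set (E d)))
  obtain ⟨n, hn, hn'⟩ := exists_coord_normal hd hv i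
  rw [height, ← hi]
  refine lt_of_lt_of_le ?_ (inv_le_infEDist_face hv i hn hn')
  have := norm_pos_iff.2 hn
  simpa using this

lemma height_ne_top {v : Vertices d d} (hd : 1 ≤ d) : height v ≠ ⊤ :=
  ((height_le_diam hd).trans_lt ENNReal.ofReal_lt_top).ne

lemma height_toReal_pos {v : Vertices d d} (hd : 1 ≤ d) (hv : AffineIndependent ℝ v) :
    0 < (height v).toReal :=
  ENNReal.toReal_pos (height_pos hd hv).ne' (height_ne_top hd)

/-- A simplex contains a ball of radius comparable to its height, centred at its barycentre. -/
lemma exists_closedBall_subset_hull {v : Vertices d d} (hd : 1 ≤ d) (hv : AffineIndependent ℝ v) :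
    ∃ c, Metric.closedBall c ((height v).toReal / (d + 1)) ⊆ hull v := by
  set b := simplexBasis v hv
  refine ⟨Finset.univ.centroid ℝ b, fun y hy => ?_⟩
  rw [hull_eq_coord v hv]
  intro i
  obtain ⟨n, hn, hn'⟩ := exists_coord_normal hd hv i
  have hn0 := norm_pos_iff.2 hn
  have hh : (height v).toReal ≤ 1 / ‖n‖ := by
    refine ENNReal.toReal_le_of_le_ofReal (by positivity) ?_
    exact (iInf_le _ i).trans (iSup₂_le fun x hx => infEDist_face_le_inv hv i hn hn' hx)
  have hc : b.coord i (Finset.univ.centroid ℝ b) = ((d : ℝ) + 1)⁻¹ := by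
    rw [b.coord_apply_centroid (Finset.mem_univ i)]; simp
  have h1 := hn' (Finset.univ.centroid ℝ b) y
  have h2 := real_inner_le_norm n (Finset.univ.centroid ℝ b - y)
  rw [Metric.mem_closedBall, dist_comm, dist_eq_norm] at hy
  have h3 : ‖n‖ * ‖Finset.univ.centroid ℝ b - y‖ ≤ ((d : ℝ) + 1)⁻¹ := by
    calc ‖n‖ * ‖Finset.univ.centroid ℝ b - y‖
        ≤ ‖n‖ * ((1 / ‖n‖) / (d + 1)) := by
          gcongr
          exact hy.trans (by gcongr)
      _ = ((d : ℝ) + 1)⁻¹ := by field_simp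
  change 0 ≤ b.coord i y
  linarith

/-- The slices of a simplex parallel to a face are contained in shrunken copies of that face. -/
lemma slice_subset {v : Vertices d d} (hv : AffineIndependent ℝ v) (i : Fin (d + 1)) {t : ℝ}
    (ht : t < 1) : hull v ∩ {x | (simplexBasis v hv).coord i x = t} ⊆
      AffineMap.homothety (v i) (1 - t) '' convexHull ℝ (range (faceVertices v i)) := by
  rintro x ⟨hx, hxt⟩
  rw [hull_eq_coord v hv] at hx
  set b := simplexBasis v hv
  change b.coord i x = t at hxt
  have h1 := sum_coord hv i x
  have h2 := sum_coord_smul hv i x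
  have h1t : 0 < 1 - t := by linarith
  refine ⟨∑ j : Fin d, (b.coord (i.succAbove j) x / (1 - t)) • faceVertices v i j,
    (convex_convexHull ℝ _).sum_mem (fun j _ => div_nonneg (hx _) h1t.le) ?_
      fun j _ => subset_convexHull ℝ _ (mem_range_self j), ?_⟩
  · rw [← Finset.sum_div, div_eq_one_iff_eq h1t.ne']
    linarith
  · simp only [AffineMap.homothety_apply, vsub_eq_sub, vadd_eq_add, smul_sub, Finset.smul_sum,
      smul_smul]
    have h3 : ∀ j, (1 - t) * (b.coord (i.succAbove j) x / (1 - t)) = b.coord (i.succAbove j) x :=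
      fun j => by field_simp
    simp only [h3, sub_smul, one_smul]
    conv_rhs => rw [← h2, hxt]
    abel

/-- The volume of a simplex is at most base times height. -/
lemma volume_hull_le {v : Vertices d d} (hd : 1 ≤ d) (hv : AffineIndependent ℝ v) :
    volume (hull v) ≤
      (⨆ i : Fin (d + 1), μHE[d - 1] (convexHull ℝ (range (faceVertices v i)))) * height v := by
  obtain ⟨i, hi⟩ := exists_eq_ciInf_of_finite (f := fun i : Fin (d + 1) => ⨆ x ∈ hull v,
    Metric.infEDist x (affineSpan ℝ (range (faceVertices v i)) : Set (E d)))
  obtain ⟨n, hn, hn'⟩ := exists_coord_normal hd hv i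
  have hn0 := norm_pos_iff.2 hn
  set b := simplexBasis v hv
  rw [height, ← hi, mul_comm]
  refine le_trans ?_ (mul_le_mul' (inv_le_infEDist_face hv i hn hn')
    (le_iSup (fun i => μHE[d - 1] (convexHull ℝ (range (faceVertices v i)))) i))
  -- slice the simplex orthogonally to the normal `n`, parametrised so that the slice at height `t`
  -- is the set where the barycentric coordinate equals `t`
  set w : E d := (1 / ‖n‖ ^ 2) • n with hw
  have hw0 : w ≠ 0 := smul_ne_zero (by positivity) hn
  have hwn : ‖w‖ₑ = ENNReal.ofReal (1 / ‖n‖) := by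
    rw [← ofReal_norm, hw, norm_smul, Real.norm_eq_abs, abs_of_pos (by positivity)]
    congr 1; field_simp
  have hb1 : b.coord i (v i) = 1 := b.coord_apply_eq i
  have hslice : ∀ t : ℝ, (AffineSubspace.mk' (t • w +ᵥ (v i - w))
      (Submodule.span ℝ {w})ᗮ : Set (E d)) = {x | b.coord i x = t} := by
    intro t
    ext x
    have h1 := hn' x (v i)
    rw [hb1] at h1
    simp only [SetLike.mem_coe, AffineSubspace.mem_mk',
      Submodule.mem_orthogonal_singleton_iff_inner_right, mem_ofPred_eq, vsub_eq_sub, vadd_eq_add]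
    have h2 : x - (t • w + (v i - w)) = (x - v i) - (t - 1) • w := by rw [sub_smul, one_smul]; abel
    have h3 : inner ℝ n w = 1 := by
      rw [hw, inner_smul_right, real_inner_self_eq_norm_sq]; field_simp
    rw [h2, hw, inner_smul_left, ← hw, inner_sub_right, inner_smul_right, h3, ← h1]
    simp only [conj_trivial, mul_one, mul_eq_zero]
    constructor
    · rintro (h | h)
      · exact absurd h (by positivity)
      · linarith
    · intro h; right; rw [h]; ring
  have hfub := EuclideanGeometry.euclideanHausdorffMeasure_eq_lintegral (V := E d) (v i - w) hw0
    (measurableSet_hull v)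
  simp only [finrank_euclideanSpace, Fintype.card_fin, hslice] at hfub
  rw [EuclideanSpace.euclideanHausdorffMeasure_eq_volume] at hfub
  rw [hfub, hwn]
  gcongr
  have hae : ∀ᵐ t : ℝ, μHE[d - 1] (hull v ∩ {x | b.coord i x = t}) ≤
      (Icc (0 : ℝ) 1).indicator
        (fun _ => μHE[d - 1] (convexHull ℝ (range (faceVertices v i)))) t := by
    filter_upwards [Measure.ae_ne volume (1 : ℝ)] with t ht1
    by_cases ht : t ∈ Icc (0 : ℝ) 1
    · rw [indicator_of_mem ht]
      have ht1' : t < 1 := lt_of_le_of_ne ht.2 ht1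
      refine (measure_mono (slice_subset hv i ht1')).trans ?_
      rw [euclideanHausdorffMeasure_homothety_image _ _ (by linarith : (1 : ℝ) - t ≠ 0)]
      have h1 : ‖1 - t‖₊ ^ (d - 1) ≤ 1 := by
        refine pow_le_one' ?_ _
        rw [← NNReal.coe_le_coe, coe_nnnorm, Real.norm_eq_abs, abs_of_pos (by linarith)]
        have := ht.1
        simp; linarith
      calc _ ≤ (1 : ℝ≥0) • μHE[d - 1] (convexHull ℝ (range (faceVertices v i))) := by gcongr
        _ = _ := one_smul _ _
    · rw [indicator_of_notMem ht]
      refine le_of_eq ?_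
      suffices h : hull v ∩ {x | b.coord i x = t} = ∅ by rw [h, measure_empty]
      rw [← disjoint_iff_inter_eq_empty, disjoint_left]
      intro x hx hxt
      refine ht ?_
      change b.coord i x = t at hxt
      rw [hull_eq_coord v hv] at hx
      have h1 := sum_coord hv i x
      have h2 : 0 ≤ ∑ j : Fin d, b.coord (i.succAbove j) x := Finset.sum_nonneg fun j _ => hx _
      have h3 := hx i
      rw [← hxt]
      exact ⟨h3, by linarith⟩
  refine (lintegral_mono_ae hae).trans ?_
  rw [lintegral_indicator measurableSet_Icc]
  simp

/-- This is the inequality between volume and base times height, multiplied by `h ^ (α - 1)`; it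
compares the bound for integrals of Hölder distributions over simplices with the `α`-mass. -/
lemma le_mass {v : Vertices d d} (hd : 1 ≤ d) (hv : AffineIndependent ℝ v) {α : ℝ} (hα : 0 < α) :
    ENNReal.ofReal (volume.real (hull v) * (height v).toReal ^ (α - 1)) ≤ mass α v := by
  have hH := height_toReal_pos hd hv
  rw [mass, if_neg hα.ne', ENNReal.ofReal_mul measureReal_nonneg,
    ofReal_measureReal (isCompact_hull v).measure_lt_top.ne]
  refine (mul_le_mul_left (volume_hull_le hd hv) _).trans_eq ?_
  rw [mul_assoc]
  congr 1
  obtain ⟨H, hHe⟩ : ∃ H, H = (height v).toReal := ⟨_, rfl⟩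
  rw [← hHe] at hH ⊢
  rw [← ENNReal.ofReal_toReal (height_ne_top (v := v) hd), ← hHe]
  rw [← ENNReal.ofReal_mul hH.le, ENNReal.ofReal_rpow_of_pos hH]
  congr 1
  rw [Real.rpow_sub hH, Real.rpow_one]
  field_simp

/-! ### Boundary layers of convex bodies -/

/-- Shrinking a convex body towards the centre of an inscribed ball of radius `r` by the factor
`1 - δ / r` keeps it at distance `δ` from the boundary. -/
lemma closedBall_subset_of_homothety {K : Set (E d)} (hK : Convex ℝ K) {c : E d} {r : ℝ}
    (hr : 0 < r) (hball : Metric.closedBall c r ⊆ K) {δ : ℝ} (hδ : 0 < δ) (hδr : δ ≤ r) {x : E d}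
    (hx : x ∈ AffineMap.homothety c (1 - δ / r) '' K) : Metric.closedBall x δ ⊆ K := by
  obtain ⟨s, hs, rfl⟩ := hx
  intro y hy
  rw [Metric.mem_closedBall, dist_eq_norm, AffineMap.homothety_apply] at hy
  simp only [vsub_eq_sub, vadd_eq_add] at hy
  have hz : c + (r / δ) • (y - ((1 - δ / r) • (s - c) + c)) ∈ K := by
    refine hball ?_
    rw [Metric.mem_closedBall, dist_eq_norm, add_sub_cancel_left, norm_smul, Real.norm_eq_abs,
      abs_of_pos (by positivity)]
    calc r / δ * _ ≤ r / δ * δ := by gcongr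
      _ = r := by field_simp
  have h := hK hs hz (a := 1 - δ / r) (b := δ / r)
    (by rw [sub_nonneg, div_le_one hr]; exact hδr) (by positivity) (by ring)
  convert h using 1
  rw [smul_add, smul_smul, div_mul_div_comm, mul_comm δ r, div_self (by positivity), one_smul]
  simp only [sub_smul, smul_sub, one_smul]
  abel

lemma mem_homothety_of_dist_le {K : Set (E d)} (hK : Convex ℝ K) {c : E d} {r : ℝ}
    (hr : 0 < r) (hball : Metric.closedBall c r ⊆ K) {δ : ℝ} (hδ : 0 < δ) {x y : E d}
    (hy : y ∈ K) (hxy : dist x y ≤ δ) : x ∈ AffineMap.homothety c (1 + δ / r) '' K := by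
  have hpos : 0 < 1 + δ / r := by positivity
  have hz : c + (r / δ) • (x - y) ∈ K := by
    refine hball ?_
    rw [Metric.mem_closedBall, dist_eq_norm, add_sub_cancel_left, norm_smul, Real.norm_eq_abs,
      abs_of_pos (by positivity)]
    rw [dist_eq_norm] at hxy
    calc r / δ * _ ≤ r / δ * δ := by gcongr
      _ = r := by field_simp
  have h := hK hy hz (a := 1 / (1 + δ / r)) (b := (δ / r) / (1 + δ / r))
    (by positivity) (by positivity) (by field_simp)
  refine ⟨_, h, ?_⟩
  have h1 : (1 + δ / r) * (1 / (1 + δ / r)) = 1 := by field_simp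
  have h2 : (1 + δ / r) * (δ / r / (1 + δ / r)) = δ / r := by field_simp
  have h3 : (δ / r) * (r / δ) = 1 := by field_simp
  simp only [AffineMap.homothety_apply, vsub_eq_sub, vadd_eq_add, smul_sub, smul_add, smul_smul]
  rw [← mul_assoc, h1, h2, h3, one_smul, one_smul]
  simp only [add_smul, one_smul]
  abel

lemma add_pow_sub_pow_le {t : ℝ} (h0 : 0 ≤ t) (h1 : t ≤ 1) (n : ℕ) :
    (1 + t) ^ n - (1 - t) ^ n ≤ n * 2 ^ n * t := by
  induction n with
  | zero => simp
  | succ n ih =>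
    have h2 : (1 - t) ^ n ≤ 1 := pow_le_one₀ (by linarith) (by linarith)
    have h3 : (1 : ℝ) ≤ 2 ^ n := one_le_pow₀ (by norm_num)
    have h5 : (1 - t) ^ n ≤ (1 + t) ^ n := pow_le_pow_left₀ (by linarith) (by linarith) n
    have h4 : (1 + t) * ((1 + t) ^ n - (1 - t) ^ n) ≤ 2 * (n * 2 ^ n * t) :=
      mul_le_mul (by linarith) ih (by linarith) (by norm_num)
    have h6 : t * (1 - t) ^ n ≤ t * 2 ^ n := by gcongr; linarith
    push_cast
    calc (1 + t) ^ (n + 1) - (1 - t) ^ (n + 1)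
        = (1 + t) * ((1 + t) ^ n - (1 - t) ^ n) + 2 * (t * (1 - t) ^ n) := by ring
      _ ≤ 2 * (n * 2 ^ n * t) + 2 * (t * 2 ^ n) := by linarith
      _ = (n + 1) * 2 ^ (n + 1) * t := by ring

/-- The points within `δ` of a convex body lie in the dilate of the body by the factor
`1 + δ / r ≤ 2`. -/
lemma volume_near_le {K : Set (E d)} (hK : Convex ℝ K) {c : E d} {r : ℝ}
    (hr : 0 < r) (hball : Metric.closedBall c r ⊆ K) {δ : ℝ} (hδ : 0 < δ) (hδr : δ ≤ r) :
    volume {x | ∃ y ∈ K, dist x y ≤ δ} ≤ ENNReal.ofReal (2 ^ d) * volume K := by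
  refine (measure_mono (t := AffineMap.homothety c (1 + δ / r) '' K) ?_).trans ?_
  · rintro x ⟨y, hy, hxy⟩
    exact mem_homothety_of_dist_le hK hr hball hδ hy hxy
  · rw [Measure.addHaar_image_homothety]
    gcongr
    have h0 : 0 < δ / r := by positivity
    have h1 : δ / r ≤ 1 := (div_le_one hr).2 hδr
    rw [abs_of_nonneg (by positivity)]
    simp only [finrank_euclideanSpace, Fintype.card_fin]
    exact pow_le_pow_left₀ (by positivity) (by linarith) d

/-- The boundary layer of thickness `δ` of a convex body containing a ball of radius `r` takes up
at most a proportion of order `δ / r` of the body. -/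
lemma volume_boundary_layer_le {K : Set (E d)} (hK : Convex ℝ K) (hKc : IsCompact K) {c : E d}
    {r : ℝ} (hr : 0 < r) (hball : Metric.closedBall c r ⊆ K) {δ : ℝ} (hδ : 0 < δ) (hδr : δ ≤ r) :
    volume {x | (∃ y ∈ K, dist x y ≤ δ) ∧ ¬ Metric.closedBall x δ ⊆ K} ≤
      ENNReal.ofReal (d * 2 ^ d * (δ / r)) * volume K := by
  have h0 : 0 < δ / r := by positivity
  have h1 : δ / r ≤ 1 := (div_le_one hr).2 hδr
  have hcompact : ∀ t : ℝ, IsCompact (AffineMap.homothety c t '' K) := fun t =>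
    hKc.image (AffineMap.homothety_continuous c t)
  have hsub : AffineMap.homothety c (1 - δ / r) '' K ⊆ AffineMap.homothety c (1 + δ / r) '' K := by
    intro x hx
    have := closedBall_subset_of_homothety hK hr hball hδ hδr hx
    exact mem_homothety_of_dist_le hK hr hball hδ (this (Metric.mem_closedBall_self hδ.le))
      (by simp [hδ.le])
  refine (measure_mono (t := AffineMap.homothety c (1 + δ / r) '' K \
    AffineMap.homothety c (1 - δ / r) '' K) ?_).trans ?_
  · rintro x ⟨⟨y, hy, hxy⟩, hx⟩
    exact ⟨mem_homothety_of_dist_le hK hr hball hδ hy hxy,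
      fun h => hx (closedBall_subset_of_homothety hK hr hball hδ hδr h)⟩
  · rw [measure_sdiff hsub (hcompact _).measurableSet.nullMeasurableSet
      (hcompact _).measure_lt_top.ne,
      Measure.addHaar_image_homothety, Measure.addHaar_image_homothety]
    simp only [finrank_euclideanSpace, Fintype.card_fin]
    rw [abs_of_nonneg (by positivity), abs_of_nonneg (pow_nonneg (by linarith) _),
      ← ENNReal.sub_mul (fun _ _ => hKc.measure_lt_top.ne),
      ← ENNReal.ofReal_sub _ (pow_nonneg (by linarith) _)]
    gcongr
    exact add_pow_sub_pow_le h0.le h1 d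

/-! ### Values on small cubes -/

/-- The bound for the mass of a simplex contained in a ball of radius `r`. -/
def ballMass (d : ℕ) (α r : ℝ) : ℝ := (2 * r) ^ (d - 1) * faceConst d * (2 * r) ^ α

lemma ballMass_nonneg {α r : ℝ} (hr : 0 ≤ r) : 0 ≤ ballMass d α r :=
  mul_nonneg (mul_nonneg (by positivity) (faceConst_nonneg d)) (by positivity)

lemma abs_posVal_le_ballMass (hd : 1 ≤ d) {α : ℝ} (hα : 0 < α) {A : Vertices d d → ℝ}
    (hG : growthNorm α A ≠ ⊤) {v : Vertices d d} {x : E d} {r : ℝ} (hr : 0 ≤ r) (hr1 : 2 * r ≤ 1)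
    (h : hull v ⊆ Metric.closedBall x r) :
    |posVal A v| ≤ (growthNorm α A).toReal * ballMass d α r := by
  by_cases hv : AffineIndependent ℝ v
  swap
  · rw [posVal_of_not A hv, abs_zero]
    exact mul_nonneg ENNReal.toReal_nonneg (ballMass_nonneg hr)
  have hm := mass_le hd hv hα hr h
  have h1 : ‖A v‖ₑ / mass α v ≤ growthNorm α A :=
    le_growthNorm ⟨hv, (Metric.diam_le_of_subset_closedBall hr h).trans hr1⟩
  rw [ENNReal.div_le_iff_le_mul (Or.inr hG) (Or.inl (hm.trans_lt ENNReal.ofReal_lt_top).ne)] at h1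
  have h2 := h1.trans (mul_le_mul_right hm _)
  have hnn : 0 ≤ (growthNorm α A).toReal * ballMass d α r :=
    mul_nonneg ENNReal.toReal_nonneg (ballMass_nonneg hr)
  rw [← ballMass, ← ENNReal.ofReal_toReal hG, ← ENNReal.ofReal_mul ENNReal.toReal_nonneg,
    Real.enorm_eq_ofReal_abs, ENNReal.ofReal_le_ofReal_iff hnn] at h2
  rw [abs_posVal A hv]
  exact h2

/-- The vector all of whose coordinates equal `ε`. -/
def diag (d : ℕ) (ε : ℝ) : E d := WithLp.toLp 2 fun _ => ε

@[simp] lemma diag_apply (ε : ℝ) (i : Fin d) : diag d ε i = ε := rfl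

/-- The closed cube with lowest corner `a` and side `ε`. -/
def cube (a : E d) (ε : ℝ) : Set (E d) := {x | ∀ i, a i ≤ x i ∧ x i ≤ a i + ε}

lemma norm_le_of_coord_le {x : E d} {ε : ℝ} (hε : 0 ≤ ε) (h : ∀ i, |x i| ≤ ε) : ‖x‖ ≤ d * ε := by
  rw [EuclideanSpace.norm_eq, Real.sqrt_le_iff]
  refine ⟨by positivity, ?_⟩
  calc ∑ i, ‖x i‖ ^ 2 ≤ ∑ i : Fin d, ε ^ 2 :=
        Finset.sum_le_sum fun i _ => pow_le_pow_left₀ (norm_nonneg _) (h i) 2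
    _ = d * ε ^ 2 := by simp
    _ ≤ (d * ε) ^ 2 := by
        rw [mul_pow]
        have : (d : ℝ) ≤ (d : ℝ) ^ 2 := by exact_mod_cast Nat.le_self_pow two_ne_zero d
        gcongr

lemma cube_subset_closedBall (a : E d) {ε : ℝ} (hε : 0 ≤ ε) :
    cube a ε ⊆ Metric.closedBall a (d * ε) := by
  intro x hx
  rw [Metric.mem_closedBall, dist_eq_norm]
  refine norm_le_of_coord_le hε fun i => ?_
  rw [PiLp.sub_apply, abs_le]
  constructor <;> linarith [(hx i).1, (hx i).2]

lemma dist_le_of_mem_cube {a : E d} {ε : ℝ} (hε : 0 ≤ ε) {x y : E d} (hx : x ∈ cube a ε)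
    (hy : y ∈ cube a ε) : dist x y ≤ d * ε := by
  rw [dist_eq_norm]
  refine norm_le_of_coord_le hε fun i => ?_
  rw [PiLp.sub_apply, abs_le]
  constructor <;> linarith [(hx i).1, (hx i).2, (hy i).1, (hy i).2]

lemma convex_cube (a : E d) (ε : ℝ) : Convex ℝ (cube a ε) := by
  intro x hx y hy s t hs ht hst i
  simp only [PiLp.add_apply, PiLp.smul_apply, smul_eq_mul]
  obtain ⟨h1, h2⟩ := hx i
  obtain ⟨h3, h4⟩ := hy i
  obtain rfl : t = 1 - s := by linarith
  constructor
  · linarith [mul_le_mul_of_nonneg_left h1 hs, mul_le_mul_of_nonneg_left h3 ht]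
  · linarith [mul_le_mul_of_nonneg_left h2 hs, mul_le_mul_of_nonneg_left h4 ht]

lemma isClosed_cube (a : E d) (ε : ℝ) : IsClosed (cube a ε) := by
  have : cube a ε = ⋂ i, {x : E d | a i ≤ x i ∧ x i ≤ a i + ε} := by
    ext x; simp [cube]
  rw [this]
  refine isClosed_iInter fun i => ?_
  have hc : Continuous fun x : E d => x i := by fun_prop
  exact (isClosed_le continuous_const hc).inter (isClosed_le hc continuous_const)

lemma hull_boxVertices_subset_cube (a : E d) {ε : ℝ} (hε : 0 ≤ ε) (s : Equiv.Perm (Fin d)) :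
    hull (boxVertices a (a + diag d ε) s) ⊆ cube a ε := by
  refine (hull_subset_iff _ (convex_cube a ε)).2 fun j i => ?_
  rw [boxVertices_apply]
  split_ifs <;> simp [hε]

lemma abs_boxValue_le {A : Vertices d d → ℝ} (hA : A ∈ Cochain d d) {w u : E d} {M : ℝ}
    (h : ∀ s, |posVal A (boxVertices w u s)| ≤ M) : |boxValue A w u| ≤ d.factorial * M := by
  rw [boxValue_eq_posVal hA]
  refine (Finset.abs_sum_le_sum_abs _ _).trans ?_
  refine (Finset.sum_le_card_nsmul _ _ M fun s _ => ?_).trans ?_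
  · rw [abs_mul]
    have h1 : |(SignType.sign (∏ i, (u i - w i)) : ℝ)| ≤ 1 := by
      rcases lt_trichotomy (∏ i, (u i - w i)) 0 with h | h | h <;> simp [h]
    calc _ ≤ 1 * |posVal A (boxVertices w u s)| := by gcongr
      _ ≤ M := by rw [one_mul]; exact h s
  · rw [Finset.card_univ, Fintype.card_perm, Fintype.card_fin, nsmul_eq_mul]

lemma abs_boxValue_cube_le (hd : 1 ≤ d) {α : ℝ} (hα : 0 < α) {A : Vertices d d → ℝ}
    (hA : A ∈ Cochain d d) (hG : growthNorm α A ≠ ⊤) (a : E d) {ε : ℝ} (hε : 0 ≤ ε)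
    (hε1 : 2 * (d * ε) ≤ 1) : |boxValue A a (a + diag d ε)| ≤
      d.factorial * ((growthNorm α A).toReal * ballMass d α (d * ε)) :=
  abs_boxValue_le hA fun s => abs_posVal_le_ballMass hd hα hG (by positivity) hε1
    ((hull_boxVertices_subset_cube a hε s).trans (cube_subset_closedBall a hε))

/-! ### Decomposition along a grid -/

/-- The affine function `x ↦ x i - a`. -/
def coordSub (i : Fin d) (a : ℝ) : E d →ᵃ[ℝ] ℝ :=
  (EuclideanSpace.proj i : E d →L[ℝ] ℝ).toLinearMap.toAffineMap - AffineMap.const ℝ (E d) a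

@[simp] lemma coordSub_apply (i : Fin d) (a : ℝ) (x : E d) : coordSub i a x = x i - a := by
  simp [coordSub]

lemma coordSub_ne_zero (i : Fin d) (a : ℝ) : coordSub i a ≠ 0 := by
  intro h
  have := DFunLike.congr_fun h (diag d (a + 1))
  simp at this

lemma ae_coord_ne (a : E d) : ∀ᵐ x : E d, ∀ i, x i ≠ a i := by
  rw [ae_all_iff]
  intro i
  filter_upwards [ae_affine_ne_zero _ (coordSub_ne_zero i (a i))] with x hx h
  exact hx (by simp [h])

/-- The index of the cell containing `x` in the grid of mesh `ε` based at `y`. -/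
def cellIndex (y : E d) (ε : ℝ) (x : E d) : Fin d → ℤ := fun i => ⌊(x i - y i) / ε⌋

/-- The lowest corner of the cell with index `k` in the grid of mesh `ε` based at `y`. -/
def cellCorner (y : E d) (ε : ℝ) (k : Fin d → ℤ) : E d := y + WithLp.toLp 2 fun i => ε * (k i : ℝ)

lemma cellCorner_apply (y : E d) (ε : ℝ) (k : Fin d → ℤ) (i : Fin d) :
    cellCorner y ε k i = y i + ε * k i := rfl

lemma cellIndex_eq_iff {y : E d} {ε : ℝ} (hε : 0 < ε) {x : E d} {k : Fin d → ℤ} :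
    cellIndex y ε x = k ↔ ∀ i, cellCorner y ε k i ≤ x i ∧ x i < cellCorner y ε k i + ε := by
  simp only [funext_iff, cellIndex, Int.floor_eq_iff, cellCorner_apply]
  refine forall_congr' fun i => ?_
  rw [le_div_iff₀ hε, div_lt_iff₀ hε]
  constructor <;> rintro ⟨h1, h2⟩ <;> constructor <;> linarith

lemma mem_cube_of_cellIndex {y : E d} {ε : ℝ} (hε : 0 < ε) {x : E d} {k : Fin d → ℤ}
    (h : cellIndex y ε x = k) : x ∈ cube (cellCorner y ε k) ε := fun i =>
  ⟨((cellIndex_eq_iff hε).1 h i).1, ((cellIndex_eq_iff hε).1 h i).2.le⟩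

lemma ae_cellIndex_iff (y : E d) {ε : ℝ} (hε : 0 < ε) (k : Fin d → ℤ) :
    ∀ᵐ x : E d, cellIndex y ε x = k ↔ x ∈ cube (cellCorner y ε k) ε := by
  filter_upwards [ae_coord_ne (cellCorner y ε k + diag d ε)] with x hx
  refine ⟨mem_cube_of_cellIndex hε, fun h => (cellIndex_eq_iff hε).2 fun i => ⟨(h i).1, ?_⟩⟩
  exact lt_of_le_of_ne (h i).2 (by simpa using hx i)

lemma step_of_lt {a x : ℝ} (h : a < x) : step a x = 1 := if_pos h

lemma step_of_le {a x : ℝ} (h : x ≤ a) : step a x = 0 := if_neg h.not_gt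

lemma boxFun_cube_ae (a : E d) {ε : ℝ} (hε : 0 < ε) :
    boxFun a (a + diag d ε) =ᵐ[volume] (cube a ε).indicator 1 := by
  filter_upwards [ae_coord_ne a, ae_coord_ne (a + diag d ε)] with x hx hx'
  have h1 : ∀ i, step (a i) (x i) - step ((a + diag d ε) i) (x i) =
      if a i ≤ x i ∧ x i ≤ a i + ε then 1 else 0 := by
    intro i
    have h2 := hx i
    have h3 : x i ≠ a i + ε := hx' i
    have h4 : (a + diag d ε) i = a i + ε := rfl
    rw [h4]
    rcases lt_or_gt_of_ne h2 with h2 | h2 <;> rcases lt_or_gt_of_ne h3 with h3 | h3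
    · rw [step_of_le h2.le, step_of_le h3.le, if_neg (by rintro ⟨h, _⟩; linarith)]; simp
    · linarith
    · rw [step_of_lt h2, step_of_le h3.le, if_pos ⟨h2.le, h3.le⟩]; simp
    · rw [step_of_lt h2, step_of_lt h3, if_neg (by rintro ⟨_, h⟩; linarith)]; simp
  simp only [boxFun, h1, Finset.prod_ite_zero, Finset.prod_const_one, Finset.mem_univ,
    true_imp_iff]
  by_cases hxc : x ∈ cube a ε
  · rw [indicator_of_mem hxc]; exact if_pos hxc
  · rw [indicator_of_notMem hxc]; exact if_neg hxc

/-- The affine functions whose nonnegativity describes a cube. -/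
def cubeFaces (a : E d) (ε : ℝ) : List (E d →ᵃ[ℝ] ℝ) :=
  (List.finRange d).map (fun i => coordSub i (a i)) ++
    (List.finRange d).map fun i => -coordSub i (a i + ε)

lemma mem_cube_iff (a : E d) (ε : ℝ) (x : E d) : x ∈ cube a ε ↔ ∀ l ∈ cubeFaces a ε, 0 ≤ l x := by
  simp only [cube, mem_ofPred_eq, cubeFaces, List.mem_append, List.mem_map, List.mem_finRange,
    true_and]
  constructor
  · rintro h l (⟨i, rfl⟩ | ⟨i, rfl⟩)
    · simpa using (h i).1
    · simpa using (h i).2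
  · intro h i
    have h1 := h _ (Or.inl ⟨i, rfl⟩)
    have h2 := h _ (Or.inr ⟨i, rfl⟩)
    simp only [AffineMap.coe_neg, Pi.neg_apply, coordSub_apply] at h1 h2
    constructor <;> linarith

/-- The bound for the number of simplices needed to triangulate the intersection of a simplex with
a cube. -/
def cellPieces (d : ℕ) : ℕ := (2 ^ (d + 1)) ^ (d + d)

/-- The trace of a simplex on a grid cell is a union of boundedly many simplices. -/
lemma exists_decomp_cell {v : Vertices d d} (hv : AffineIndependent ℝ v) (y : E d) {ε : ℝ}
    (hε : 0 < ε) (k : Fin d → ℤ) : ∃ L : List (Vertices d d), L.length ≤ cellPieces d ∧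
      (∀ w ∈ L, hull w ⊆ cube (cellCorner y ε k) ε) ∧
      (L.map ind).sum =ᵐ[volume] (hull v ∩ {x | cellIndex y ε x = k}).indicator 1 := by
  obtain ⟨L, h1, h2, h3⟩ := exists_decomp_inter hv (cubeFaces (cellCorner y ε k) ε) (by
    intro l hl
    simp only [cubeFaces, List.mem_append, List.mem_map, List.mem_finRange, true_and] at hl
    rcases hl with ⟨i, rfl⟩ | ⟨i, rfl⟩
    · exact coordSub_ne_zero _ _
    · exact neg_ne_zero.2 (coordSub_ne_zero _ _))
  simp only [← mem_cube_iff, ofPred_mem_eq] at h2 h3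
  refine ⟨L, by simpa [cubeFaces, cellPieces] using h1, fun w hw => (h2 w hw).2.trans
    inter_subset_right, ?_⟩
  filter_upwards [h3, ae_cellIndex_iff y hε k] with x hx hx'
  rw [hx]
  have h4 : x ∈ hull v ∩ {x | cellIndex y ε x = k} ↔ x ∈ hull v ∩ cube (cellCorner y ε k) ε :=
    and_congr_right fun _ => hx'
  by_cases hxc : x ∈ hull v ∩ {x | cellIndex y ε x = k}
  · rw [indicator_of_mem hxc, indicator_of_mem (h4.1 hxc)]
  · rw [indicator_of_notMem hxc, indicator_of_notMem (mt h4.2 hxc)]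

/-- The formal sum of a list of simplices. -/
def listChain (L : List (Vertices d d)) : Vertices d d →₀ ℝ :=
  (L.map fun w => Finsupp.single w (1 : ℝ)).sum

lemma linearCombination_listChain {V : Type*} [AddCommGroup V] [Module ℝ V]
    (f : Vertices d d → V) (L : List (Vertices d d)) :
    Finsupp.linearCombination ℝ f (listChain L) = (L.map f).sum := by
  induction L with
  | nil => simp [listChain]
  | cons a L ih =>
    rw [listChain, List.map_cons, List.sum_cons, map_add, ← listChain, ih]
    simp [Finsupp.linearCombination_single]

lemma finite_cellIndex_image {K : Set (E d)} (hK : Bornology.IsBounded K) (y : E d) {ε : ℝ}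
    (hε : 0 < ε) : (cellIndex y ε '' K).Finite := by
  obtain ⟨R, hR⟩ := hK.subset_closedBall y
  refine (Set.finite_Icc (fun _ => ⌊-(R / ε)⌋ : Fin d → ℤ) (fun _ => ⌊R / ε⌋)).subset ?_
  rintro _ ⟨x, hx, rfl⟩
  have h := hR hx
  rw [Metric.mem_closedBall, dist_eq_norm] at h
  have h1 : ∀ i, |x i - y i| ≤ R := fun i => (PiLp.norm_apply_le (x - y) i).trans h
  refine ⟨fun i => Int.floor_le_floor ?_, fun i => Int.floor_le_floor ?_⟩
  · rw [← neg_div]; gcongr; exact (abs_le.1 (h1 i)).1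
  · gcongr; exact (abs_le.1 (h1 i)).2

/-- The value of a cochain on a simplex as the sum of its values on the traces of the simplex on
the cells of a grid, each cut into boundedly many simplices. -/
lemma exists_grid_decomp (hd : 1 ≤ d) {v : Vertices d d} (hv : AffineIndependent ℝ v) (y : E d)
    {ε : ℝ} (hε : 0 < ε) : ∃ (K : Finset (Fin d → ℤ)) (L : (Fin d → ℤ) → List (Vertices d d)),
      (∀ k, k ∈ K ↔ ∃ x ∈ hull v, cellIndex y ε x = k) ∧
      (∀ k, (L k).length ≤ cellPieces d) ∧
      (∀ k, ∀ w ∈ L k, hull w ⊆ cube (cellCorner y ε k) ε) ∧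
      (∀ A ∈ Cochain d d, posVal A v = ∑ k ∈ K, ((L k).map (posVal A)).sum) ∧
      ∀ A ∈ Cochain d d, ∀ k, cube (cellCorner y ε k) ε ⊆ hull v →
        ((L k).map (posVal A)).sum =
          boxValue A (cellCorner y ε k) (cellCorner y ε k + diag d ε) := by
  classical
  choose L h1 h2 h3 using fun k => exists_decomp_cell hv y hε k
  set K := (finite_cellIndex_image (isCompact_hull v).isBounded y hε).toFinset with hK
  have hKmem : ∀ k, k ∈ K ↔ ∃ x ∈ hull v, cellIndex y ε x = k := fun k => by simp [hK]
  refine ⟨K, L, hKmem, h1, h2, fun A hA => ?_, fun A hA k hk => ?_⟩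
  · have h := linearCombination_posVal_eq_zero hd hA
      (Finsupp.single v 1 - ∑ k ∈ K, listChain (L k)) (by
      have h4 : ∀ᵐ x : E d, ∀ k ∈ K, ((L k).map ind).sum x =
          (hull v ∩ {x | cellIndex y ε x = k}).indicator 1 x := by
        rw [Filter.eventually_all_finset]
        exact fun k _ => h3 k
      filter_upwards [h4] with x hx
      simp only [map_sub, map_sum, linearCombination_listChain, Finsupp.linearCombination_single,
        one_smul, Pi.sub_apply, Finset.sum_apply, Pi.zero_apply]
      rw [Finset.sum_congr rfl hx]
      by_cases hxv : x ∈ hull v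
      · rw [ind_apply_of_mem hxv, Finset.sum_eq_single (cellIndex y ε x)]
        · rw [indicator_of_mem
            (show x ∈ hull v ∩ {z | cellIndex y ε z = cellIndex y ε x} from ⟨hxv, rfl⟩)]
          simp
        · intro k _ hk
          exact indicator_of_notMem (fun h => hk h.2.symm) _
        · intro h
          exact absurd ((hKmem _).2 ⟨x, hxv, rfl⟩) h
      · rw [ind_apply_of_notMem hxv, Finset.sum_eq_zero, sub_zero]
        exact fun k _ => indicator_of_notMem (fun h => hxv h.1) _)
    simp only [map_sub, map_sum, linearCombination_listChain, Finsupp.linearCombination_single,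
        one_smul] at h
    linarith
  · have h := linearCombination_posVal_eq_zero hd hA
      (listChain (L k) - boxChain (cellCorner y ε k) (cellCorner y ε k + diag d ε)) (by
      filter_upwards [h3 k, ae_cellIndex_iff y hε k, boxFun_cube_ae (cellCorner y ε k) hε,
        ae_linearCombination_boxChain (cellCorner y ε k) (cellCorner y ε k + diag d ε)] with
        x hx1 hx2 hx3 hx4
      simp only [map_sub, linearCombination_listChain, Pi.sub_apply, Pi.zero_apply]
      rw [hx1, hx4, hx3]
      by_cases hxc : x ∈ cube (cellCorner y ε k) ε
      · rw [indicator_of_mem hxc,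
          indicator_of_mem (show x ∈ hull v ∩ {z | _ = k} from ⟨hk hxc, hx2.2 hxc⟩)]
        simp
      · rw [indicator_of_notMem hxc, indicator_of_notMem fun h => hxc (hx2.1 h.2)]; simp)
    simp only [map_sub, linearCombination_listChain, ← boxValue_eq_linearCombination hA] at h
    linarith

lemma abs_list_sum_le {α : Type*} (L : List α) (f : α → ℝ) {M : ℝ} {N : ℕ} (hM : 0 ≤ M)
    (hN : L.length ≤ N) (h : ∀ w ∈ L, |f w| ≤ M) : |(L.map f).sum| ≤ N * M := by
  rw [list_sum_map_eq]
  refine (Finset.abs_sum_le_sum_abs _ _).trans ?_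
  refine (Finset.sum_le_card_nsmul _ _ M fun n _ => h _ (List.get_mem L n)).trans ?_
  rw [Finset.card_univ, Fintype.card_fin, nsmul_eq_mul]
  gcongr

/-! ### Bounds for cochains from grid decompositions -/

/-- A cochain of finite growth norm is bounded on the simplices contained in a bounded set. -/
lemma exists_posVal_bound (hd : 1 ≤ d) {α : ℝ} (hα : 0 < α) {A : Vertices d d → ℝ}
    (hA : A ∈ Cochain d d) (hG : growthNorm α A ≠ ⊤) (R : ℝ) :
    ∃ M : ℝ, ∀ v : Vertices d d, hull v ⊆ Metric.closedBall 0 R → |posVal A v| ≤ M := by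
  have hd0 : (0 : ℝ) < d := by exact_mod_cast hd
  set ε : ℝ := 1 / (2 * d) with hεdef
  have hε : 0 < ε := by positivity
  have hdε : 2 * (d * ε) = 1 := by rw [hεdef]; field_simp
  set K := (finite_cellIndex_image (Metric.isBounded_closedBall (x := (0 : E d)) (r := R))
    0 hε).toFinset with hK
  set M₀ := (growthNorm α A).toReal * ballMass d α (d * ε) with hM₀
  have hM₀0 : 0 ≤ M₀ := mul_nonneg ENNReal.toReal_nonneg (ballMass_nonneg (by positivity))
  refine ⟨K.card * (cellPieces d * M₀), fun v hvR => ?_⟩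
  by_cases hv : AffineIndependent ℝ v
  swap
  · rw [posVal_of_not A hv, abs_zero]; positivity
  obtain ⟨K', L, h1, h2, h3, h4, -⟩ := exists_grid_decomp hd hv 0 hε
  rw [h4 A hA]
  refine (Finset.abs_sum_le_sum_abs _ _).trans ?_
  refine (Finset.sum_le_card_nsmul _ _ (cellPieces d * M₀) fun k _ => ?_).trans ?_
  · exact abs_list_sum_le _ _ hM₀0 (h2 k) fun w hw => abs_posVal_le_ballMass hd hα hG
      (by positivity) hdε.le ((h3 k w hw).trans (cube_subset_closedBall _ hε.le))
  · rw [nsmul_eq_mul]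
    have : K' ⊆ K := fun k hk => by
      obtain ⟨x, hx, rfl⟩ := (h1 k).1 hk
      simpa [hK] using ⟨x, by simpa using hvR hx, rfl⟩
    gcongr

lemma exists_boxValue_bound (hd : 1 ≤ d) {α : ℝ} (hα : 0 < α) {A : Vertices d d → ℝ}
    (hA : A ∈ Cochain d d) (hG : growthNorm α A ≠ ⊤) (R : ℝ) :
    ∃ M : ℝ, ∀ w u : E d, ‖w‖ ≤ R → ‖u‖ ≤ R → |boxValue A w u| ≤ M := by
  obtain ⟨M, hM⟩ := exists_posVal_bound hd hα hA hG (d * R)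
  refine ⟨d.factorial * M, fun w u hw hu => abs_boxValue_le hA fun s => hM _ ?_⟩
  refine (hull_subset_iff _ (convex_closedBall _ _)).2 fun j => ?_
  rw [mem_closedBall_zero_iff]
  refine norm_le_of_coord_le ((norm_nonneg w).trans hw) fun i => ?_
  rw [boxVertices_apply]
  split_ifs
  · exact (PiLp.norm_apply_le u i).trans hu
  · exact (PiLp.norm_apply_le w i).trans hw

lemma measurableSet_cell (y : E d) {ε : ℝ} (hε : 0 < ε) (k : Fin d → ℤ) :
    MeasurableSet {x | cellIndex y ε x = k} := by
  have : {x | cellIndex y ε x = k} =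
      ⋂ i, {x : E d | cellCorner y ε k i ≤ x i ∧ x i < cellCorner y ε k i + ε} := by
    ext x; simp [cellIndex_eq_iff hε]
  rw [this]
  refine MeasurableSet.iInter fun i => ?_
  have hc : Continuous fun x : E d => x i := by fun_prop
  exact (isClosed_le continuous_const hc).measurableSet.inter
    (isOpen_lt hc continuous_const).measurableSet

lemma volume_cell (y : E d) {ε : ℝ} (hε : 0 < ε) (k : Fin d → ℤ) :
    volume {x | cellIndex y ε x = k} = ENNReal.ofReal (ε ^ d) := by
  have h := (EuclideanSpace.volume_preserving_symm_measurableEquiv_toLp (Fin d)).measure_preimage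
    (s := Set.pi univ fun i => Ico (cellCorner y ε k i) (cellCorner y ε k i + ε))
    (MeasurableSet.univ_pi fun i => measurableSet_Ico).nullMeasurableSet
  rw [Real.volume_pi_Ico] at h
  simp only [add_sub_cancel_left, Finset.prod_const, Finset.card_univ, Fintype.card_fin] at h
  rw [ENNReal.ofReal_pow hε.le, ← h]
  congr 1
  ext x
  simp only [mem_ofPred_eq, cellIndex_eq_iff hε, mem_preimage, mem_univ_pi, mem_Ico]
  rfl

/-- The number of grid cells that meet a convex body without being contained in it. -/
lemma card_boundary_cells_le {K : Set (E d)} (hK : Convex ℝ K) (hKc : IsCompact K) {c : E d}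
    {r : ℝ} (hr : 0 < r) (hball : Metric.closedBall c r ⊆ K) (hd : 1 ≤ d) (y : E d) {ε : ℝ}
    (hε : 0 < ε) (hεr : d * ε ≤ r) (S : Finset (Fin d → ℤ))
    (hS : ∀ k ∈ S, (∃ x ∈ K, cellIndex y ε x = k) ∧ ¬ cube (cellCorner y ε k) ε ⊆ K) :
    S.card * ε ^ d ≤ d * 2 ^ d * (d * ε / r) * volume.real K := by
  have hd0 : (0 : ℝ) < d := by exact_mod_cast hd
  have h1 : volume (⋃ k ∈ S, {x | cellIndex y ε x = k}) = S.card * ENNReal.ofReal (ε ^ d) := by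
    rw [measure_biUnion_finset]
    · simp [volume_cell y hε]
    · intro k _ l _ hkl
      exact disjoint_left.2 fun x hx hx' => hkl (hx.symm.trans hx')
    · exact fun k _ => measurableSet_cell y hε k
  have h2 := volume_boundary_layer_le hK hKc hr hball (δ := d * ε) (by positivity) hεr
  have h3 : (⋃ k ∈ S, {x | cellIndex y ε x = k}) ⊆
      {x | (∃ y ∈ K, dist x y ≤ d * ε) ∧ ¬ Metric.closedBall x (d * ε) ⊆ K} := by
    intro x hx
    simp only [mem_iUnion, exists_prop] at hx
    obtain ⟨k, hk, hxk⟩ := hx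
    obtain ⟨⟨z, hz, hzk⟩, hn⟩ := hS k hk
    refine ⟨⟨z, hz, dist_le_of_mem_cube hε.le (mem_cube_of_cellIndex hε hxk)
      (mem_cube_of_cellIndex hε hzk)⟩, fun h => hn fun p hp => h ?_⟩
    exact dist_le_of_mem_cube hε.le hp (mem_cube_of_cellIndex hε hxk)
  have h4 := h1.symm.trans_le ((measure_mono h3).trans h2)
  rw [← ofReal_measureReal hKc.measure_lt_top.ne, ← ENNReal.ofReal_mul (by positivity),
    ← ENNReal.ofReal_natCast, ← ENNReal.ofReal_mul (by positivity),
    ENNReal.ofReal_le_ofReal_iff (mul_nonneg (by positivity) measureReal_nonneg)] at h4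
  exact h4

/-- A cochain of finite growth norm that vanishes on almost all cubes is zero: only the grid cells
at the boundary of a simplex contribute to its value, and there are few of them. -/
lemma posVal_eq_zero_of_cubes (hd : 1 ≤ d) {α : ℝ} (hα : 0 < α) {A : Vertices d d → ℝ}
    (hA : A ∈ Cochain d d) (hG : growthNorm α A ≠ ⊤)
    (h0 : ∀ ε : ℝ, 0 < ε → ∀ᵐ y : E d, boxValue A y (y + diag d ε) = 0) (v : Vertices d d) :
    posVal A v = 0 := by
  by_cases hv : AffineIndependent ℝ v
  swap
  · exact posVal_of_not A hv
  have hd0 : (0 : ℝ) < d := by exact_mod_cast hd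
  obtain ⟨c, hc⟩ := exists_closedBall_subset_hull hd hv
  set r := (height v).toReal / (d + 1) with hrdef
  have hr : 0 < r := div_pos (height_toReal_pos hd hv) (by positivity)
  set G := (growthNorm α A).toReal
  have hG0 : 0 ≤ G := ENNReal.toReal_nonneg
  set B := d * 2 ^ d * (d / r) * volume.real (hull v) * (cellPieces d *
    (G * ((2 * d) ^ (d - 1) * faceConst d * (2 * d) ^ α))) with hB
  have key : ∀ ε : ℝ, 0 < ε → d * ε ≤ r → 2 * (d * ε) ≤ 1 → |posVal A v| ≤ B * ε ^ α := by
    intro ε hε hεr hε1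
    have hall : ∀ᵐ y : E d, ∀ k : Fin d → ℤ,
        boxValue A (cellCorner y ε k) (cellCorner y ε k + diag d ε) = 0 := by
      rw [ae_all_iff]
      intro k
      exact (measurePreserving_add_right (volume : Measure (E d))
        (WithLp.toLp 2 fun i => ε * (k i : ℝ))).quasiMeasurePreserving.ae (h0 ε hε)
    -- a position of the grid for which the value on every cell vanishes
    obtain ⟨y, hy⟩ := hall.exists
    obtain ⟨K, L, h1, h2, h3, h4, h5⟩ := exists_grid_decomp hd hv y hε
    classical
    set S := K.filter fun k => ¬ cube (cellCorner y ε k) ε ⊆ hull v with hS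
    set M₀ := G * ballMass d α (d * ε) with hM₀
    have hM₀0 : 0 ≤ M₀ := mul_nonneg hG0 (ballMass_nonneg (by positivity))
    have hsum : |posVal A v| ≤ S.card * (cellPieces d * M₀) := by
      rw [h4 A hA, ← Finset.sum_subset (Finset.filter_subset
        (fun k => ¬ cube (cellCorner y ε k) ε ⊆ hull v) K)]
      · refine (Finset.abs_sum_le_sum_abs _ _).trans ?_
        refine (Finset.sum_le_card_nsmul _ _ (cellPieces d * M₀) fun k _ => ?_).trans_eq
          (nsmul_eq_mul _ _)
        exact abs_list_sum_le _ _ hM₀0 (h2 k) fun w hw => abs_posVal_le_ballMass hd hα hG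
          (by positivity) hε1 ((h3 k w hw).trans (cube_subset_closedBall _ hε.le))
      · intro k hk hkS
        rw [h5 A hA k, hy k]
        by_contra hsub
        exact hkS (Finset.mem_filter.2 ⟨hk, hsub⟩)
    have hcard := card_boundary_cells_le (convex_hull v) (isCompact_hull v) hr hc hd y hε hεr S
      (fun k hk => ⟨(h1 k).1 (Finset.mem_filter.1 hk).1, (Finset.mem_filter.1 hk).2⟩)
    have hpow : ε ^ d = ε ^ (d - 1) * ε := by rw [← pow_succ, Nat.sub_add_cancel hd]
    have hcard' : S.card * ε ^ (d - 1) ≤ d * 2 ^ d * (d / r) * volume.real (hull v) := by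
      rw [hpow] at hcard
      refine le_of_mul_le_mul_right ?_ hε
      calc S.card * ε ^ (d - 1) * ε = S.card * (ε ^ (d - 1) * ε) := by ring
        _ ≤ _ := hcard
        _ = _ := by ring
    have hball : ballMass d α (d * ε) = ε ^ (d - 1) *
        (((2 * d) ^ (d - 1) * faceConst d * (2 * d) ^ α) * ε ^ α) := by
      rw [ballMass, ← mul_assoc, mul_pow, Real.mul_rpow (by positivity) hε.le]
      ring
    calc |posVal A v| ≤ S.card * (cellPieces d * M₀) := hsum
      _ = (S.card * ε ^ (d - 1)) * (cellPieces d *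
          (G * ((2 * d) ^ (d - 1) * faceConst d * (2 * d) ^ α))) * ε ^ α := by
          rw [hM₀, hball]; ring
      _ ≤ B * ε ^ α := by
          have := faceConst_nonneg d
          rw [hB]
          gcongr
  have hlim : Filter.Tendsto (fun ε : ℝ => B * ε ^ α) (nhdsWithin 0 (Ioi 0)) (nhds 0) := by
    have := (Real.continuousAt_rpow_const 0 α (Or.inr hα.le)).tendsto.const_mul B
    rw [Real.zero_rpow hα.ne', mul_zero] at this
    exact this.mono_left nhdsWithin_le_nhds
  have hle : |posVal A v| ≤ 0 := by
    refine ge_of_tendsto hlim ?_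
    have h1 : ∀ᶠ ε : ℝ in nhdsWithin 0 (Ioi 0), ε < r / d ∧ ε < 1 / (2 * d) :=
      nhdsWithin_le_nhds ((eventually_lt_nhds (by positivity)).and
        (eventually_lt_nhds (by positivity)))
    filter_upwards [h1, self_mem_nhdsWithin] with ε hε hε0
    refine key ε hε0 ?_ ?_
    · have := (lt_div_iff₀ hd0).1 hε.1; linarith
    · have := (lt_div_iff₀ (by positivity)).1 hε.2; linarith
  exact abs_nonpos_iff.1 hle

/-! ### Superpositions of translates of a test function -/

/-- The test function with a given underlying function. -/
def Test.mk (f : E d → ℝ) (hf : ContDiff ℝ (⊤ : ℕ∞) f) (hc : HasCompactSupport f) : Test d :=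
  ⟨f, hf, hc, by simp⟩

@[simp] lemma Test.mk_apply (f : E d → ℝ) (hf : ContDiff ℝ (⊤ : ℕ∞) f) (hc : HasCompactSupport f)
    (x : E d) : Test.mk f hf hc x = f x := rfl

lemma Test.contDiff (ψ : Test d) : ContDiff ℝ (⊤ : ℕ∞) ψ := TestFunction.contDiff ψ

lemma Test.hasCompactSupport (ψ : Test d) : HasCompactSupport ψ :=
  TestFunction.hasCompactSupport ψ

lemma Test.continuous (ψ : Test d) : Continuous ψ := TestFunction.continuous ψ

lemma Test.differentiable (ψ : Test d) : Differentiable ℝ ψ :=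
  ψ.contDiff.differentiable (by simp)

lemma Test.integrable (ψ : Test d) : Integrable ψ :=
  ψ.continuous.integrable_of_hasCompactSupport ψ.hasCompactSupport

lemma Test.exists_tsupport_subset (ψ : Test d) :
    ∃ R, 0 ≤ R ∧ tsupport ψ ⊆ Metric.closedBall 0 R := by
  obtain ⟨R, hR⟩ := ψ.hasCompactSupport.isCompact.isBounded.subset_closedBall 0
  exact ⟨max R 0, le_max_right _ _,
    hR.trans (Metric.closedBall_subset_closedBall (le_max_left _ _))⟩

lemma Test.exists_bound (ψ : Test d) : ∃ M, 0 ≤ M ∧ ∀ x, |ψ x| ≤ M := by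
  obtain ⟨C, hC⟩ := ψ.continuous.bounded_above_of_compact_support ψ.hasCompactSupport
  exact ⟨C, (norm_nonneg _).trans (hC 0), fun x => hC x⟩

lemma Test.exists_bound_fderiv (ψ : Test d) : ∃ M, 0 ≤ M ∧ ∀ x, ‖fderiv ℝ ψ x‖ ≤ M := by
  obtain ⟨C, hC⟩ := (ψ.contDiff.continuous_fderiv (by simp)).bounded_above_of_compact_support
    (ψ.hasCompactSupport.fderiv ℝ)
  exact ⟨C, (norm_nonneg _).trans (hC 0), fun x => hC x⟩

lemma Test.exists_lipschitz (ψ : Test d) : ∃ M, 0 ≤ M ∧ ∀ x y, |ψ x - ψ y| ≤ M * ‖x - y‖ := by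
  obtain ⟨M, h0, hM⟩ := ψ.exists_bound_fderiv
  refine ⟨M, h0, fun x y => ?_⟩
  exact convex_univ.norm_image_sub_le_of_norm_fderiv_le (fun z _ => ψ.differentiable z)
    (fun z _ => hM z) (mem_univ y) (mem_univ x)

lemma hasCompactSupport_of_bound {V : Type*} [Zero V] {f : E d → V} {R : ℝ}
    (h : ∀ x, R < ‖x‖ → f x = 0) : HasCompactSupport f :=
  HasCompactSupport.intro (isCompact_closedBall 0 R) fun x hx => h x (by simpa using hx)

/-- The translate `ψ(· - a)` of a test function. -/
def translate (a : E d) (ψ : Test d) : Test d :=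
  Test.mk (fun x => ψ (x - a)) (ψ.contDiff.comp (contDiff_id.sub contDiff_const)) (by
    obtain ⟨R, -, hR⟩ := ψ.exists_tsupport_subset
    refine hasCompactSupport_of_bound (R := R + ‖a‖) fun x hx => image_eq_zero_of_notMem_tsupport
      fun h => ?_
    have h1 := hR h
    rw [mem_closedBall_zero_iff] at h1
    have h2 := norm_add_le (x - a) a
    rw [sub_add_cancel] at h2
    linarith)

@[simp] lemma translate_apply (a : E d) (ψ : Test d) (x : E d) : translate a ψ x = ψ (x - a) := rfl

lemma translate_zero (ψ : Test d) : translate 0 ψ = ψ := by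
  ext x; simp

lemma translate_translate (a b : E d) (ψ : Test d) :
    translate a (translate b ψ) = translate (a + b) ψ := by
  ext x; simp [sub_sub]

/-- The conditions under which `∫ f t • ψ(· - g t) dt` is again a test function: the weight `f` is
integrable and the shifts `g` are bounded where `f` does not vanish. -/
structure IsSpread {T : Type*} [MeasureSpace T] (f : T → ℝ) (g : T → E d) : Prop where
  integrable : Integrable f
  measurable : Measurable g
  bounded : ∃ R, ∀ t, f t ≠ 0 → ‖g t‖ ≤ R

section Superpose

variable {T : Type*} [MeasureSpace T] {f : T → ℝ} {g : T → E d}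

lemma IsSpread.integrable_smul (h : IsSpread f g) {V : Type*} [NormedAddCommGroup V]
    [NormedSpace ℝ V] {G : E d → V} (hG : Continuous G) {M : ℝ} (hM : ∀ x, ‖G x‖ ≤ M) (x : E d) :
    Integrable fun t => f t • G (x - g t) := by
  have h1 : AEStronglyMeasurable (fun t => G (x - g t)) volume :=
    (hG.stronglyMeasurable.comp_measurable
      (measurable_const.sub h.measurable)).aestronglyMeasurable
  refine (h.integrable.norm.mul_const M).mono' (h.integrable.aestronglyMeasurable.smul h1)
    (Filter.Eventually.of_forall fun t => ?_)
  rw [norm_smul]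
  exact mul_le_mul_of_nonneg_left (hM _) (norm_nonneg _)

lemma IsSpread.hasFDerivAt (h : IsSpread f g) {V : Type*} [NormedAddCommGroup V]
    [NormedSpace ℝ V] {G : E d → V} (hG : ContDiff ℝ 1 G) (hc : HasCompactSupport G) (x : E d) :
    HasFDerivAt (fun x => ∫ t, f t • G (x - g t)) (∫ t, f t • fderiv ℝ G (x - g t)) x := by
  obtain ⟨M, hM⟩ := hG.continuous.bounded_above_of_compact_support hc
  have hG' := hG.continuous_fderiv (by simp)
  obtain ⟨M', hM'⟩ := hG'.bounded_above_of_compact_support (hc.fderiv ℝ)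
  refine hasFDerivAt_integral_of_dominated_of_fderiv_le (bound := fun t => |f t| * M')
    (F' := fun x t => f t • fderiv ℝ G (x - g t)) Filter.univ_mem
    (Filter.Eventually.of_forall fun y =>
      (h.integrable_smul hG.continuous hM y).aestronglyMeasurable)
    (h.integrable_smul hG.continuous hM x) (h.integrable_smul hG' hM' x).aestronglyMeasurable
    (Filter.Eventually.of_forall fun t y _ => ?_) (h.integrable.abs.mul_const _)
    (Filter.Eventually.of_forall fun t y _ => ?_)
  · rw [norm_smul, Real.norm_eq_abs]
    exact mul_le_mul_of_nonneg_left (hM' _) (abs_nonneg _)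
  · have h1 : HasFDerivAt G (fderiv ℝ G (y - g t)) (y - g t) :=
      (hG.differentiable (by simp) _).hasFDerivAt
    have h2 : HasFDerivAt (fun z : E d => z - g t) (ContinuousLinearMap.id ℝ (E d)) y :=
      (hasFDerivAt_id y).sub_const _
    exact (h1.comp y h2).const_smul (f t)

lemma Test.contDiff_iteratedFDeriv (ψ : Test d) (i : ℕ) :
    ContDiff ℝ (⊤ : ℕ∞) (iteratedFDeriv ℝ i ψ) :=
  ψ.contDiff.iteratedFDeriv_right (m := (⊤ : ℕ∞)) (by exact_mod_cast le_top)

/-- Superpositions are differentiated under the integral sign, to every order. -/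
lemma IsSpread.hasFTaylorSeriesUpTo (h : IsSpread f g) (ψ : Test d) :
    HasFTaylorSeriesUpTo (⊤ : ℕ∞) (fun x => ∫ t, f t • ψ (x - g t))
      fun x i => ∫ t, f t • iteratedFDeriv ℝ i ψ (x - g t) := by
  have hd : ∀ (i : ℕ) (x : E d), HasFDerivAt (fun x => ∫ t, f t • iteratedFDeriv ℝ i ψ (x - g t))
      (∫ t, f t • fderiv ℝ (iteratedFDeriv ℝ i ψ) (x - g t)) x := fun i x =>
    h.hasFDerivAt ((ψ.contDiff_iteratedFDeriv i).of_le (by simp))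
      (ψ.hasCompactSupport.iteratedFDeriv i) x
  refine ⟨fun x => ?_, fun i _ x => ?_, fun i _ => ?_⟩
  · let L := (continuousMultilinearCurryFin0 ℝ (E d) ℝ).toContinuousLinearEquiv
    change L (∫ t, f t • iteratedFDeriv ℝ 0 ψ (x - g t)) = _
    rw [← L.integral_comp_comm]
    exact integral_congr_ae (Filter.Eventually.of_forall fun t => by
      simp [L])
  · refine (hd i x).congr_fderiv ?_
    obtain ⟨M, hM⟩ := (ψ.contDiff_iteratedFDeriv i).continuous_fderiv (by simp)
      |>.bounded_above_of_compact_support ((ψ.hasCompactSupport.iteratedFDeriv i).fderiv ℝ)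
    obtain ⟨M', hM'⟩ := (ψ.contDiff_iteratedFDeriv (i + 1)).continuous
      |>.bounded_above_of_compact_support (ψ.hasCompactSupport.iteratedFDeriv (i + 1))
    have h1 := h.integrable_smul ((ψ.contDiff_iteratedFDeriv i).continuous_fderiv (by simp)) hM x
    have h2 := h.integrable_smul (ψ.contDiff_iteratedFDeriv (i + 1)).continuous hM' x
    ext v w
    change _ = (∫ t, f t • iteratedFDeriv ℝ (i + 1) ψ (x - g t)) (Fin.cons v w)
    rw [ContinuousLinearMap.integral_apply h1, ContinuousMultilinearMap.integral_apply,
      ContinuousMultilinearMap.integral_apply h2]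
    · refine integral_congr_ae (Filter.Eventually.of_forall fun t => ?_)
      simp [iteratedFDeriv_succ_apply_left]
    · exact h1.apply_continuousLinearMap v
  · exact continuous_iff_continuousAt.2 fun x => (hd i x).continuousAt

/-- The superposition `∫ f t • ψ(· - g t) dt` of translates of a test function. -/
def superpose (h : IsSpread f g) (ψ : Test d) : Test d :=
  Test.mk (fun x => ∫ t, f t • ψ (x - g t))
    (contDiff_iff_ftaylorSeries.2 (by
      have h1 := h.hasFTaylorSeriesUpTo ψ
      exact contDiff_iff_ftaylorSeries.1 h1.contDiff)) (by
    obtain ⟨R, hR⟩ := h.bounded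
    obtain ⟨R', -, hR'⟩ := ψ.exists_tsupport_subset
    refine hasCompactSupport_of_bound (R := R + R') fun x hx => ?_
    refine integral_eq_zero_of_ae (Filter.Eventually.of_forall fun t => ?_)
    by_cases hf : f t = 0
    · simp [hf]
    have h1 : ψ (x - g t) = 0 := image_eq_zero_of_notMem_tsupport fun h2 => by
      have h3 := hR' h2
      rw [mem_closedBall_zero_iff] at h3
      have h4 := norm_add_le (x - g t) (g t)
      rw [sub_add_cancel] at h4
      linarith [hR t hf]
    simp [h1])

lemma superpose_apply (h : IsSpread f g) (ψ : Test d) (x : E d) :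
    superpose h ψ x = ∫ t, f t * ψ (x - g t) := rfl

lemma iteratedFDeriv_superpose (h : IsSpread f g) (ψ : Test d) (i : ℕ) (x : E d) :
    iteratedFDeriv ℝ i (superpose h ψ) x = ∫ t, f t • iteratedFDeriv ℝ i ψ (x - g t) :=
  ((h.hasFTaylorSeriesUpTo ψ).eq_iteratedFDeriv (by exact_mod_cast le_top) x).symm

lemma fderiv_superpose (h : IsSpread f g) (ψ : Test d) (x : E d) :
    fderiv ℝ (superpose h ψ) x = ∫ t, f t • fderiv ℝ ψ (x - g t) :=
  (h.hasFDerivAt (ψ.contDiff.of_le (by simp)) ψ.hasCompactSupport x).fderiv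

lemma lineDerivOp_apply_eq (v : E d) (ψ : Test d) (x : E d) : (∂_{v} ψ) x = fderiv ℝ ψ x v := by
  rw [TestFunction.lineDerivOp_eq_lineDerivCLM ℝ, TestFunction.lineDerivCLM_apply_of_le (by simp),
    (ψ.differentiable x).lineDeriv_eq_fderiv]

lemma lineDerivOp_superpose (h : IsSpread f g) (ψ : Test d) (v : E d) :
    ∂_{v} (superpose h ψ) = superpose h (∂_{v} ψ) := by
  ext x
  obtain ⟨M, -, hM⟩ := ψ.exists_bound_fderiv
  rw [lineDerivOp_apply_eq, fderiv_superpose, ContinuousLinearMap.integral_apply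
    (h.integrable_smul (ψ.contDiff.continuous_fderiv (by simp)) hM x), superpose_apply]
  simp [lineDerivOp_apply_eq]

end Superpose

/-! ### Distributions applied to superpositions -/

/-- Bounded continuous functions with values in the `i`-linear forms on `ℝ^d`. -/
abbrev Jet (d i : ℕ) : Type := BoundedContinuousFunction (E d) (E d [×i]→L[ℝ] ℝ)

instance (i : ℕ) : NormedAddCommGroup (Jet d i) := inferInstance

instance (i : ℕ) : NormedSpace ℝ (Jet d i) := inferInstance

/-- The `i`-th derivative of a test function as a bounded continuous function. -/
def derivBCF (i : ℕ) (ψ : Test d) : Jet d i :=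
  BoundedContinuousFunction.ofNormedAddCommGroup (iteratedFDeriv ℝ i ψ)
    (ψ.contDiff_iteratedFDeriv i).continuous
    ((ψ.contDiff_iteratedFDeriv i).continuous.bounded_above_of_compact_support
      (ψ.hasCompactSupport.iteratedFDeriv i)).choose
    ((ψ.contDiff_iteratedFDeriv i).continuous.bounded_above_of_compact_support
      (ψ.hasCompactSupport.iteratedFDeriv i)).choose_spec

@[simp] lemma derivBCF_apply (i : ℕ) (ψ : Test d) (x : E d) :
    derivBCF i ψ x = iteratedFDeriv ℝ i ψ x := rfl

/-- A functional bounded by the norm of an injective linear map extends along that map, by the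
Hahn–Banach theorem. -/
lemma exists_extension_of_le {V W : Type*} [AddCommGroup V] [Module ℝ V] [NormedAddCommGroup W]
    [NormedSpace ℝ W] (J : V →ₗ[ℝ] W) (hJ : Function.Injective J) (G : V →ₗ[ℝ] ℝ) (C : ℝ)
    (hb : ∀ a, ‖G a‖ ≤ C * ‖J a‖) : ∃ L : StrongDual ℝ W, ∀ a, L (J a) = G a := by
  let e := LinearEquiv.ofInjective J hJ
  let f : StrongDual ℝ (LinearMap.range J) :=
    (G ∘ₗ e.symm.toLinearMap).mkContinuous C fun x => by
      obtain ⟨a, rfl⟩ := e.surjective x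
      change ‖G (e.symm (e a))‖ ≤ C * ‖J a‖
      rw [e.symm_apply_apply]
      exact hb a
  obtain ⟨L, hL, -⟩ := exists_extension_norm_eq (LinearMap.range J) f
  refine ⟨L, fun a => ?_⟩
  have h : J a = e a := rfl
  rw [h, hL]
  simp [f]

/-- On test functions supported in a fixed ball, a distribution is a continuous linear functional
of finitely many derivatives, by the Hahn–Banach theorem. -/
lemma exists_functional (F : Distr d) (R : ℝ) : ∃ (s : Finset ℕ)
    (L : StrongDual ℝ ((i : s) → Jet d i)),
    ∀ ψ : Test d, tsupport ψ ⊆ Metric.closedBall 0 R → F ψ = L fun i => derivBCF i ψ := by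
  let K : TopologicalSpace.Compacts (E d) := ⟨Metric.closedBall 0 R, isCompact_closedBall 0 R⟩
  have hK : (K : Set (E d)) ⊆ (⊤ : TopologicalSpace.Opens (E d)) := fun _ _ => trivial
  let G : ContDiffMapSupportedIn (E d) ℝ (⊤ : ℕ∞) K →L[ℝ] ℝ :=
    (F : Test d →L[ℝ] ℝ).comp (TestFunction.ofSupportedInCLM ℝ hK)
  obtain ⟨s, C, -, hs⟩ := Seminorm.bound_of_continuous
    (ContDiffMapSupportedIn.withSeminorms ℝ (E d) ℝ (⊤ : ℕ∞) K)
    ((normSeminorm ℝ ℝ).comp G.toLinearMap) (by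
      exact continuous_norm.comp G.continuous)
  let s' := insert 0 s
  let J : ContDiffMapSupportedIn (E d) ℝ (⊤ : ℕ∞) K →ₗ[ℝ]
      ((i : s') → Jet d i) :=
    LinearMap.pi fun i => ContDiffMapSupportedIn.structureMapLM ℝ (⊤ : ℕ∞) (i : ℕ)
  have hJ : Function.Injective J := fun a b hab =>
    ContDiffMapSupportedIn.structureMapLM_zero_injective ℝ
      (congrFun hab ⟨0, Finset.mem_insert_self 0 s⟩)
  have hb : ∀ a, ‖G a‖ ≤ C * ‖J a‖ := fun a => by
    refine (hs a).trans ?_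
    change (C : ℝ) * (s.sup (ContDiffMapSupportedIn.seminorm ℝ (E d) ℝ (⊤ : ℕ∞) K)) a ≤ _
    refine mul_le_mul_of_nonneg_left (Seminorm.finset_sup_apply_le (norm_nonneg _) fun i hi => ?_)
      C.2
    exact norm_le_pi_norm (J a) ⟨i, Finset.mem_insert_of_mem hi⟩
  obtain ⟨L, hL⟩ := exists_extension_of_le J hJ G.toLinearMap C hb
  refine ⟨s', L, fun ψ hψ => ?_⟩
  let a : ContDiffMapSupportedIn (E d) ℝ (⊤ : ℕ∞) K :=
    ContDiffMapSupportedIn.of_support_subset ψ.contDiff ((subset_tsupport ψ).trans hψ)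
  have h1 : F ψ = G a := congrArg F (by ext x; rfl)
  have h2 : (fun i : s' => derivBCF (i : ℕ) ψ) = J a := by
    funext i
    ext x : 1
    change _ = (ContDiffMapSupportedIn.structureMapLM ℝ (⊤ : ℕ∞) (i : ℕ) a) x
    rw [ContDiffMapSupportedIn.structureMapLM_top_apply]
    rfl
  rw [h1, h2, hL]
  rfl

lemma derivBCF_translate (i : ℕ) (a : E d) (ψ : Test d) (x : E d) :
    derivBCF i (translate a ψ) x = iteratedFDeriv ℝ i ψ (x - a) :=
  iteratedFDeriv_comp_sub i a x

lemma continuous_derivBCF_translate (i : ℕ) (ψ : Test d) :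
    Continuous fun a => derivBCF i (translate a ψ) := by
  have hu : UniformContinuous (iteratedFDeriv ℝ i ψ) :=
    (ψ.hasCompactSupport.iteratedFDeriv i).uniformContinuous_of_continuous
      (ψ.contDiff_iteratedFDeriv i).continuous
  refine Metric.continuous_iff.2 fun b ε hε => ?_
  obtain ⟨δ, hδ, h⟩ := Metric.uniformContinuous_iff.1 hu (ε / 2) (half_pos hε)
  refine ⟨δ, hδ, fun a ha => ?_⟩
  refine lt_of_le_of_lt ((BoundedContinuousFunction.dist_le (half_pos hε).le).2 fun x => ?_)
    (half_lt_self hε)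
  rw [derivBCF_translate, derivBCF_translate]
  refine (h ?_).le
  rwa [dist_sub_left]

lemma norm_derivBCF_translate (i : ℕ) (a : E d) (ψ : Test d) :
    ‖derivBCF i (translate a ψ)‖ ≤ ‖derivBCF i ψ‖ := by
  refine (BoundedContinuousFunction.norm_le (norm_nonneg _)).2 fun x => ?_
  rw [derivBCF_translate]
  exact (derivBCF i ψ).norm_coe_le_norm (x - a)

lemma tsupport_translate_subset {ψ : Test d} {R : ℝ} (h : tsupport ψ ⊆ Metric.closedBall 0 R)
    (a : E d) : tsupport (translate a ψ) ⊆ Metric.closedBall a R := by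
  refine closure_minimal (fun x hx => ?_) Metric.isClosed_closedBall
  have h1 := h (subset_tsupport _ (show x - a ∈ Function.support ψ from hx))
  rwa [mem_closedBall_zero_iff, ← dist_eq_norm] at h1

lemma continuous_apply_translate (F : Distr d) (ψ : Test d) :
    Continuous fun a => F (translate a ψ) := by
  obtain ⟨R, hR0, hR⟩ := ψ.exists_tsupport_subset
  refine continuous_iff_continuousAt.2 fun b => ?_
  obtain ⟨s, L, hL⟩ := exists_functional F (‖b‖ + 1 + R)
  have h1 : Continuous fun a => L fun i => derivBCF i (translate a ψ) :=
    L.continuous.comp (continuous_pi fun i => continuous_derivBCF_translate i ψ)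
  refine h1.continuousAt.congr ?_
  filter_upwards [Metric.ball_mem_nhds b one_pos] with a ha
  refine (hL _ ((tsupport_translate_subset hR a).trans ?_)).symm
  refine Metric.closedBall_subset_closedBall' ?_
  have h2 : ‖a‖ ≤ ‖b‖ + 1 := by
    have := norm_le_norm_add_norm_sub (b : E d) a
    rw [Metric.mem_ball, dist_comm, dist_eq_norm] at ha
    linarith
  rw [dist_zero_right]
  linarith

section Superpose

variable {T : Type*} [MeasureSpace T] {f : T → ℝ} {g : T → E d}

lemma integral_apply_bcf {V : Type*} [NormedAddCommGroup V] [NormedSpace ℝ V] [CompleteSpace V]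
    {H : T → BoundedContinuousFunction (E d) V} (hH : Integrable H) (x : E d) :
    (∫ t, H t) x = ∫ t, H t x :=
  ((BoundedContinuousFunction.evalCLM ℝ x).integral_comp_comm hH).symm

/-- A distribution commutes with superpositions of translates. -/
lemma apply_superpose (F : Distr d) (h : IsSpread f g) (ψ : Test d) :
    (Integrable fun t => f t * F (translate (g t) ψ)) ∧
      F (superpose h ψ) = ∫ t, f t * F (translate (g t) ψ) := by
  obtain ⟨R, hR⟩ := h.bounded
  obtain ⟨R', hR'0, hR'⟩ := ψ.exists_tsupport_subset
  obtain ⟨s, L, hL⟩ := exists_functional F (R + R')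
  let H : T → ((i : s) → Jet d i) :=
    fun t i => f t • derivBCF i (translate (g t) ψ)
  have hHi : ∀ i : s, Integrable fun t => H t i := fun i => by
    have h1 : AEStronglyMeasurable (fun t => derivBCF i (translate (g t) ψ)) volume :=
      ((continuous_derivBCF_translate i ψ).stronglyMeasurable.comp_measurable
        h.measurable).aestronglyMeasurable
    refine (h.integrable.norm.mul_const ‖derivBCF i ψ‖).mono'
      (h.integrable.aestronglyMeasurable.smul h1) (Filter.Eventually.of_forall fun t => ?_)
    rw [norm_smul]
    exact mul_le_mul_of_nonneg_left (norm_derivBCF_translate _ _ _) (norm_nonneg _)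
  have hH : Integrable H := Integrable.of_eval hHi
  have h2 : ∀ t, L (H t) = f t * F (translate (g t) ψ) := fun t => by
    have h3 : H t = f t • fun i : s => derivBCF i (translate (g t) ψ) := rfl
    rw [h3, map_smul, smul_eq_mul]
    by_cases hf : f t = 0
    · simp [hf]
    rw [hL _ ((tsupport_translate_subset hR' _).trans (Metric.closedBall_subset_closedBall' ?_))]
    rw [dist_zero_right]
    linarith [hR t hf]
  have h3 : (fun i : s => derivBCF i (superpose h ψ)) = ∫ t, H t := by
    funext i
    rw [eval_integral hHi]
    ext x : 1
    rw [integral_apply_bcf (hHi i), derivBCF_apply, iteratedFDeriv_superpose]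
    refine integral_congr_ae (Filter.Eventually.of_forall fun t => ?_)
    simp only [H, BoundedContinuousFunction.coe_smul, derivBCF_translate]
  have h4 : tsupport (superpose h ψ) ⊆ Metric.closedBall 0 (R + R') := by
    refine closure_minimal (fun x hx => ?_) Metric.isClosed_closedBall
    rw [mem_closedBall_zero_iff]
    by_contra hlt
    refine hx (integral_eq_zero_of_ae (Filter.Eventually.of_forall fun t => ?_))
    by_cases hf : f t = 0
    · simp [hf]
    have h1 : ψ (x - g t) = 0 := image_eq_zero_of_notMem_tsupport fun h2 => by
      have h3 := hR' h2
      rw [mem_closedBall_zero_iff] at h3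
      have h4 := norm_add_le (x - g t) (g t)
      rw [sub_add_cancel] at h4
      linarith [hR t hf]
    simp [h1]
  refine ⟨(L.integrable_comp hH).congr (Filter.Eventually.of_forall h2), ?_⟩
  rw [hL _ h4, h3, ← L.integral_comp_comm hH]
  exact integral_congr_ae (Filter.Eventually.of_forall h2)

end Superpose

/-- The product of two test functions. -/
def testMul (φ ψ : Test d) : Test d :=
  Test.mk (fun x => φ x * ψ x) (φ.contDiff.mul ψ.contDiff) φ.hasCompactSupport.mul_right

@[simp] lemma testMul_apply (φ ψ : Test d) (x : E d) : testMul φ ψ x = φ x * ψ x := rfl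

/-- The product `ψ ↦ F(φψ)` of a distribution with a test function. -/
def distrMul (φ : Test d) (F : Distr d) : Distr d :=
  (TestFunction.limitCLM ℝ (fun ψ => F (testMul φ ψ))
    (fun _ hK => ((F : Test d →L[ℝ] ℝ).comp (TestFunction.ofSupportedInCLM ℝ hK)).comp
      (ContDiffMapSupportedIn.bilinLeftCLM (ContinuousLinearMap.mul ℝ ℝ) φ.contDiff))
    (fun K hK ψ => congrArg F (by ext x; exact mul_comm _ _)) : Test d →L[ℝ] ℝ)

lemma distrMul_apply (φ ψ : Test d) (F : Distr d) : distrMul φ F ψ = F (testMul φ ψ) := rfl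

/-! ### Averages along the coordinate directions -/

/-- The `i`-th standard basis vector. -/
def basisVec (i : Fin d) : E d := EuclideanSpace.single i (1 : ℝ)

lemma norm_basisVec (i : Fin d) : ‖basisVec i‖ = 1 := by simp [basisVec]

lemma basisVec_self (i : Fin d) : basisVec i i = 1 := by simp [basisVec]

lemma basisVec_of_ne {i j : Fin d} (h : j ≠ i) : basisVec i j = 0 := by simp [basisVec, h]

lemma isSpread_avg (i : Fin d) (ε : ℝ) :
    IsSpread (T := ℝ) ((Icc (0 : ℝ) 1).indicator 1) fun t => (t * ε) • (basisVec i) where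
  integrable := (integrable_indicator_iff measurableSet_Icc).2
    (integrableOn_const measure_Icc_lt_top.ne)
  measurable := ((continuous_id.mul continuous_const).smul continuous_const).measurable
  bounded := ⟨|ε|, fun t ht => by
    have ht' : t ∈ Icc (0 : ℝ) 1 := by
      by_contra h
      exact ht (indicator_of_notMem h _)
    rw [norm_smul, norm_basisVec, mul_one, Real.norm_eq_abs, abs_mul, abs_of_nonneg ht'.1]
    exact mul_le_of_le_one_left (abs_nonneg _) ht'.2⟩

/-- The average `∫ t in 0..1, ψ(· - t ε e_i)` of a test function. -/
def avg (i : Fin d) (ε : ℝ) (ψ : Test d) : Test d := superpose (isSpread_avg i ε) ψ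

lemma avg_apply (i : Fin d) (ε : ℝ) (ψ : Test d) (x : E d) :
    avg i ε ψ x = ∫ t in (0 : ℝ)..1, ψ (x - (t * ε) • basisVec i) := by
  rw [avg, superpose_apply, intervalIntegral.integral_of_le zero_le_one,
    ← integral_Icc_eq_integral_Ioc, ← integral_indicator measurableSet_Icc]
  refine integral_congr_ae (Filter.Eventually.of_forall fun t => ?_)
  by_cases ht : t ∈ Icc (0 : ℝ) 1 <;> simp [ht]

lemma continuous_shift (ψ : Test d) (i : Fin d) (ε : ℝ) (x : E d) :
    Continuous fun t : ℝ => ψ (x - (t * ε) • basisVec i) :=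
  ψ.continuous.comp (continuous_const.sub ((continuous_id.mul continuous_const).smul
    continuous_const))

lemma lineDerivOp_avg (v : E d) (i : Fin d) (ε : ℝ) (ψ : Test d) :
    ∂_{v} (avg i ε ψ) = avg i ε (∂_{v} ψ) := lineDerivOp_superpose _ _ _

/-- The derivative of an average is a difference quotient. -/
lemma lineDerivOp_avg_apply (i : Fin d) (ε : ℝ) (ψ : Test d) (x : E d) :
    ε * (∂_{basisVec i} (avg i ε ψ)) x = ψ x - ψ (x - ε • basisVec i) := by
  rw [lineDerivOp_avg, avg_apply]
  have h : ∀ t ∈ uIcc (0 : ℝ) 1, HasDerivAt (fun t : ℝ => ψ (x - (t * ε) • basisVec i))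
      (-(ε * (∂_{basisVec i} ψ) (x - (t * ε) • basisVec i))) t := by
    intro t _
    have h1 : HasDerivAt (fun t : ℝ => x - (t * ε) • basisVec i) (-((1 * ε) • basisVec i)) t :=
      (((hasDerivAt_id t).mul_const ε).smul_const _).const_sub x
    have h2 := (ψ.differentiable (x - (t * ε) • basisVec i)).hasFDerivAt.comp_hasDerivAt t h1
    refine h2.congr_deriv ?_
    rw [lineDerivOp_apply_eq, one_mul, map_neg, map_smul, smul_eq_mul]
  have h3 := intervalIntegral.integral_eq_sub_of_hasDerivAt h
    ((((continuous_shift (∂_{basisVec i} ψ) i ε x).const_mul ε).neg).intervalIntegrable _ _)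
  rw [intervalIntegral.integral_neg, intervalIntegral.integral_const_mul] at h3
  simp only [one_mul, zero_mul, zero_smul, sub_zero] at h3
  linarith

lemma abs_avg_sub_le {ψ : Test d} {L : ℝ} (hL : ∀ x y, |ψ x - ψ y| ≤ L * ‖x - y‖) (i : Fin d)
    {ε : ℝ} (hε : 0 ≤ ε) (x : E d) : |avg i ε ψ x - ψ x| ≤ L * ε := by
  have hL0 : 0 ≤ L := by
    have h1 := (abs_nonneg _).trans (hL (basisVec i) 0)
    rwa [sub_zero, norm_basisVec, mul_one] at h1
  have h1 : avg i ε ψ x - ψ x = ∫ t in (0 : ℝ)..1, (ψ (x - (t * ε) • basisVec i) - ψ x) := by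
    rw [intervalIntegral.integral_sub ((continuous_shift ψ i ε x).intervalIntegrable _ _)
      (by simp), avg_apply]
    simp
  rw [h1]
  have h2 : L * ε * |(1 : ℝ) - 0| = L * ε := by rw [sub_zero, abs_one, mul_one]
  rw [← h2, ← Real.norm_eq_abs]
  refine intervalIntegral.norm_integral_le_of_norm_le_const fun t ht => ?_
  rw [uIoc_of_le zero_le_one] at ht
  refine (hL _ _).trans (mul_le_mul_of_nonneg_left ?_ hL0)
  rw [sub_sub_cancel_left, norm_neg, norm_smul, norm_basisVec, mul_one, Real.norm_eq_abs,
    abs_of_nonneg (mul_nonneg ht.1.le hε)]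
  exact mul_le_of_le_one_left hε ht.2

lemma avg_lipschitz {ψ : Test d} {L : ℝ} (hL : ∀ x y, |ψ x - ψ y| ≤ L * ‖x - y‖) (i : Fin d)
    (ε : ℝ) (x y : E d) : |avg i ε ψ x - avg i ε ψ y| ≤ L * ‖x - y‖ := by
  rw [avg_apply, avg_apply, ← intervalIntegral.integral_sub
    ((continuous_shift ψ i ε x).intervalIntegrable _ _)
    ((continuous_shift ψ i ε y).intervalIntegrable _ _)]
  have h2 : L * ‖x - y‖ * |(1 : ℝ) - 0| = L * ‖x - y‖ := by rw [sub_zero, abs_one, mul_one]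
  rw [← h2, ← Real.norm_eq_abs]
  refine intervalIntegral.norm_integral_le_of_norm_le_const fun t _ => ?_
  simpa using hL (x - (t * ε) • basisVec i) (y - (t * ε) • basisVec i)

lemma avg_eq_zero {ψ : Test d} {R : ℝ} (hR : ∀ x, R < ‖x‖ → ψ x = 0) (i : Fin d) {ε : ℝ}
    (hε : 0 ≤ ε) {x : E d} (hx : R + ε < ‖x‖) : avg i ε ψ x = 0 := by
  rw [avg_apply]
  refine (intervalIntegral.integral_congr fun t ht => ?_).trans intervalIntegral.integral_zero
  rw [uIcc_of_le zero_le_one] at ht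
  refine hR _ ?_
  have h1 := norm_sub_norm_le x ((t * ε) • basisVec i)
  rw [norm_smul, norm_basisVec, mul_one, Real.norm_eq_abs, abs_of_nonneg (mul_nonneg ht.1 hε)] at h1
  have h2 : t * ε ≤ ε := mul_le_of_le_one_left hε ht.2
  linarith

/-- Successive averages in the directions listed by `m`. -/
def avgs : {n : ℕ} → (Fin n → Fin d) → ℝ → Test d → Test d
  | 0, _, _, ψ => ψ
  | n + 1, m, ε, ψ => avgs (Fin.init m) ε (avg (m (Fin.last n)) ε ψ)

lemma lineDerivOp_avgs (v : E d) {n : ℕ} (m : Fin n → Fin d) (ε : ℝ) (ψ : Test d) :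
    ∂_{v} (avgs m ε ψ) = avgs m ε (∂_{v} ψ) := by
  induction n generalizing ψ with
  | zero => rfl
  | succ n ih => rw [avgs, ih, lineDerivOp_avg, avgs]

lemma iteratedLineDerivOp_avgs {k : ℕ} (e : Fin k → E d) {n : ℕ} (m : Fin n → Fin d) (ε : ℝ)
    (ψ : Test d) : ∂^{e} (avgs m ε ψ) = avgs m ε (∂^{e} ψ) := by
  induction k with
  | zero => rfl
  | succ k ih =>
    rw [LineDeriv.iteratedLineDerivOp_succ_left, ih, lineDerivOp_avgs,
      ← LineDeriv.iteratedLineDerivOp_succ_left]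

lemma abs_avgs_sub_le {n : ℕ} (m : Fin n → Fin d) {ψ : Test d} {L : ℝ}
    (hL : ∀ x y, |ψ x - ψ y| ≤ L * ‖x - y‖) {ε : ℝ} (hε : 0 ≤ ε) (x : E d) :
    |avgs m ε ψ x - ψ x| ≤ n * (L * ε) := by
  induction n generalizing ψ with
  | zero => simp [avgs]
  | succ n ih =>
    have h1 := ih (Fin.init m) (avg_lipschitz hL (m (Fin.last n)) ε)
    have h2 := abs_avg_sub_le hL (m (Fin.last n)) hε x
    have h3 := abs_sub_le (avgs m ε ψ x) (avg (m (Fin.last n)) ε ψ x) (ψ x)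
    rw [avgs] at h3 ⊢
    push_cast
    linarith

lemma avgs_eq_zero {n : ℕ} (m : Fin n → Fin d) {ψ : Test d} {R : ℝ} (hR : ∀ x, R < ‖x‖ → ψ x = 0)
    {ε : ℝ} (hε : 0 ≤ ε) {x : E d} (hx : R + n * ε < ‖x‖) : avgs m ε ψ x = 0 := by
  induction n generalizing ψ R with
  | zero => exact hR x (by simpa using hx)
  | succ n ih =>
    refine ih (Fin.init m) (R := R + ε) (fun y hy => avg_eq_zero hR _ hε hy) ?_
    push_cast at hx
    linarith

/-! ### The distribution of a cochain -/

/-- Measurable functions that are bounded on bounded sets. -/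
def IsLocBounded (b : E d → ℝ) : Prop :=
  Measurable b ∧ ∀ R : ℝ, ∃ M : ℝ, ∀ v, ‖v‖ ≤ R → |b v| ≤ M

lemma IsLocBounded.locallyIntegrable {b : E d → ℝ} (hb : IsLocBounded b) : LocallyIntegrable b := by
  refine locallyIntegrable_iff.2 fun K hK => ?_
  obtain ⟨R, hR⟩ := hK.isBounded.subset_closedBall 0
  obtain ⟨M, hM⟩ := hb.2 R
  refine Measure.integrableOn_of_bounded (M := M) hK.measure_lt_top.ne
    hb.1.aestronglyMeasurable ?_
  refine (ae_restrict_iff' hK.measurableSet).2 (Filter.Eventually.of_forall fun v hv => hM v ?_)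
  simpa using hR hv

lemma IsLocBounded.integrable_mul {b : E d → ℝ} (hb : IsLocBounded b) (ψ : Test d) :
    Integrable fun v => b v * ψ v := by
  have h := hb.locallyIntegrable.integrable_smul_right_of_hasCompactSupport ψ.continuous
    ψ.hasCompactSupport
  simpa [mul_comm] using h

lemma isLocBounded_boxValue (hd : 1 ≤ d) {α : ℝ} (hα : 0 < α) {A : Vertices d d → ℝ}
    (hA : A ∈ Cochain d d) (hG : growthNorm α A ≠ ⊤) {f g : E d → E d} (hf : Measurable f)
    (hg : Measurable g) {c : ℝ} (hfc : ∀ v i, |f v i| ≤ ‖v‖ + c) (hgc : ∀ v i, |g v i| ≤ ‖v‖ + c) :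
    IsLocBounded fun v => boxValue A (f v) (g v) := by
  refine ⟨measurable_boxValue hA.1 hf hg, fun R => ?_⟩
  obtain ⟨M, hM⟩ := exists_boxValue_bound hd hα hA hG (d * (R + c))
  refine ⟨M, fun v hv => hM _ _ ?_ ?_⟩
  · have h0 : 0 ≤ R + c := ((abs_nonneg _).trans (hfc v ⟨0, hd⟩)).trans (by linarith)
    exact norm_le_of_coord_le h0 fun i => (hfc v i).trans (by linarith)
  · have h0 : 0 ≤ R + c := ((abs_nonneg _).trans (hgc v ⟨0, hd⟩)).trans (by linarith)
    exact norm_le_of_coord_le h0 fun i => (hgc v i).trans (by linarith)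

/-- The primitive `v ↦ A([0, v_1] × ⋯ × [0, v_d])` of a cochain. -/
def primitive (A : Vertices d d → ℝ) (v : E d) : ℝ := boxValue A 0 v

lemma isLocBounded_primitive (hd : 1 ≤ d) {α : ℝ} (hα : 0 < α) {A : Vertices d d → ℝ}
    (hA : A ∈ Cochain d d) (hG : growthNorm α A ≠ ⊤) : IsLocBounded (primitive A) :=
  isLocBounded_boxValue hd hα hA hG (f := fun _ => 0) measurable_const measurable_id (c := 0)
    (fun v i => by simp) (fun v i => by simpa using PiLp.norm_apply_le v i)

/-- The distribution `(-1)^d ∂_1 ⋯ ∂_d` of the primitive of a cochain. It is `0` by convention when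
the primitive is not locally integrable. -/
def toDistr (A : Vertices d d → ℝ) : Distr d :=
  (((-1 : ℝ) ^ d) • (TestFunction.integralAgainstBilinCLM (ContinuousLinearMap.mul ℝ ℝ) volume
    (primitive A)).comp (LineDeriv.iteratedLineDerivOpCLM ℝ (Test d)
      (fun i : Fin d => (EuclideanSpace.single i (1 : ℝ) : E d))) : Test d →L[ℝ] ℝ)

lemma toDistr_apply {A : Vertices d d → ℝ} (hA : IsLocBounded (primitive A)) (ψ : Test d) :
    toDistr A ψ = (-1) ^ d * ∫ v : E d, primitive A v * mixedDeriv ψ v := by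
  change (-1 : ℝ) ^ d * (TestFunction.integralAgainstBilinCLM (ContinuousLinearMap.mul ℝ ℝ) volume
    (primitive A) (mixedDeriv ψ)) = _
  rw [TestFunction.integralAgainstBilinCLM_eq_integral
    (hA.locallyIntegrable.locallyIntegrableOn _)]
  simp [mul_comm]

/-- The corner with coordinates `v_i` for `i ∈ S` and `0` otherwise. -/
def lowCorner (S : Finset (Fin d)) (v : E d) : E d :=
  WithLp.toLp 2 fun i => if i ∈ S then v i else 0

/-- The corner with coordinates `v_i + ε` for `i ∈ S` and `v_i` otherwise. -/
def highCorner (S : Finset (Fin d)) (ε : ℝ) (v : E d) : E d :=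
  WithLp.toLp 2 fun i => if i ∈ S then v i + ε else v i

lemma lowCorner_apply (S : Finset (Fin d)) (v : E d) (i : Fin d) :
    lowCorner S v i = if i ∈ S then v i else 0 := rfl

lemma highCorner_apply (S : Finset (Fin d)) (ε : ℝ) (v : E d) (i : Fin d) :
    highCorner S ε v i = if i ∈ S then v i + ε else v i := rfl

lemma continuous_lowCorner (S : Finset (Fin d)) : Continuous (lowCorner S) := by
  refine (PiLp.continuous_toLp 2 _).comp (continuous_pi fun i => ?_)
  by_cases h : i ∈ S
  · simpa [h] using (by fun_prop : Continuous fun x : E d => x i)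
  · simpa [h] using continuous_const

lemma continuous_highCorner (S : Finset (Fin d)) (ε : ℝ) : Continuous (highCorner S ε) := by
  refine (PiLp.continuous_toLp 2 _).comp (continuous_pi fun i => ?_)
  have h1 : Continuous fun x : E d => x i := by fun_prop
  by_cases h : i ∈ S
  · simp only [h, if_true]
    fun_prop
  · simpa [h] using h1

lemma isLocBounded_partial (hd : 1 ≤ d) {α : ℝ} (hα : 0 < α) {A : Vertices d d → ℝ}
    (hA : A ∈ Cochain d d) (hG : growthNorm α A ≠ ⊤) (S : Finset (Fin d)) (ε : ℝ) :
    IsLocBounded fun v => boxValue A (lowCorner S v) (highCorner S ε v) := by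
  refine isLocBounded_boxValue hd hα hA hG (continuous_lowCorner S).measurable
    (continuous_highCorner S ε).measurable (c := |ε|) (fun v i => ?_) fun v i => ?_
  · have h := PiLp.norm_apply_le v i
    rw [Real.norm_eq_abs] at h
    rw [lowCorner_apply]
    split_ifs
    · linarith [abs_nonneg ε]
    · rw [abs_zero]; positivity
  · have h := PiLp.norm_apply_le v i
    rw [Real.norm_eq_abs] at h
    rw [highCorner_apply]
    split_ifs
    · exact (abs_add_le _ _).trans (by linarith)
    · linarith [abs_nonneg ε]

/-- Extruding a box in one more direction is the same as differencing its translates. -/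
lemma boxValue_insert (hd : 1 ≤ d) {A : Vertices d d → ℝ} (hA : A ∈ Cochain d d)
    (S : Finset (Fin d)) {i : Fin d} (hi : i ∉ S) (ε : ℝ) (v : E d) :
    boxValue A (lowCorner (insert i S) v) (highCorner (insert i S) ε v) =
      boxValue A (lowCorner S (v + ε • basisVec i)) (highCorner S ε (v + ε • basisVec i)) -
        boxValue A (lowCorner S v) (highCorner S ε v) := by
  have hv : ∀ j, j ≠ i → (v + ε • basisVec i) j = v j := fun j hj => by
    simp [basisVec_of_ne hj]
  have hvi : (v + ε • basisVec i) i = v i + ε := by simp [basisVec_self]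
  have hlow : lowCorner S (v + ε • basisVec i) = lowCorner S v := by
    ext j
    rw [lowCorner_apply, lowCorner_apply]
    split_ifs with h
    · exact hv j fun h' => hi (h' ▸ h)
    · rfl
  have hhigh : highCorner S ε (v + ε • basisVec i) = highCorner (insert i S) ε v := by
    ext j
    rw [highCorner_apply, highCorner_apply]
    by_cases hj : j = i
    · subst hj; simp [hi, hvi]
    · simp [hj, hv j hj]
  rw [hlow, hhigh, boxValue_split hd hA (lowCorner S v) (highCorner (insert i S) ε v)
    (lowCorner (insert i S) v) (highCorner S ε v) i]
  · ring
  · intro j hj; simp [lowCorner_apply, hj]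
  · intro j hj; simp [highCorner_apply, hj]
  · simp [lowCorner_apply, highCorner_apply, hi]

/-- Differencing the primitive in the directions listed by `m` amounts to differentiating averages
of the test function. -/
lemma integral_partial (hd : 1 ≤ d) {α : ℝ} (hα : 0 < α) {A : Vertices d d → ℝ}
    (hA : A ∈ Cochain d d) (hG : growthNorm α A ≠ ⊤) (ε : ℝ) {n : ℕ} (m : Fin n → Fin d)
    (hm : Function.Injective m) (ψ : Test d) :
    ∫ v, boxValue A (lowCorner (Finset.univ.image m) v) (highCorner (Finset.univ.image m) ε v) *
      ψ v = (-ε) ^ n * ∫ v, primitive A v * (∂^{fun k => basisVec (m k)} (avgs m ε ψ)) v := by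
  induction n generalizing ψ with
  | zero =>
    have h2 : ∀ v : E d, lowCorner ∅ v = 0 := fun v => by ext i; simp [lowCorner_apply]
    have h3 : ∀ v : E d, highCorner ∅ ε v = v := fun v => by ext i; simp [highCorner_apply]
    simp [h2, h3, primitive, avgs]
  | succ n ih =>
    set i := m (Fin.last n) with hidef
    set S := Finset.univ.image (Fin.init m) with hS
    have hi : i ∉ S := by
      simp only [hS, Finset.mem_image, Finset.mem_univ, true_and, not_exists]
      intro k hk
      exact (Fin.castSucc_lt_last k).ne (hm hk)
    have himage : Finset.univ.image m = insert i S := by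
      ext j
      simp only [hS, Finset.mem_image, Finset.mem_univ, true_and, Finset.mem_insert]
      constructor
      · rintro ⟨k, rfl⟩
        rcases Fin.eq_castSucc_or_eq_last k with ⟨k, rfl⟩ | rfl
        · exact Or.inr ⟨k, rfl⟩
        · exact Or.inl rfl
      · rintro (rfl | ⟨k, rfl⟩)
        · exact ⟨_, rfl⟩
        · exact ⟨k.castSucc, rfl⟩
    set b : E d → ℝ := fun v => boxValue A (lowCorner S v) (highCorner S ε v) with hb
    have hbl : IsLocBounded b := isLocBounded_partial hd hα hA hG S ε
    have hshift : ∀ v, ψ (v - ε • basisVec i) = translate (ε • basisVec i) ψ v := fun v => rfl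
    have h1 : ∫ v, b (v + ε • basisVec i) * ψ v = ∫ v, b v * ψ (v - ε • basisVec i) := by
      rw [← integral_add_right_eq_self (fun v => b v * ψ (v - ε • basisVec i)) (ε • basisVec i)]
      simp
    have hint : Integrable fun v => b (v + ε • basisVec i) * ψ v := by
      have h2 := (hbl.integrable_mul (translate (ε • basisVec i) ψ)).comp_add_right
        (ε • basisVec i)
      simpa using h2
    rw [himage]
    simp_rw [boxValue_insert hd hA S hi ε, sub_mul]
    rw [integral_sub hint (hbl.integrable_mul ψ), h1, ← integral_sub
      (by simpa only [hshift] using hbl.integrable_mul (translate (ε • basisVec i) ψ))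
      (hbl.integrable_mul ψ)]
    have h2 : ∀ v, b v * ψ (v - ε • basisVec i) - b v * ψ v =
        (-ε) * (b v * (∂_{basisVec i} (avg i ε ψ)) v) := fun v => by
      linear_combination (b v) * lineDerivOp_avg_apply i ε ψ v
    simp_rw [h2]
    rw [integral_const_mul, ih (Fin.init m) (hm.comp (Fin.castSucc_injective n)),
      pow_succ', mul_assoc]
    congr 3
    rw [LineDeriv.iteratedLineDerivOp_succ_right, avgs, lineDerivOp_avgs]
    rfl

/-- The values of a cochain on the cubes of side `ε`, integrated against a test function, in terms
of the distribution of the cochain. -/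
lemma integral_cube_mul (hd : 1 ≤ d) {α : ℝ} (hα : 0 < α) {A : Vertices d d → ℝ}
    (hA : A ∈ Cochain d d) (hG : growthNorm α A ≠ ⊤) (ε : ℝ) (ψ : Test d) :
    ∫ v, boxValue A v (v + diag d ε) * ψ v = ε ^ d * toDistr A (avgs (fun i => i) ε ψ) := by
  have h := integral_partial hd hα hA hG ε (fun i : Fin d => i) (fun _ _ h => h) ψ
  have h1 : (Finset.univ.image fun i : Fin d => i) = Finset.univ := Finset.image_id
  have h2 : ∀ v : E d, lowCorner Finset.univ v = v := fun v => by ext i; simp [lowCorner_apply]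
  have h3 : ∀ v : E d, highCorner Finset.univ ε v = v + diag d ε := fun v => by
    ext i; simp [highCorner_apply]
  rw [h1] at h
  simp only [h2, h3] at h
  rw [h, toDistr_apply (isLocBounded_primitive hd hα hA hG), neg_pow]
  change _ = _ * (_ * ∫ v, primitive A v *
    (∂^{fun i : Fin d => basisVec i} (avgs (fun i : Fin d => i) ε ψ)) v)
  ring

lemma isLocBounded_cube (hd : 1 ≤ d) {α : ℝ} (hα : 0 < α) {A : Vertices d d → ℝ}
    (hA : A ∈ Cochain d d) (hG : growthNorm α A ≠ ⊤) (ε : ℝ) :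
    IsLocBounded fun v => boxValue A v (v + diag d ε) := by
  have h := isLocBounded_partial hd hα hA hG Finset.univ ε
  have h2 : ∀ v : E d, lowCorner Finset.univ v = v := fun v => by ext i; simp [lowCorner_apply]
  have h3 : ∀ v : E d, highCorner Finset.univ ε v = v + diag d ε := fun v => by
    ext i; simp [highCorner_apply]
  simpa only [h2, h3] using h

lemma tendsto_toDistr_avgs {A : Vertices d d → ℝ} (hA : IsLocBounded (primitive A)) (ψ : Test d)
    {ε : ℕ → ℝ} (hε0 : ∀ k, 0 ≤ ε k) (hε : Filter.Tendsto ε Filter.atTop (nhds 0)) :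
    Filter.Tendsto (fun k => toDistr A (avgs (fun i => i) (ε k) ψ)) Filter.atTop
      (nhds (toDistr A ψ)) := by
  simp only [toDistr_apply hA]
  refine Filter.Tendsto.const_mul _ ?_
  set g := mixedDeriv ψ with hg
  have h1 : ∀ k, mixedDeriv (avgs (fun i => i) (ε k) ψ) = avgs (fun i => i) (ε k) g := fun k =>
    iteratedLineDerivOp_avgs _ _ _ _
  simp only [h1]
  obtain ⟨L, hL0, hL⟩ := g.exists_lipschitz
  obtain ⟨M, hM0, hM⟩ := g.exists_bound
  obtain ⟨R, hR0, hR⟩ := g.exists_tsupport_subset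
  have hR' : ∀ x, R < ‖x‖ → g x = 0 := fun x hx => image_eq_zero_of_notMem_tsupport fun h => by
    have := hR h
    rw [mem_closedBall_zero_iff] at this
    linarith
  have hsmall : ∀ᶠ k in Filter.atTop, ε k ≤ 1 := hε.eventually_le_const one_pos
  refine tendsto_integral_filter_of_dominated_convergence
    ((Metric.closedBall 0 (R + d)).indicator fun v => |primitive A v| * (M + d * L))
    (Filter.Eventually.of_forall fun k => (hA.integrable_mul _).aestronglyMeasurable)
    (hsmall.mono fun k hk => Filter.Eventually.of_forall fun v => ?_)
    ?_ (Filter.Eventually.of_forall fun v => Filter.Tendsto.const_mul _ ?_)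
  · by_cases hv : v ∈ Metric.closedBall (0 : E d) (R + d)
    · rw [indicator_of_mem hv, norm_mul]
      refine mul_le_mul_of_nonneg_left ?_ (abs_nonneg _)
      have h2 := abs_avgs_sub_le (fun i : Fin d => i) hL (hε0 k) v
      have h3 : (d : ℝ) * (L * ε k) ≤ d * L := by
        have := mul_le_of_le_one_right hL0 hk
        gcongr
      have h4 := abs_add_le (avgs (fun i : Fin d => i) (ε k) g v - g v) (g v)
      rw [sub_add_cancel] at h4
      rw [Real.norm_eq_abs]
      linarith [hM v]
    · rw [indicator_of_notMem hv, avgs_eq_zero _ hR' (hε0 k), mul_zero, norm_zero]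
      rw [mem_closedBall_zero_iff, not_le] at hv
      refine lt_of_le_of_lt ?_ hv
      have : (d : ℝ) * ε k ≤ d * 1 := by gcongr
      linarith
  · rw [integrable_indicator_iff measurableSet_closedBall]
    exact ((hA.locallyIntegrable.integrableOn_isCompact (isCompact_closedBall _ _)).abs).mul_const _
  · rw [tendsto_iff_norm_sub_tendsto_zero]
    refine squeeze_zero (fun k => norm_nonneg _)
      (fun k => abs_avgs_sub_le (fun i : Fin d => i) hL (hε0 k) v) ?_
    simpa using (hε.const_mul L).const_mul (d : ℝ)

/-! ### Injectivity and the upper bound for the distribution of a cochain -/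

/-- A cochain is determined by its distribution, which determines the values on almost all cubes of
each size. -/
lemma eq_zero_of_toDistr_eq_zero (hd : 1 ≤ d) {α : ℝ} (hα : 0 < α) {A : Vertices d d → ℝ}
    (hA : A ∈ Cochain d d) (hG : growthNorm α A ≠ ⊤) (h0 : toDistr A = 0) : A = 0 := by
  funext v
  rw [eq_sign_mul_posVal hA v, posVal_eq_zero_of_cubes hd hα hA hG _ v]
  · simp
  intro ε _
  refine ae_eq_zero_of_integral_contDiff_smul_eq_zero
    (isLocBounded_cube hd hα hA hG ε).locallyIntegrable fun g hg hc => ?_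
  have h := integral_cube_mul hd hα hA hG ε (Test.mk g hg hc)
  rw [h0] at h
  simp only [smul_eq_mul, mul_comm (g _)]
  exact h.trans (mul_zero _)

/-- The support and the size of `l ^ (-d) ψ((· - x) / l)` and of its derivative. -/
lemma bounds_of_dilate {x : E d} {l M : ℝ} (hl : 0 < l) {φ ψ : Test d}
    (h1 : tsupport ψ ⊆ Metric.closedBall 0 1) (h2 : ∀ y, |ψ y| ≤ M) (h3 : ∀ y, ‖fderiv ℝ ψ y‖ ≤ M)
    (h4 : ∀ y, φ y = (l ^ d)⁻¹ * ψ (l⁻¹ • (y - x))) : tsupport φ ⊆ Metric.closedBall x l ∧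
      (∀ y, |φ y| ≤ (l ^ d)⁻¹ * M) ∧ ∀ y, ‖fderiv ℝ φ y‖ ≤ (l ^ d)⁻¹ * (M * l⁻¹) := by
  have hl' : 0 < (l ^ d)⁻¹ := by positivity
  refine ⟨closure_minimal (fun y hy => ?_) Metric.isClosed_closedBall, fun y => ?_, fun y => ?_⟩
  · have h5 : ψ (l⁻¹ • (y - x)) ≠ 0 := fun h => hy (by rw [h4, h, mul_zero])
    have h6 := h1 (subset_tsupport _ h5)
    rw [mem_closedBall_zero_iff, norm_smul, norm_inv, Real.norm_of_nonneg hl.le] at h6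
    rw [Metric.mem_closedBall, dist_eq_norm]
    rwa [inv_mul_le_iff₀ hl, mul_one] at h6
  · rw [h4, abs_mul, abs_of_pos hl']
    exact mul_le_mul_of_nonneg_left (h2 _) hl'.le
  · have h5 : HasFDerivAt (fun y : E d => l⁻¹ • (y - x))
        (l⁻¹ • ContinuousLinearMap.id ℝ (E d)) y := ((hasFDerivAt_id y).sub_const x).const_smul l⁻¹
    have h6 := ((ψ.differentiable (l⁻¹ • (y - x))).hasFDerivAt.comp y h5).const_mul ((l ^ d)⁻¹)
    have h7 : (φ : E d → ℝ) = fun y => (l ^ d)⁻¹ * ψ (l⁻¹ • (y - x)) := funext h4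
    rw [h7]
    refine (congrArg norm h6.fderiv).trans_le ?_
    rw [norm_smul, Real.norm_of_nonneg hl'.le]
    refine mul_le_mul_of_nonneg_left ?_ hl'.le
    refine (ContinuousLinearMap.opNorm_comp_le _ _).trans ?_
    have h8 : ‖l⁻¹ • ContinuousLinearMap.id ℝ (E d)‖ ≤ l⁻¹ := by
      rw [norm_smul, norm_inv, Real.norm_of_nonneg hl.le]
      exact mul_le_of_le_one_right (by positivity) ContinuousLinearMap.norm_id_le
    exact mul_le_mul (h3 _) h8 (norm_nonneg _) ((abs_nonneg _).trans (h2 0))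

lemma IsRescaledTest.bounds {x : E d} {l : ℝ} (hl : 0 < l) {φ : Test d}
    (h : IsRescaledTest x l φ) : tsupport φ ⊆ Metric.closedBall x l ∧ (∀ y, |φ y| ≤ (l ^ d)⁻¹) ∧
      ∀ y, ‖fderiv ℝ φ y‖ ≤ (l ^ d)⁻¹ * l⁻¹ := by
  obtain ⟨ψ, h1, h2, h3, h4⟩ := h
  simpa using bounds_of_dilate hl h1 h2 h3 h4

/-- The volume of the unit ball. -/
def ballVol (d : ℕ) : ℝ := volume.real (Metric.ball (0 : E d) 1)

lemma ballVol_nonneg : 0 ≤ ballVol d := measureReal_nonneg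

lemma volumeReal_closedBall (x : E d) {r : ℝ} (hr : 0 ≤ r) :
    volume.real (Metric.closedBall x r) = r ^ d * ballVol d := by
  rw [Measure.addHaar_real_closedBall volume x hr, finrank_euclideanSpace_fin, ballVol]

lemma abs_integral_le_of_closedBall {h : E d → ℝ} {x : E d} {r C : ℝ} (hr : 0 ≤ r)
    (h0 : ∀ y, y ∉ Metric.closedBall x r → h y = 0) (hC : ∀ y, |h y| ≤ C) :
    |∫ y, h y| ≤ C * (r ^ d * ballVol d) := by
  rw [← setIntegral_eq_integral_of_forall_compl_eq_zero h0, ← volumeReal_closedBall x hr,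
    ← Real.norm_eq_abs]
  exact norm_setIntegral_le_of_norm_le_const measure_closedBall_lt_top fun y _ => hC y

/-- The corner of the dyadic subcube with index `σ`, relative to the corner of the cube. -/
def subcorner (η : ℝ) (σ : Fin d → Fin 2) : E d := WithLp.toLp 2 fun i => ((σ i : ℕ) : ℝ) * η

lemma subcorner_apply (η : ℝ) (σ : Fin d → Fin 2) (i : Fin d) :
    subcorner η σ i = ((σ i : ℕ) : ℝ) * η := rfl

lemma norm_subcorner_le {η : ℝ} (hη : 0 ≤ η) (σ : Fin d → Fin 2) : ‖subcorner η σ‖ ≤ d * η := by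
  refine norm_le_of_coord_le hη fun i => ?_
  rw [subcorner_apply, abs_of_nonneg (by positivity)]
  have h : ((σ i : ℕ) : ℝ) ≤ 1 := by exact_mod_cast Nat.lt_succ_iff.1 (σ i).2
  exact mul_le_of_le_one_left hη h

/-- A cube is the union of its `2 ^ d` dyadic subcubes. -/
lemma boxFun_halve (y : E d) (η : ℝ) (x : E d) : boxFun y (y + diag d (2 * η)) x =
    ∑ σ : Fin d → Fin 2, boxFun (y + subcorner η σ) (y + subcorner η σ + diag d η) x := by
  have h : ∀ i, step (y i) (x i) - step ((y + diag d (2 * η)) i) (x i) =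
      ∑ b : Fin 2, (step (y i + ((b : ℕ) : ℝ) * η) (x i) -
        step (y i + ((b : ℕ) : ℝ) * η + η) (x i)) := fun i => by
    have h1 : (y + diag d (2 * η)) i = y i + 1 * η + η := by
      simp only [PiLp.add_apply, diag_apply]; ring
    rw [h1, Fin.sum_univ_two]
    simp
  rw [boxFun, Finset.prod_congr rfl fun i _ => h i, Finset.prod_univ_sum, Fintype.piFinset_univ]
  rfl

lemma boxValue_halve (hd : 1 ≤ d) {A : Vertices d d → ℝ} (hA : A ∈ Cochain d d) (y : E d) (η : ℝ) :
    boxValue A y (y + diag d (2 * η)) =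
      ∑ σ : Fin d → Fin 2, boxValue A (y + subcorner η σ) (y + subcorner η σ + diag d η) := by
  have h := sum_boxValue_eq_zero hd hA (Finset.univ : Finset (Option (Fin d → Fin 2)))
    (fun o => o.elim 1 fun _ => -1) (fun o => o.elim y fun σ => y + subcorner η σ)
    (fun o => o.elim (y + diag d (2 * η)) fun σ => y + subcorner η σ + diag d η)
    (Filter.Eventually.of_forall fun x => by
      simp [Fintype.sum_option, boxFun_halve y η x])
  simp only [Fintype.sum_option, Option.elim_none, Option.elim_some, one_mul, neg_mul,
    Finset.sum_neg_distrib] at h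
  linarith

/-- The integral of the values on cubes of side `ε` against a test function. -/
def cubeIntegral (A : Vertices d d → ℝ) (ε : ℝ) (φ : Test d) : ℝ :=
  ∫ v, boxValue A v (v + diag d ε) * φ v

/-- Halving the side of the cubes only moves the test function by the size of the cubes. -/
lemma cubeIntegral_halve (hd : 1 ≤ d) {α : ℝ} (hα : 0 < α) {A : Vertices d d → ℝ}
    (hA : A ∈ Cochain d d) (hG : growthNorm α A ≠ ⊤) (η : ℝ) (φ : Test d) :
    cubeIntegral A (2 * η) φ - 2 ^ d * cubeIntegral A η φ = ∑ σ : Fin d → Fin 2,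
      ∫ v, boxValue A v (v + diag d η) * (φ (v - subcorner η σ) - φ v) := by
  set b : E d → ℝ := fun v => boxValue A v (v + diag d η) with hb
  have hbl : IsLocBounded b := isLocBounded_cube hd hα hA hG η
  have h2 : ∀ a : E d, ∫ v, b (v + a) * φ v = ∫ v, b v * translate a φ v := fun a => by
    rw [← integral_add_right_eq_self (fun v => b v * translate a φ v) a]
    simp
  have h3 : ∀ a : E d, Integrable fun v => b (v + a) * φ v := fun a => by
    simpa using (hbl.integrable_mul (translate a φ)).comp_add_right a
  have h4 : cubeIntegral A (2 * η) φ =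
      ∑ σ : Fin d → Fin 2, ∫ v, b v * translate (subcorner η σ) φ v := by
    rw [cubeIntegral]
    simp_rw [boxValue_halve hd hA _ η, Finset.sum_mul]
    rw [integral_finsetSum _ fun σ _ => h3 (subcorner η σ)]
    exact Finset.sum_congr rfl fun σ _ => h2 _
  have h5 : (2 : ℝ) ^ d * cubeIntegral A η φ = ∑ σ : Fin d → Fin 2, ∫ v, b v * φ v := by
    simp [cubeIntegral, hb]
  rw [h4, h5, ← Finset.sum_sub_distrib]
  refine Finset.sum_congr rfl fun σ _ => ?_
  rw [← integral_sub (hbl.integrable_mul _) (hbl.integrable_mul _)]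
  simp [mul_sub, hb]

/-- The constant in the upper bound for the distribution of a cochain, at a fixed scale. -/
def scaleConst (d : ℕ) : ℝ := (2 * d) ^ d * d.factorial * faceConst d * ballVol d * 2 ^ d

lemma scaleConst_nonneg : 0 ≤ scaleConst d := by
  have h1 := faceConst_nonneg d
  have h2 := ballVol_nonneg (d := d)
  unfold scaleConst
  positivity

section Bounds

variable {α : ℝ} {A : Vertices d d → ℝ} {x : E d} {l : ℝ} {φ : Test d}

lemma abs_boxValue_side_le (hd : 1 ≤ d) (hα : 0 < α) (hA : A ∈ Cochain d d)
    (hG : growthNorm α A ≠ ⊤) {s : ℝ} (hs : 0 < s) (hs1 : s ≤ 1) (y : E d) :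
    |boxValue A y (y + diag d (s / (2 * d)))| ≤
      d.factorial * ((growthNorm α A).toReal * (s ^ (d - 1) * faceConst d * s ^ α)) := by
  have hd0 : (0 : ℝ) < d := by exact_mod_cast hd
  have h1 : 2 * (d * (s / (2 * d))) = s := by field_simp
  have h := abs_boxValue_cube_le hd hα hA hG y (ε := s / (2 * d)) (by positivity)
    (by rw [h1]; exact hs1)
  rwa [ballMass, h1] at h

/-- The estimate at the scale of the test function, where the growth norm is applied directly. -/
lemma abs_cubeIntegral_le (hd : 1 ≤ d) (hα : 0 < α) (hA : A ∈ Cochain d d)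
    (hG : growthNorm α A ≠ ⊤) (hl : 0 < l) (hl1 : l ≤ 1) (hφ : IsRescaledTest x l φ) :
    |((l / (2 * d)) ^ d)⁻¹ * cubeIntegral A (l / (2 * d)) φ| ≤
      scaleConst d * (growthNorm α A).toReal * l ^ (α - 1) := by
  have hd0 : (0 : ℝ) < d := by exact_mod_cast hd
  obtain ⟨h1, h2, -⟩ := hφ.bounds hl
  set G := (growthNorm α A).toReal with hGdef
  have hG0 : 0 ≤ G := ENNReal.toReal_nonneg
  have hf0 := faceConst_nonneg d
  have hV0 := ballVol_nonneg (d := d)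
  have h3 : |cubeIntegral A (l / (2 * d)) φ| ≤
      d.factorial * (G * (l ^ (d - 1) * faceConst d * l ^ α)) * (l ^ d)⁻¹ *
        (l ^ d * ballVol d) := by
    refine abs_integral_le_of_closedBall (x := x) hl.le (fun y hy => ?_) fun y => ?_
    · rw [image_eq_zero_of_notMem_tsupport fun h => hy (h1 h), mul_zero]
    · rw [abs_mul]
      exact mul_le_mul (abs_boxValue_side_le hd hα hA hG hl hl1 y) (h2 y) (abs_nonneg _)
        (by positivity)
  rw [abs_mul, abs_of_pos (by positivity)]
  refine (mul_le_mul_of_nonneg_left h3 (by positivity)).trans ?_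
  have h4 : l ^ d = l ^ (d - 1) * l := (pow_sub_one_mul (by omega) l).symm
  rw [Real.rpow_sub_one hl.ne', scaleConst]
  have h5 : (1 : ℝ) ≤ 2 ^ d := one_le_pow₀ one_le_two
  have h6 : ((l / (2 * d)) ^ d)⁻¹ * (d.factorial * (G * (l ^ (d - 1) * faceConst d * l ^ α)) *
      (l ^ d)⁻¹ * (l ^ d * ballVol d)) =
      ((2 * d) ^ d * d.factorial * faceConst d * ballVol d) * 1 * G * (l ^ α / l) := by
    rw [div_pow, h4]
    field_simp
  rw [h6]
  gcongr

/-- The estimate for passing to the next smaller scale, which gains the factor `s / l` from the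
derivative of the test function. -/
lemma abs_cubeIntegral_sub_le (hd : 1 ≤ d) (hα : 0 < α) (hA : A ∈ Cochain d d)
    (hG : growthNorm α A ≠ ⊤) (hl : 0 < l) (hl1 : l ≤ 1) (hφ : IsRescaledTest x l φ) {s : ℝ}
    (hs : 0 < s) (hsl : s ≤ l) :
    |((2 * (s / (2 * d))) ^ d)⁻¹ * cubeIntegral A (2 * (s / (2 * d))) φ -
      ((s / (2 * d)) ^ d)⁻¹ * cubeIntegral A (s / (2 * d)) φ| ≤
      scaleConst d * (growthNorm α A).toReal * (s ^ α / l) := by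
  have hd0 : (0 : ℝ) < d := by exact_mod_cast hd
  obtain ⟨h1, -, h2⟩ := hφ.bounds hl
  set G := (growthNorm α A).toReal with hGdef
  have hG0 : 0 ≤ G := ENNReal.toReal_nonneg
  have hf0 := faceConst_nonneg d
  have hV0 := ballVol_nonneg (d := d)
  set η := s / (2 * d) with hη
  have hη0 : 0 < η := by positivity
  have hdη : d * η = s / 2 := by rw [hη]; field_simp
  have h0 : ∀ y, y ∉ Metric.closedBall x l → φ y = 0 := fun y hy =>
    image_eq_zero_of_notMem_tsupport fun h => hy (h1 h)
  have h3 : ∀ σ : Fin d → Fin 2,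
      |∫ v, boxValue A v (v + diag d η) * (φ (v - subcorner η σ) - φ v)| ≤
        d.factorial * (G * (s ^ (d - 1) * faceConst d * s ^ α)) * ((l ^ d)⁻¹ * l⁻¹ * (s / 2)) *
          ((2 * l) ^ d * ballVol d) := fun σ => by
    have hn := norm_subcorner_le hη0.le σ
    rw [hdη] at hn
    refine abs_integral_le_of_closedBall (x := x) (by positivity) (fun y hy => ?_) fun y => ?_
    · rw [Metric.mem_closedBall, not_le, dist_eq_norm] at hy
      rw [h0 y, h0 (y - subcorner η σ), sub_zero, mul_zero]
      · rw [Metric.mem_closedBall, not_le, dist_eq_norm]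
        have h5 := norm_add_le (y - subcorner η σ - x) (subcorner η σ)
        rw [show y - subcorner η σ - x + subcorner η σ = y - x by abel] at h5
        linarith
      · rw [Metric.mem_closedBall, not_le, dist_eq_norm]
        linarith
    · rw [abs_mul]
      refine mul_le_mul (abs_boxValue_side_le hd hα hA hG hs (hsl.trans hl1) y) ?_
        (abs_nonneg _) (by positivity)
      have h5 := convex_univ.norm_image_sub_le_of_norm_fderiv_le (𝕜 := ℝ)
        (fun z _ => φ.differentiable z) (fun z _ => h2 z) (mem_univ y)
        (mem_univ (y - subcorner η σ))
      rw [sub_sub_cancel_left, norm_neg] at h5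
      exact h5.trans (mul_le_mul_of_nonneg_left hn (by positivity))
  have h4 := cubeIntegral_halve hd hα hA hG η φ
  have h5 : ((2 * η) ^ d)⁻¹ * cubeIntegral A (2 * η) φ - (η ^ d)⁻¹ * cubeIntegral A η φ =
      ((2 * η) ^ d)⁻¹ * (cubeIntegral A (2 * η) φ - 2 ^ d * cubeIntegral A η φ) := by
    rw [mul_pow]; field_simp
  rw [h5, h4, abs_mul, abs_of_pos (by positivity)]
  have h6 := (Finset.abs_sum_le_sum_abs _ Finset.univ).trans
    (Finset.sum_le_sum fun σ (_ : σ ∈ Finset.univ) => h3 σ)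
  rw [Finset.sum_const, Finset.card_univ, Fintype.card_fun, Fintype.card_fin, Fintype.card_fin,
    nsmul_eq_mul] at h6
  refine (mul_le_mul_of_nonneg_left h6 (by positivity)).trans ?_
  have h7 : s ^ d = s ^ (d - 1) * s := (pow_sub_one_mul (by omega) s).symm
  have h8 : ((2 * η) ^ d)⁻¹ * (((2 ^ d : ℕ) : ℝ) * (d.factorial *
      (G * (s ^ (d - 1) * faceConst d * s ^ α)) * ((l ^ d)⁻¹ * l⁻¹ * (s / 2)) *
          ((2 * l) ^ d * ballVol d))) = scaleConst d * G * (s ^ α / l) * (1 / 2) := by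
    rw [scaleConst, hη, mul_pow, mul_pow, div_pow, h7]
    push_cast
    field_simp
  rw [h8]
  have h9 : 0 ≤ scaleConst d * G * (s ^ α / l) := by
    have := scaleConst_nonneg (d := d)
    positivity
  linarith

/-- The normalised cube integrals converge to the value of the distribution, along a dyadic
sequence of scales whose successive differences are summable because `α > 0`. -/
lemma abs_toDistr_le (hd : 1 ≤ d) (hα : 0 < α) (hA : A ∈ Cochain d d)
    (hG : growthNorm α A ≠ ⊤) (hl : 0 < l) (hl1 : l ≤ 1) (hφ : IsRescaledTest x l φ) :
    |toDistr A φ| ≤ scaleConst d * (growthNorm α A).toReal * l ^ (α - 1) *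
      (1 + 1 / (1 - 2⁻¹ ^ α)) := by
  have hd0 : (0 : ℝ) < d := by exact_mod_cast hd
  set q : ℝ := 2⁻¹ ^ α with hq
  have hq0 : 0 < q := by positivity
  have hq1 : q < 1 := Real.rpow_lt_one (by norm_num) (by norm_num) hα
  set B := scaleConst d * (growthNorm α A).toReal * l ^ (α - 1) with hB
  have hB0 : 0 ≤ B := by
    have := scaleConst_nonneg (d := d)
    positivity
  let ε : ℕ → ℝ := fun k => l / 2 ^ k / (2 * d)
  let t : ℕ → ℝ := fun k => ((ε k) ^ d)⁻¹ * cubeIntegral A (ε k) φ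
  have ht : Filter.Tendsto t Filter.atTop (nhds (toDistr A φ)) := by
    have hε : Filter.Tendsto ε Filter.atTop (nhds 0) := by
      have h1 : Filter.Tendsto (fun k : ℕ => l / (2 * d) * (2⁻¹ : ℝ) ^ k) Filter.atTop
          (nhds (l / (2 * d) * 0)) :=
        (tendsto_pow_atTop_nhds_zero_of_lt_one (by norm_num) (by norm_num)).const_mul _
      rw [mul_zero] at h1
      refine h1.congr fun k => ?_
      simp only [ε, inv_pow]
      ring
    refine (tendsto_toDistr_avgs (isLocBounded_primitive hd hα hA hG) φ
      (fun k => by positivity) hε).congr fun k => ?_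
    have hεk : 0 < ε k := by positivity
    simp only [t, cubeIntegral]
    rw [integral_cube_mul hd hα hA hG, inv_mul_cancel_left₀ (by positivity)]
  have hdist : ∀ k, dist (t k) (t (k + 1)) ≤ B * q ^ k := fun k => by
    have hs : 0 < l / 2 ^ (k + 1) := by positivity
    have h1 := abs_cubeIntegral_sub_le hd hα hA hG hl hl1 hφ hs
      (div_le_self hl.le (one_le_pow₀ one_le_two))
    have h2 : 2 * (l / 2 ^ (k + 1) / (2 * d)) = ε k := by
      simp only [ε]; rw [pow_succ]; field_simp
    rw [h2] at h1
    rw [Real.dist_eq]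
    refine h1.trans ?_
    have h3 : (l / 2 ^ (k + 1)) ^ α = l ^ α * q ^ (k + 1) := by
      rw [div_eq_mul_inv, ← inv_pow, Real.mul_rpow hl.le (by positivity), hq,
        ← Real.rpow_natCast, ← Real.rpow_natCast, ← Real.rpow_mul (by norm_num),
        ← Real.rpow_mul (by norm_num), mul_comm α]
    have h4 : q ^ (k + 1) ≤ q ^ k := pow_le_pow_of_le_one hq0.le hq1.le (Nat.le_succ k)
    rw [h3, hB, Real.rpow_sub_one hl.ne']
    have h5 := scaleConst_nonneg (d := d)
    calc scaleConst d * (growthNorm α A).toReal * (l ^ α * q ^ (k + 1) / l) ≤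
        scaleConst d * (growthNorm α A).toReal * (l ^ α * q ^ k / l) := by gcongr
      _ = _ := by ring
  have h1 := dist_le_of_le_geometric_of_tendsto₀ q B hq1 hdist ht
  have h2 : |t 0| ≤ B := by
    have h3 := abs_cubeIntegral_le hd hα hA hG hl hl1 hφ
    have h4 : ε 0 = l / (2 * d) := by simp [ε]
    simpa only [t, h4] using h3
  rw [Real.dist_eq, abs_sub_comm] at h1
  have h3 := abs_add_le (toDistr A φ - t 0) (t 0)
  rw [sub_add_cancel] at h3
  rw [mul_add, mul_one, mul_one_div]
  linarith

end Bounds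

lemma distrNorm_toDistr_le (hd : 1 ≤ d) {α : ℝ} (hα : 0 < α) :
    ∃ C : ℝ≥0, ∀ A ∈ Cochain d d, growthNorm α A ≠ ⊤ →
      distrNorm (α - 1) (toDistr A) ≤ C * growthNorm α A := by
  have hq1 : (2⁻¹ : ℝ) ^ α < 1 := Real.rpow_lt_one (by norm_num) (by norm_num) hα
  have hC : 0 ≤ scaleConst d * (1 + 1 / (1 - (2⁻¹ : ℝ) ^ α)) := by
    have h1 := scaleConst_nonneg (d := d)
    have h2 : 0 ≤ 1 / (1 - (2⁻¹ : ℝ) ^ α) := by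
      rw [one_div_nonneg]; linarith
    positivity
  refine ⟨Real.toNNReal (scaleConst d * (1 + 1 / (1 - (2⁻¹ : ℝ) ^ α))),
    fun A hA hG => distrNorm_le fun x l φ h => ?_⟩
  have h1 := abs_toDistr_le hd hα hA hG h.1 h.2.1 h.2.2
  have hl : 0 < l ^ (α - 1) := Real.rpow_pos_of_pos h.1 _
  refine ENNReal.div_le_of_le_mul ?_
  rw [← ofReal_norm, Real.norm_eq_abs, ← ENNReal.ofReal_toReal hG,
    ENNReal.ofNNReal_toNNReal, ← ENNReal.ofReal_mul hC, ← ENNReal.ofReal_mul (by positivity)]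
  refine ENNReal.ofReal_le_ofReal (h1.trans_eq ?_)
  ring

/-! ### Mollifiers -/

/-- A smooth bump function at the origin. -/
def unitBump (d : ℕ) : ContDiffBump (0 : E d) := ⟨1 / 2, 1, by norm_num, by norm_num⟩

/-- A nonnegative test function supported in the unit ball, with integral `1`. -/
def bump (d : ℕ) : Test d :=
  Test.mk ((unitBump d).normed volume) (unitBump d).contDiff_normed
    (unitBump d).hasCompactSupport_normed

lemma bump_nonneg (x : E d) : 0 ≤ bump d x := (unitBump d).nonneg_normed x

lemma integral_bump : ∫ x, bump d x = 1 := (unitBump d).integral_normed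

lemma tsupport_bump : tsupport (bump d) ⊆ Metric.closedBall 0 1 :=
  ((unitBump d).tsupport_normed_eq (μ := volume)).subset

lemma exists_bumpConst (d : ℕ) : ∃ C : ℝ, 0 < C ∧ (∀ x, |bump d x| ≤ C) ∧
    ∀ x, ‖fderiv ℝ (bump d) x‖ ≤ C := by
  obtain ⟨M, h0, hM⟩ := (bump d).exists_bound
  obtain ⟨M', h0', hM'⟩ := (bump d).exists_bound_fderiv
  exact ⟨M + M' + 1, by linarith, fun x => (hM x).trans (by linarith),
    fun x => (hM' x).trans (by linarith)⟩

/-- A bound for the bump function and its derivative. -/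
def bumpConst (d : ℕ) : ℝ := (exists_bumpConst d).choose

lemma bumpConst_pos : 0 < bumpConst d := (exists_bumpConst d).choose_spec.1

/-- The dyadic scales. -/
def rad (n : ℕ) : ℝ := 2⁻¹ ^ n

lemma rad_pos (n : ℕ) : 0 < rad n := by unfold rad; positivity

lemma rad_le_one (n : ℕ) : rad n ≤ 1 := pow_le_one₀ (by norm_num) (by norm_num)

lemma rad_succ (n : ℕ) : rad n = 2 * rad (n + 1) := by
  unfold rad; rw [pow_succ]; ring

lemma rad_rpow (n : ℕ) (a : ℝ) : rad n ^ a = (2⁻¹ ^ a) ^ n := by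
  rw [rad, ← Real.rpow_natCast, ← Real.rpow_mul (by norm_num), mul_comm,
    Real.rpow_mul (by norm_num), Real.rpow_natCast]

/-- The test function `x ↦ c * φ(a + l x)`. -/
def dilate (c : ℝ) (a : E d) {l : ℝ} (hl : l ≠ 0) (φ : Test d) : Test d :=
  Test.mk (fun x => c * φ (a + l • x))
    (contDiff_const.mul (φ.contDiff.comp (contDiff_const.add (contDiff_id.const_smul l))))
    (HasCompactSupport.mul_left
      (φ.hasCompactSupport.comp_homeomorph ((Homeomorph.smulOfNeZero l hl).trans
        (Homeomorph.addLeft a))))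

@[simp] lemma dilate_apply (c : ℝ) (a : E d) {l : ℝ} (hl : l ≠ 0) (φ : Test d) (x : E d) :
    dilate c a hl φ x = c * φ (a + l • x) := rfl

/-- The mollifier at scale `2⁻ⁿ`. -/
def mollifier (d n : ℕ) : Test d :=
  dilate ((rad n ^ d)⁻¹) 0 (inv_ne_zero (rad_pos n).ne') (bump d)

lemma mollifier_apply (n : ℕ) (x : E d) :
    mollifier d n x = (rad n ^ d)⁻¹ * bump d ((rad n)⁻¹ • (x - 0)) := by
  simp [mollifier]

lemma mollifier_nonneg (n : ℕ) (x : E d) : 0 ≤ mollifier d n x := by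
  rw [mollifier_apply]
  have := rad_pos n
  exact mul_nonneg (by positivity) (bump_nonneg _)

lemma integral_mollifier (n : ℕ) : ∫ x, mollifier d n x = 1 := by
  simp only [mollifier_apply, sub_zero]
  rw [integral_const_mul, Measure.integral_comp_inv_smul_of_nonneg volume _ (rad_pos n).le,
    integral_bump, finrank_euclideanSpace_fin, smul_eq_mul, mul_one,
    inv_mul_cancel₀ (pow_ne_zero _ (rad_pos n).ne')]

lemma mollifier_bounds (n : ℕ) : tsupport (mollifier d n) ⊆ Metric.closedBall 0 (rad n) ∧
    (∀ y, |mollifier d n y| ≤ (rad n ^ d)⁻¹ * bumpConst d) ∧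
      ∀ y, ‖fderiv ℝ (mollifier d n) y‖ ≤ (rad n ^ d)⁻¹ * (bumpConst d * (rad n)⁻¹) :=
  bounds_of_dilate (rad_pos n) tsupport_bump (exists_bumpConst d).choose_spec.2.1
    (exists_bumpConst d).choose_spec.2.2 (mollifier_apply n)

lemma isSpread_indicator {S : Set (E d)} (hS : MeasurableSet S) (hb : Bornology.IsBounded S) :
    IsSpread (S.indicator 1 : E d → ℝ) id where
  integrable := (integrable_indicator_iff hS).2 (integrableOn_const hb.measure_lt_top.ne)
  measurable := measurable_id
  bounded := by
    obtain ⟨R, hR⟩ := hb.subset_closedBall 0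
    refine ⟨R, fun t ht => ?_⟩
    have h : t ∈ S := by
      by_contra h
      exact ht (indicator_of_notMem h _)
    simpa using hR h

lemma superpose_indicator_apply {S : Set (E d)} (hS : MeasurableSet S)
    (hb : Bornology.IsBounded S) (ψ : Test d) (x : E d) :
    superpose (isSpread_indicator hS hb) ψ x = ∫ t in S, ψ (x - t) := by
  rw [superpose_apply, ← integral_indicator hS]
  refine integral_congr_ae (Filter.Eventually.of_forall fun t => ?_)
  by_cases ht : t ∈ S <;> simp [ht]

lemma apply_superpose_indicator (F : Distr d) {S : Set (E d)} (hS : MeasurableSet S)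
    (hb : Bornology.IsBounded S) (ψ : Test d) :
    F (superpose (isSpread_indicator hS hb) ψ) = ∫ t in S, F (translate t ψ) := by
  rw [(apply_superpose F (isSpread_indicator hS hb) ψ).2, ← integral_indicator hS]
  refine integral_congr_ae (Filter.Eventually.of_forall fun t => ?_)
  by_cases ht : t ∈ S <;> simp [ht]

lemma integral_mollifier_sub (n : ℕ) (x : E d) : ∫ t, mollifier d n (x - t) = 1 := by
  rw [integral_sub_left_eq_self (fun t => mollifier d n t) volume x, integral_mollifier]

lemma mollifier_sub_eq_zero {n : ℕ} {x t : E d} (h : t ∉ Metric.closedBall x (rad n)) :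
    mollifier d n (x - t) = 0 := by
  refine image_eq_zero_of_notMem_tsupport fun h' => h ?_
  have h1 := (mollifier_bounds n).1 h'
  rwa [mem_closedBall_zero_iff, ← dist_eq_norm, dist_comm] at h1

lemma superpose_mollifier_eq_one {S : Set (E d)} (hS : MeasurableSet S)
    (hb : Bornology.IsBounded S) {n : ℕ} {x : E d} (h : Metric.closedBall x (rad n) ⊆ S) :
    superpose (isSpread_indicator hS hb) (mollifier d n) x = 1 := by
  rw [superpose_indicator_apply hS hb, ← integral_mollifier_sub n x]
  exact setIntegral_eq_integral_of_forall_compl_eq_zero fun t ht =>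
    mollifier_sub_eq_zero fun h' => ht (h h')

lemma superpose_mollifier_eq_zero {S : Set (E d)} (hS : MeasurableSet S)
    (hb : Bornology.IsBounded S) {n : ℕ} {x : E d} (h : ∀ y ∈ S, rad n < dist x y) :
    superpose (isSpread_indicator hS hb) (mollifier d n) x = 0 := by
  rw [superpose_indicator_apply hS hb]
  refine setIntegral_eq_zero_of_forall_eq_zero fun t ht => mollifier_sub_eq_zero ?_
  rw [Metric.mem_closedBall, not_le, dist_comm]
  exact h t ht

lemma superpose_mollifier_mem_Icc {S : Set (E d)} (hS : MeasurableSet S)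
    (hb : Bornology.IsBounded S) (n : ℕ) (x : E d) :
    superpose (isSpread_indicator hS hb) (mollifier d n) x ∈ Icc (0 : ℝ) 1 := by
  rw [superpose_indicator_apply hS hb]
  refine ⟨setIntegral_nonneg hS fun t _ => mollifier_nonneg n _, ?_⟩
  rw [← integral_mollifier_sub n x]
  exact setIntegral_le_integral ((mollifier d n).integrable.comp_sub_left x)
    (Filter.Eventually.of_forall fun t => mollifier_nonneg n _)

lemma norm_fderiv_superpose_mollifier_le {S : Set (E d)} (hS : MeasurableSet S)
    (hb : Bornology.IsBounded S) (n : ℕ) (x : E d) :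
    ‖fderiv ℝ (superpose (isSpread_indicator hS hb) (mollifier d n)) x‖ ≤
      bumpConst d * ballVol d / rad n := by
  have hr := rad_pos n
  have hc := bumpConst_pos (d := d)
  rw [fderiv_superpose]
  have h1 : ∀ t, t ∉ Metric.closedBall x (rad n) → (S.indicator 1 t : ℝ) •
      fderiv ℝ (mollifier d n) (x - id t) = 0 := fun t ht => by
    rw [image_eq_zero_of_notMem_tsupport (f := fderiv ℝ (mollifier d n)), smul_zero]
    intro h'
    have h2 := (mollifier_bounds n).1 (tsupport_fderiv_subset ℝ h')
    rw [mem_closedBall_zero_iff, ← dist_eq_norm, dist_comm] at h2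
    exact ht h2
  rw [← setIntegral_eq_integral_of_forall_compl_eq_zero h1]
  refine (norm_setIntegral_le_of_norm_le_const (C := (rad n ^ d)⁻¹ * (bumpConst d * (rad n)⁻¹))
    measure_closedBall_lt_top fun t _ => ?_).trans ?_
  · rw [norm_smul]
    refine (mul_le_of_le_one_left (norm_nonneg _) ?_).trans ((mollifier_bounds n).2.2 _)
    by_cases ht : t ∈ S <;> simp [ht]
  · rw [volumeReal_closedBall x hr.le]
    refine le_of_eq ?_
    field_simp

/-! ### Pairing a Hölder distribution with a test function spread over a large set -/

lemma abs_apply_le_of_isRescaledTest {a : ℝ} {F : Distr d} (hF : distrNorm a F ≠ ⊤) {x : E d}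
    {l : ℝ} (hl : 0 < l) (hl1 : l ≤ 1) {φ : Test d} (h : IsRescaledTest x l φ) :
    |F φ| ≤ (distrNorm a F).toReal * l ^ a := by
  have h1 := le_distrNorm (a := a) (F := F) ⟨hl, hl1, h⟩
  have hp : 0 < l ^ a := Real.rpow_pos_of_pos hl a
  rw [ENNReal.div_le_iff (by simpa using hp) ENNReal.ofReal_ne_top, ← ENNReal.ofReal_toReal hF,
    ← ENNReal.ofReal_mul (by positivity), ← ofReal_norm,
    ENNReal.ofReal_le_ofReal_iff (by positivity)] at h1
  exact h1

/-- A test function with the support and the size of a rescaled one is a multiple of such a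
function. -/
lemma abs_apply_le_of_bounds {a : ℝ} {F : Distr d} (hF : distrNorm a F ≠ ⊤) {x : E d}
    {l M : ℝ} (hl : 0 < l) (hl1 : l ≤ 1) (hM : 0 < M) {φ : Test d}
    (h1 : tsupport φ ⊆ Metric.closedBall x l) (h2 : ∀ y, |φ y| ≤ M * (l ^ d)⁻¹)
    (h3 : ∀ y, ‖fderiv ℝ φ y‖ ≤ M * ((l ^ d)⁻¹ * l⁻¹)) :
    |F φ| ≤ M * ((distrNorm a F).toReal * l ^ a) := by
  have h : IsRescaledTest x l (M⁻¹ • φ) := by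
    refine ⟨dilate (M⁻¹ * l ^ d) x hl.ne' φ, ?_, fun y => ?_, fun y => ?_, fun y => ?_⟩
    · refine closure_minimal (fun y hy => ?_) Metric.isClosed_closedBall
      have h4 : φ (x + l • y) ≠ 0 := fun h => hy (by rw [dilate_apply, h, mul_zero])
      have h5 := h1 (subset_tsupport _ h4)
      rw [Metric.mem_closedBall, dist_eq_norm, add_sub_cancel_left, norm_smul,
        Real.norm_of_nonneg hl.le] at h5
      rw [mem_closedBall_zero_iff]
      exact le_of_mul_le_mul_left (by linarith) hl
    · rw [dilate_apply, abs_mul, abs_of_pos (by positivity)]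
      refine (mul_le_mul_of_nonneg_left (h2 _) (by positivity)).trans (le_of_eq ?_)
      field_simp
    · have h5 : HasFDerivAt (fun y : E d => x + l • y) (l • ContinuousLinearMap.id ℝ (E d)) y :=
        ((hasFDerivAt_id y).const_smul l).const_add x
      have h6 := ((φ.differentiable (x + l • y)).hasFDerivAt.comp y h5).const_mul (M⁻¹ * l ^ d)
      refine (congrArg norm h6.fderiv).trans_le ?_
      rw [norm_smul, Real.norm_of_nonneg (by positivity)]
      have h7 : ‖l • ContinuousLinearMap.id ℝ (E d)‖ ≤ l := by
        rw [norm_smul, Real.norm_of_nonneg hl.le]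
        exact mul_le_of_le_one_right hl.le ContinuousLinearMap.norm_id_le
      calc _ ≤ M⁻¹ * l ^ d * ((M * ((l ^ d)⁻¹ * l⁻¹)) * l) := by
            refine mul_le_mul_of_nonneg_left ?_ (by positivity)
            exact (ContinuousLinearMap.opNorm_comp_le _ _).trans
              (mul_le_mul (h3 _) h7 (norm_nonneg _) (by positivity))
        _ = 1 := by field_simp
    · have h4 : x + l • l⁻¹ • (y - x) = y := by rw [smul_inv_smul₀ hl.ne']; abel
      rw [dilate_apply, h4]
      change M⁻¹ * φ y = _
      field_simp
  have h4 := abs_apply_le_of_isRescaledTest hF hl hl1 h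
  have h5 : F φ = M * F (M⁻¹ • φ) := by
    rw [map_smul, smul_eq_mul, mul_inv_cancel_left₀ hM.ne']
  rw [h5, abs_mul, abs_of_pos hM]
  exact mul_le_mul_of_nonneg_left h4 hM.le

/-- A test function of size `M` varying at scale `2⁻ⁿ` is cut into pieces of that size by a
partition of unity made of translated mollifiers, so the pairing with a Hölder distribution is
controlled by the volume of a neighbourhood of the support. -/
lemma abs_apply_le_volume {a : ℝ} {F : Distr d} (hF : distrNorm a F ≠ ⊤) {n : ℕ} {M : ℝ}
    (hM : 0 < M) {φ : Test d} (h1 : ∀ y, |φ y| ≤ M) (h2 : ∀ y, ‖fderiv ℝ φ y‖ ≤ M * (rad n)⁻¹)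
    {S : Set (E d)} (hS : MeasurableSet S) (hb : Bornology.IsBounded S)
    (h3 : ∀ x ∈ tsupport φ, Metric.closedBall x (rad n) ⊆ S) :
    |F φ| ≤ 2 * bumpConst d * M * ((distrNorm a F).toReal * rad n ^ a) * volume.real S := by
  have hr := rad_pos n
  have hc := bumpConst_pos (d := d)
  have h4 : F φ = ∫ t in S, distrMul φ F (translate t (mollifier d n)) := by
    rw [← apply_superpose_indicator (distrMul φ F) hS hb, distrMul_apply]
    congr 1
    ext x
    rw [testMul_apply]
    by_cases hx : x ∈ tsupport φ
    · rw [superpose_mollifier_eq_one hS hb (h3 x hx), mul_one]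
    · rw [image_eq_zero_of_notMem_tsupport hx, zero_mul]
  rw [h4, ← Real.norm_eq_abs]
  refine norm_setIntegral_le_of_norm_le_const hb.measure_lt_top fun t _ => ?_
  rw [distrMul_apply, Real.norm_eq_abs]
  refine abs_apply_le_of_bounds hF (x := t) hr (rad_le_one n) (by positivity) ?_ (fun y => ?_)
    fun y => ?_
  · refine (tsupport_mul_subset_right (f := φ) (g := translate t (mollifier d n))).trans
      (tsupport_translate_subset (mollifier_bounds n).1 t)
  · rw [testMul_apply, abs_mul]
    have h5 := mul_le_mul (h1 y) ((mollifier_bounds n).2.1 (y - t)) (abs_nonneg _) hM.le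
    rw [translate_apply]
    refine h5.trans ?_
    have h6 : 0 ≤ M * ((rad n ^ d)⁻¹ * bumpConst d) := by positivity
    linarith
  · have h5 := (φ.differentiable y).hasFDerivAt.mul
      ((translate t (mollifier d n)).differentiable y).hasFDerivAt
    refine (congrArg norm h5.fderiv).trans_le ?_
    have h6 : fderiv ℝ (translate t (mollifier d n)) y = fderiv ℝ (mollifier d n) (y - t) :=
      fderiv_comp_sub (f := mollifier d n) (x := y) t
    rw [h6]
    refine (norm_add_le _ _).trans ?_
    rw [norm_smul, norm_smul, translate_apply, Real.norm_eq_abs, Real.norm_eq_abs]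
    have h7 := mul_le_mul (h1 y) ((mollifier_bounds n).2.2 (y - t)) (norm_nonneg _) hM.le
    have h8 := mul_le_mul ((mollifier_bounds n).2.1 (y - t)) (h2 y) (norm_nonneg _) (by positivity)
    calc _ ≤ _ := add_le_add h7 h8
      _ = _ := by ring

/-! ### Integrating a Hölder distribution over a convex body -/

lemma isClosed_near {K : Set (E d)} (hK : IsCompact K) {δ : ℝ} (hδ : 0 ≤ δ) :
    IsClosed {x | ∃ y ∈ K, dist x y ≤ δ} := by
  have h : {x | ∃ y ∈ K, dist x y ≤ δ} = Metric.cthickening δ K := by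
    rw [hK.cthickening_eq_biUnion_closedBall hδ]
    ext x
    simp
  rw [h]
  exact Metric.isClosed_cthickening

lemma isClosed_inner {K : Set (E d)} (hK : IsClosed K) (δ : ℝ) :
    IsClosed {x | Metric.closedBall x δ ⊆ K} := by
  have h : {x | Metric.closedBall x δ ⊆ K} =
      ⋂ v ∈ Metric.closedBall (0 : E d) δ, (fun x => x + v) ⁻¹' K := by
    ext x
    simp only [Set.mem_ofPred_eq, mem_iInter, mem_preimage, mem_closedBall_zero_iff]
    refine ⟨fun h v hv => h (by simpa using hv), fun h z hz => ?_⟩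
    have := h (z - x) (by rwa [← dist_eq_norm])
    rwa [add_sub_cancel] at this
  rw [h]
  exact isClosed_biInter fun v _ => hK.preimage (by fun_prop)

/-- The points within distance `δ` of both `K` and its complement. -/
def layer (K : Set (E d)) (δ : ℝ) : Set (E d) :=
  {x | (∃ y ∈ K, dist x y ≤ δ) ∧ ¬ Metric.closedBall x δ ⊆ K}

lemma measurableSet_layer {K : Set (E d)} (hK : IsCompact K) {δ : ℝ} (hδ : 0 ≤ δ) :
    MeasurableSet (layer K δ) :=
  (isClosed_near hK hδ).measurableSet.inter (isClosed_inner hK.isClosed δ).measurableSet.compl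

lemma isBounded_near {K : Set (E d)} (hK : IsCompact K) (δ : ℝ) :
    Bornology.IsBounded {x | ∃ y ∈ K, dist x y ≤ δ} := by
  obtain ⟨R, hR⟩ := hK.isBounded.subset_closedBall 0
  refine Metric.isBounded_closedBall (x := (0 : E d)) (r := R + δ) |>.subset ?_
  rintro x ⟨y, hy, hxy⟩
  have h1 := hR hy
  rw [Metric.mem_closedBall] at h1 ⊢
  linarith [dist_triangle x y 0]

/-- The integral over `K` of the distribution `F` regularised at scale `2⁻ⁿ`. -/
def regInt (F : Distr d) (n : ℕ) (K : Set (E d)) : ℝ :=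
  ∫ z in K, F (translate z (mollifier d n))

/-- The indicator function of a compact set, regularised at scale `2⁻ⁿ`. -/
def smoothInd {K : Set (E d)} (hK : IsCompact K) (n : ℕ) : Test d :=
  superpose (isSpread_indicator hK.measurableSet hK.isBounded) (mollifier d n)

lemma regInt_eq (F : Distr d) {K : Set (E d)} (hK : IsCompact K) (n : ℕ) :
    regInt F n K = F (smoothInd hK n) :=
  (apply_superpose_indicator F hK.measurableSet hK.isBounded _).symm

lemma smoothInd_eq_zero {K : Set (E d)} (hK : IsCompact K) {n : ℕ} {x : E d}
    (h : ∀ y ∈ K, rad n < dist x y) : smoothInd hK n x = 0 :=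
  superpose_mollifier_eq_zero hK.measurableSet hK.isBounded h

lemma smoothInd_eq_one {K : Set (E d)} (hK : IsCompact K) {n : ℕ} {x : E d}
    (h : Metric.closedBall x (rad n) ⊆ K) : smoothInd hK n x = 1 :=
  superpose_mollifier_eq_one hK.measurableSet hK.isBounded h

/-- The size, at its own scale, of a regularised indicator function. -/
def smoothConst (d : ℕ) : ℝ := 1 + 2 * (bumpConst d * ballVol d)

lemma smoothConst_pos : 0 < smoothConst d := by
  have h1 := bumpConst_pos (d := d)
  have h2 := ballVol_nonneg (d := d)
  unfold smoothConst
  positivity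

section Regularisation

variable {a r N : ℝ} {F : Distr d} {K : Set (E d)} {c : E d} {n : ℕ}

lemma tsupport_smoothInd_subset (hK : IsCompact K) (n : ℕ) :
    tsupport (smoothInd hK n) ⊆ {x | ∃ y ∈ K, dist x y ≤ rad n} := by
  refine closure_minimal (fun x hx => ?_) (isClosed_near hK (rad_pos n).le)
  by_contra h
  refine hx (smoothInd_eq_zero hK fun y hy => ?_)
  by_contra h'
  exact h ⟨y, hy, not_lt.1 h'⟩

/-- The crude bound for the integral of the regularisation over a convex body, used only at a scale
comparable to the inradius. -/
lemma abs_regInt_le (hF : distrNorm a F ≠ ⊤) (hK : IsCompact K) (hKc : Convex ℝ K) (hr : 0 < r)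
    (hball : Metric.closedBall c r ⊆ K) (hn : 2 * rad n ≤ r) :
    |regInt F n K| ≤ 2 * bumpConst d * smoothConst d * ((distrNorm a F).toReal * rad n ^ a) *
      (2 ^ d * volume.real K) := by
  have h1 := bumpConst_pos (d := d)
  have h2 := ballVol_nonneg (d := d)
  have h3 := smoothConst_pos (d := d)
  have hρ := rad_pos n
  have h4 := abs_apply_le_volume hF (n := n) (M := smoothConst d) h3 (φ := smoothInd hK n)
    (fun y => ?_) (fun y => ?_) (isClosed_near hK (δ := 2 * rad n) (by positivity)).measurableSet
    (isBounded_near hK _) (fun x hx z hz => ?_)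
  · rw [regInt_eq F hK]
    refine h4.trans (mul_le_mul_of_nonneg_left ?_ (by positivity))
    have h5 := volume_near_le hKc hr hball (δ := 2 * rad n) (by positivity) hn
    have h6 := ENNReal.toReal_mono
      (ENNReal.mul_ne_top ENNReal.ofReal_ne_top hK.measure_lt_top.ne) h5
    rwa [ENNReal.toReal_mul, ENNReal.toReal_ofReal (by positivity)] at h6
  · obtain ⟨h5, h6⟩ := superpose_mollifier_mem_Icc hK.measurableSet hK.isBounded n y
    have h7 : (1 : ℝ) ≤ smoothConst d := by
      unfold smoothConst
      have : 0 ≤ bumpConst d * ballVol d := by positivity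
      linarith
    exact (abs_of_nonneg h5).trans_le (h6.trans h7)
  · refine (norm_fderiv_superpose_mollifier_le hK.measurableSet hK.isBounded n y).trans ?_
    rw [div_eq_mul_inv]
    refine mul_le_mul_of_nonneg_right ?_ (by positivity)
    unfold smoothConst
    have : 0 ≤ bumpConst d * ballVol d := by positivity
    linarith
  · obtain ⟨y, hy, hxy⟩ := tsupport_smoothInd_subset hK n hx
    refine ⟨y, hy, ?_⟩
    rw [Metric.mem_closedBall] at hz
    linarith [dist_triangle z x y]

/-- Regularised indicator functions at successive scales differ only near the boundary. -/
lemma closedBall_subset_layer (hK : IsCompact K) {x : E d}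
    (hx : x ∈ tsupport (smoothInd hK (n + 1) - smoothInd hK n)) :
    Metric.closedBall x (rad (n + 1)) ⊆ layer K (2 * rad n) := by
  have hρ := rad_pos (n + 1)
  have hs := rad_succ n
  intro z hz
  rw [Metric.mem_closedBall] at hz
  obtain ⟨x', hx', hxx'⟩ := Metric.mem_closure_iff.1 hx _ hρ
  have hne : smoothInd hK (n + 1) x' - smoothInd hK n x' ≠ 0 := hx'
  have h1 := dist_triangle z x x'
  constructor
  · by_contra h
    have h2 : ∀ y ∈ K, rad n < dist x' y := fun y hy => by
      by_contra h'
      refine h ⟨y, hy, ?_⟩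
      linarith [dist_triangle z x' y]
    refine hne ?_
    rw [smoothInd_eq_zero hK h2, smoothInd_eq_zero hK fun y hy => by linarith [h2 y hy], sub_zero]
  · intro h
    have h2 : Metric.closedBall x' (rad n) ⊆ K := by
      refine (Metric.closedBall_subset_closedBall' ?_).trans h
      rw [dist_comm]
      linarith
    refine hne ?_
    rw [smoothInd_eq_one hK h2, smoothInd_eq_one hK
      ((Metric.closedBall_subset_closedBall (by linarith)).trans h2), sub_self]

/-- Passing to the next scale changes the regularised indicator function only in a boundary layer of
relative volume `O(2⁻ⁿ / r)`, which compensates for the size `2⁻ⁿ ^ (α - 1)` of the distribution at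
that scale. -/
lemma abs_regInt_succ_sub_le {α : ℝ} (hF : distrNorm (α - 1) F ≠ ⊤) (hK : IsCompact K)
    (hKc : Convex ℝ K) (hr : 0 < r) (hball : Metric.closedBall c r ⊆ K) (hn : 2 * rad n ≤ r) :
    |regInt F (n + 1) K - regInt F n K| ≤ 8 * bumpConst d * smoothConst d * d * 2 ^ d *
      (distrNorm (α - 1) F).toReal * volume.real K * r⁻¹ * rad (n + 1) ^ α := by
  have h1 := bumpConst_pos (d := d)
  have h2 := ballVol_nonneg (d := d)
  have h3 := smoothConst_pos (d := d)
  have hρ := rad_pos n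
  have hρ' := rad_pos (n + 1)
  have hs := rad_succ n
  have h4 := abs_apply_le_volume hF (n := n + 1) (M := smoothConst d) h3
    (φ := smoothInd hK (n + 1) - smoothInd hK n)
    (fun y => ?_) (fun y => ?_) (measurableSet_layer hK (δ := 2 * rad n) (by positivity))
    ((isBounded_near hK _).subset fun x hx => hx.1) (fun x hx => closedBall_subset_layer hK hx)
  · rw [map_sub, ← regInt_eq F hK, ← regInt_eq F hK] at h4
    refine h4.trans ?_
    have h5 := volume_boundary_layer_le hKc hK hr hball (δ := 2 * rad n) (by positivity) hn
    have h6 := ENNReal.toReal_mono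
      (ENNReal.mul_ne_top ENNReal.ofReal_ne_top hK.measure_lt_top.ne) h5
    rw [ENNReal.toReal_mul, ENNReal.toReal_ofReal (by positivity)] at h6
    refine (mul_le_mul_of_nonneg_left h6 (by positivity)).trans (le_of_eq ?_)
    change _ * (_ * volume.real K) = _
    rw [Real.rpow_sub_one hρ'.ne', hs]
    field_simp
    ring
  · obtain ⟨h5, h6⟩ := superpose_mollifier_mem_Icc hK.measurableSet hK.isBounded n y
    obtain ⟨h5', h6'⟩ := superpose_mollifier_mem_Icc hK.measurableSet hK.isBounded (n + 1) y
    have h7 : (1 : ℝ) ≤ smoothConst d := by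
      unfold smoothConst
      have : 0 ≤ bumpConst d * ballVol d := by positivity
      linarith
    have h8 : |smoothInd hK (n + 1) y - smoothInd hK n y| ≤ 1 := by
      unfold smoothInd
      rw [abs_le]
      constructor <;> linarith
    exact h8.trans h7
  · have h5 := norm_fderiv_superpose_mollifier_le hK.measurableSet hK.isBounded n y
    have h6 := norm_fderiv_superpose_mollifier_le hK.measurableSet hK.isBounded (n + 1) y
    have h7 := ((smoothInd hK (n + 1)).differentiable y).hasFDerivAt.sub
      ((smoothInd hK n).differentiable y).hasFDerivAt
    refine (congrArg norm h7.fderiv).trans_le ((norm_sub_le _ _).trans ?_)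
    have h8 : bumpConst d * ballVol d / rad n ≤ bumpConst d * ballVol d / rad (n + 1) :=
      div_le_div_of_nonneg_left (by positivity) hρ' (by linarith)
    have h9 : smoothConst d * (rad (n + 1))⁻¹ = (rad (n + 1))⁻¹ +
        2 * (bumpConst d * ballVol d / rad (n + 1)) := by
      unfold smoothConst
      field_simp
    have h10 : 0 < (rad (n + 1))⁻¹ := by positivity
    unfold smoothInd
    linarith

end Regularisation

/-- The constant in the bound for the integral of a Hölder distribution over a convex body. -/
def fillConst (d : ℕ) (α : ℝ) : ℝ := 8 * bumpConst d * smoothConst d * 2 ^ d +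
  2 * (8 * bumpConst d * smoothConst d * d * 2 ^ d / (1 - 2⁻¹ ^ α))

lemma exists_rad_near {r : ℝ} (hr : 0 < r) (hr1 : r ≤ 1) :
    ∃ n, 2 * rad n ≤ r ∧ r / 4 ≤ rad n := by
  obtain ⟨n, h1, h2⟩ := exists_nat_pow_near_of_lt_one (x := r / 2) (y := 2⁻¹) (by positivity)
    (by linarith) (by norm_num) (by norm_num)
  refine ⟨n + 1, ?_, ?_⟩
  · change _ < r / 2 at h1
    unfold rad
    linarith
  · have h3 := rad_succ n
    change r / 2 ≤ rad n at h2
    linarith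

lemma fillConst_nonneg {α : ℝ} (hα : 0 < α) : 0 ≤ fillConst d α := by
  have hq1 : (2⁻¹ : ℝ) ^ α < 1 := Real.rpow_lt_one (by norm_num) (by norm_num) hα
  have h1 := bumpConst_pos (d := d)
  have h3 := smoothConst_pos (d := d)
  have h4 : 0 < 1 - (2⁻¹ : ℝ) ^ α := by linarith
  unfold fillConst
  positivity

/-- The integrals over a convex body of the regularisations of a Hölder distribution converge,
because passing to the next scale only changes the regularised indicator function near the
boundary. The scale `n₀` from which they are under control depends only on the inradius. -/
lemma exists_tendsto_regInt {α : ℝ} (hα : 0 < α) (hα1 : α ≤ 1) {F : Distr d}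
    (hF : distrNorm (α - 1) F ≠ ⊤) {r : ℝ} (hr : 0 < r) (hr1 : r ≤ 1) :
    ∃ n₀ : ℕ, ∀ (K : Set (E d)) (c : E d), IsCompact K → Convex ℝ K →
      Metric.closedBall c r ⊆ K → ∃ L : ℝ,
        Filter.Tendsto (fun n => regInt F n K) Filter.atTop (nhds L) ∧
        |L| ≤ fillConst d α * (distrNorm (α - 1) F).toReal * volume.real K * r ^ (α - 1) ∧
        ∀ n, n₀ ≤ n → |regInt F n K| ≤
          fillConst d α * (distrNorm (α - 1) F).toReal * volume.real K * r ^ (α - 1) := by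
  obtain ⟨n₀, hn1, hn2⟩ := exists_rad_near hr hr1
  refine ⟨n₀, fun K c hK hKc hball => ?_⟩
  have h1 := bumpConst_pos (d := d)
  have h3 := smoothConst_pos (d := d)
  have hρ := rad_pos n₀
  set q : ℝ := 2⁻¹ ^ α with hq
  have hq0 : 0 < q := by positivity
  have hq1 : q < 1 := Real.rpow_lt_one (by norm_num) (by norm_num) hα
  set B := 8 * bumpConst d * smoothConst d * d * 2 ^ d with hB
  set N := (distrNorm (α - 1) F).toReal with hN
  have hN0 : 0 ≤ N := ENNReal.toReal_nonneg
  set V := volume.real K with hV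
  have hV0 : 0 ≤ V := measureReal_nonneg
  have hrp : 0 < r ^ (α - 1) := Real.rpow_pos_of_pos hr _
  let f : ℕ → ℝ := fun k => regInt F (k + n₀) K
  have hdist : ∀ k, dist (f k) (f (k + 1)) ≤ B * N * V * r ^ (α - 1) * q ^ k := fun k => by
    have hle : rad (k + n₀) ≤ rad n₀ :=
      pow_le_pow_of_le_one (by norm_num) (by norm_num) (Nat.le_add_left _ _)
    have h := abs_regInt_succ_sub_le (n := k + n₀) hF hK hKc hr hball (by linarith)
    have h2 : f (k + 1) = regInt F (k + n₀ + 1) K := by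
      simp only [f]; congr 1; omega
    rw [dist_comm, Real.dist_eq, h2]
    refine h.trans ?_
    have h4 : rad (k + n₀ + 1) ^ α ≤ q ^ k * r ^ α := by
      rw [rad_rpow, ← hq, add_assoc, pow_add]
      refine mul_le_mul_of_nonneg_left ?_ (by positivity)
      rw [hq, ← rad_rpow]
      refine Real.rpow_le_rpow (rad_pos _).le ?_ hα.le
      linarith [rad_succ n₀]
    rw [Real.rpow_sub_one hr.ne']
    refine (mul_le_mul_of_nonneg_left h4 (by positivity)).trans (le_of_eq ?_)
    field_simp
    rfl
  have hbase : |f 0| ≤ 8 * bumpConst d * smoothConst d * 2 ^ d * N * V * r ^ (α - 1) := by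
    have h := abs_regInt_le hF hK hKc hr hball hn1
    simp only [f, zero_add]
    refine h.trans ?_
    have h4 : rad n₀ ^ (α - 1) ≤ 4 * r ^ (α - 1) := by
      have h5 : rad n₀ ^ (α - 1) ≤ (r / 4) ^ (α - 1) :=
        Real.rpow_le_rpow_of_nonpos (by positivity) hn2 (by linarith)
      refine h5.trans ?_
      rw [Real.div_rpow hr.le (by norm_num), div_eq_mul_inv, ← Real.rpow_neg (by norm_num),
        mul_comm]
      refine mul_le_mul_of_nonneg_right ?_ hrp.le
      calc (4 : ℝ) ^ (-(α - 1)) ≤ 4 ^ (1 : ℝ) :=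
            Real.rpow_le_rpow_of_exponent_le (by norm_num) (by linarith)
        _ = 4 := Real.rpow_one 4
    calc _ ≤ 2 * bumpConst d * smoothConst d * (N * (4 * r ^ (α - 1))) * (2 ^ d * V) := by gcongr
      _ = _ := by ring
  obtain ⟨L, hL⟩ := cauchySeq_tendsto_of_complete (cauchySeq_of_le_geometric q _ hq1 hdist)
  have h5 := dist_le_of_le_geometric_of_tendsto₀ q _ hq1 hdist hL
  have h6 : ∀ k, dist (f k) L ≤ B * N * V * r ^ (α - 1) / (1 - q) := fun k => by
    refine (dist_le_of_le_geometric_of_tendsto q _ hq1 hdist hL k).trans ?_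
    have : q ^ k ≤ 1 := pow_le_one₀ hq0.le hq1.le
    have h7 : 0 < 1 - q := by linarith
    have h8 : 0 ≤ B * N * V * r ^ (α - 1) := by positivity
    exact div_le_div_of_nonneg_right (mul_le_of_le_one_right h8 this) h7.le
  have hT : 0 ≤ B * N * V * r ^ (α - 1) / (1 - q) := dist_nonneg.trans h5
  have hC : fillConst d α * N * V * r ^ (α - 1) =
      8 * bumpConst d * smoothConst d * 2 ^ d * N * V * r ^ (α - 1) +
        2 * (B * N * V * r ^ (α - 1) / (1 - q)) := by
    rw [fillConst, ← hB, ← hq]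
    ring
  rw [hC]
  rw [Real.dist_eq] at h5
  have hLb : |L| ≤ 8 * bumpConst d * smoothConst d * 2 ^ d * N * V * r ^ (α - 1) +
        (B * N * V * r ^ (α - 1) / (1 - q)) := by
    have := abs_sub_abs_le_abs_sub L (f 0)
    rw [abs_sub_comm] at this
    linarith
  refine ⟨L, (Filter.tendsto_add_atTop_iff_nat n₀).1 hL, by linarith, fun n hn => ?_⟩
  have h7 := h6 (n - n₀)
  simp only [f, Nat.sub_add_cancel hn, Real.dist_eq] at h7
  have := abs_sub_abs_le_abs_sub (regInt F n K) L
  linarith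

/-! ### The cochain of a Hölder distribution -/

/-- The integral of a distribution over a convex body, as the limit of its regularisations. It is
meaningful for Hölder distributions and convex bodies with nonempty interior, where the limit exists
by `tendsto_fill`. -/
def fill (F : Distr d) (K : Set (E d)) : ℝ := Filter.limUnder Filter.atTop fun n => regInt F n K

/-- The cochain given by the integrals of a distribution over oriented simplices. The sign of the
determinant of the edge vectors is the orientation, and vanishes on degenerate simplices. -/
def ofDistr (F : Distr d) (v : Vertices d d) : ℝ :=
  (SignType.sign (edgeDet v) : ℝ) * fill F (hull v)

lemma fill_eq {F : Distr d} {K : Set (E d)} {L : ℝ}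
    (h : Filter.Tendsto (fun n => regInt F n K) Filter.atTop (nhds L)) : fill F K = L :=
  h.limUnder_eq

section Fill

variable {α : ℝ} {F : Distr d} {K : Set (E d)} {c : E d} {r : ℝ}

lemma tendsto_fill (hα : 0 < α) (hα1 : α ≤ 1) (hF : distrNorm (α - 1) F ≠ ⊤) (hK : IsCompact K)
    (hKc : Convex ℝ K) (hr : 0 < r) (hball : Metric.closedBall c r ⊆ K) :
    Filter.Tendsto (fun n => regInt F n K) Filter.atTop (nhds (fill F K)) := by
  obtain ⟨n₀, h⟩ := exists_tendsto_regInt hα hα1 hF (r := min r 1) (by positivity)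
    (min_le_right _ _)
  obtain ⟨L, hL, -⟩ := h K c hK hKc
    ((Metric.closedBall_subset_closedBall (min_le_left _ _)).trans hball)
  rwa [fill_eq hL]

lemma abs_fill_le (hα : 0 < α) (hα1 : α ≤ 1) (hF : distrNorm (α - 1) F ≠ ⊤) (hK : IsCompact K)
    (hKc : Convex ℝ K) (hr : 0 < r) (hr1 : r ≤ 1) (hball : Metric.closedBall c r ⊆ K) :
    |fill F K| ≤ fillConst d α * (distrNorm (α - 1) F).toReal * volume.real K * r ^ (α - 1) := by
  obtain ⟨n₀, h⟩ := exists_tendsto_regInt hα hα1 hF hr hr1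
  obtain ⟨L, hL, h1, -⟩ := h K c hK hKc hball
  rwa [fill_eq hL]

lemma tendsto_fill_hull (hd : 1 ≤ d) (hα : 0 < α) (hα1 : α ≤ 1) (hF : distrNorm (α - 1) F ≠ ⊤)
    {v : Vertices d d} (hv : AffineIndependent ℝ v) :
    Filter.Tendsto (fun n => regInt F n (hull v)) Filter.atTop (nhds (fill F (hull v))) := by
  obtain ⟨c, hc⟩ := exists_closedBall_subset_hull hd hv
  exact tendsto_fill hα hα1 hF (isCompact_hull v) (convex_hull v)
    (div_pos (height_toReal_pos hd hv) (by positivity)) hc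

/-- The incidence relation between simplices and points is closed, being the projection of a closed
set along the compact simplex of barycentric coordinates. -/
lemma isClosed_mem_hull : IsClosed {p : Vertices d d × E d | p.2 ∈ hull p.1} := by
  have h : {p : Vertices d d × E d | p.2 ∈ hull p.1} =
      Prod.snd '' {q : stdSimplex ℝ (Fin (d + 1)) × (Vertices d d × E d) |
        ∑ i, (q.1 : Fin (d + 1) → ℝ) i • q.2.1 i = q.2.2} := by
    ext ⟨v, z⟩
    have h1 : hull v =
        (fun w : Fin (d + 1) → ℝ => ∑ i, w i • v i) '' stdSimplex ℝ (Fin (d + 1)) := by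
      have h2 := LinearMap.image_convexHull (Fintype.linearCombination ℝ v)
        (range fun i : Fin (d + 1) => (Pi.single i 1 : Fin (d + 1) → ℝ))
      rw [convexHull_rangle_single_eq_stdSimplex, ← range_comp] at h2
      have h3 : (Fintype.linearCombination ℝ v) ∘
          (fun i : Fin (d + 1) => (Pi.single i 1 : Fin (d + 1) → ℝ)) = v := by
        funext i
        simp
      rw [h3] at h2
      exact h2.symm
    simp only [Set.mem_ofPred_eq, h1, mem_image, Prod.exists, Subtype.exists]
    constructor
    · rintro ⟨w, hw, rfl⟩
      exact ⟨w, hw, v, _, rfl, rfl⟩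
    · rintro ⟨w, hw, v', z', h, h'⟩
      cases h'
      exact ⟨w, hw, h⟩
  rw [h]
  refine isClosedMap_snd_of_compactSpace _ (isClosed_eq ?_ (by fun_prop))
  refine continuous_finsetSum _ fun i _ => ?_
  exact ((continuous_apply i).comp (continuous_subtype_val.comp continuous_fst)).smul
    ((continuous_apply i).comp (continuous_fst.comp continuous_snd))

lemma measurable_regInt_hull (F : Distr d) (n : ℕ) :
    Measurable fun v : Vertices d d => regInt F n (hull v) := by
  have hU := continuous_apply_translate F (mollifier d n)
  have h : StronglyMeasurable ({p : Vertices d d × E d | p.2 ∈ hull p.1}.indicator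
      fun p => F (translate p.2 (mollifier d n))) :=
    (hU.comp continuous_snd).stronglyMeasurable.indicator isClosed_mem_hull.measurableSet
  have h1 := (h.integral_prod_right' (ν := volume)).measurable
  have h2 : (fun v : Vertices d d => regInt F n (hull v)) = fun v => ∫ z,
      {p : Vertices d d × E d | p.2 ∈ hull p.1}.indicator
        (fun p => F (translate p.2 (mollifier d n))) (v, z) := by
    funext v
    rw [regInt, ← integral_indicator (measurableSet_hull v)]
    rfl
  rw [h2]
  exact h1

lemma tendsto_ofDistr (hd : 1 ≤ d) (hα : 0 < α) (hα1 : α ≤ 1) (hF : distrNorm (α - 1) F ≠ ⊤)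
    (v : Vertices d d) : Filter.Tendsto
      (fun n => (SignType.sign (edgeDet v) : ℝ) * regInt F n (hull v)) Filter.atTop
      (nhds (ofDistr F v)) := by
  by_cases hv : AffineIndependent ℝ v
  · exact (tendsto_fill_hull hd hα hα1 hF hv).const_mul _
  · rw [affineIndependent_iff_edgeDet, not_not] at hv
    simp [ofDistr, hv]

lemma regInt_iUnion (F : Distr d) (n : ℕ) {N : ℕ} {w : Fin N → Vertices d d}
    (h : ∀ m n, m ≠ n → volume (hull (w m) ∩ hull (w n)) = 0) :
    regInt F n (⋃ i, hull (w i)) = ∑ i, regInt F n (hull (w i)) := by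
  have hU := continuous_apply_translate F (mollifier d n)
  rw [regInt, integral_iUnion_ae (fun i => (measurableSet_hull (w i)).nullMeasurableSet)
    (fun m n hmn => h m n hmn), tsum_fintype]
  · rfl
  · exact hU.locallyIntegrable.integrableOn_isCompact
      (isCompact_iUnion fun i => isCompact_hull (w i))

lemma ofDistr_mem_cochain (hd : 1 ≤ d) (hα : 0 < α) (hα1 : α ≤ 1)
    (hF : distrNorm (α - 1) F ≠ ⊤) : ofDistr F ∈ Cochain d d := by
  refine ⟨?_, fun v hv => ?_, fun v s => ?_, fun v hv N w hw => ?_⟩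
  · refine measurable_of_tendsto_metrizable
      (f := fun n v => (SignType.sign (edgeDet v) : ℝ) * regInt F n (hull v)) (fun n => ?_)
      (tendsto_pi_nhds.2 fun v => tendsto_ofDistr hd hα hα1 hF v)
    refine Measurable.mul ?_ (measurable_regInt_hull F n)
    have h1 : Measurable fun x : ℝ => (SignType.sign x : ℝ) := by
      have h2 : (fun x : ℝ => (SignType.sign x : ℝ)) =
          fun x => if 0 < x then 1 else if x < 0 then -1 else 0 := by
        funext x
        rcases lt_trichotomy x 0 with h | h | h
        · simp [h, h.not_gt]
        · simp [h]
        · simp [h]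
      rw [h2]
      exact Measurable.ite measurableSet_Ioi measurable_const
        (Measurable.ite measurableSet_Iio measurable_const measurable_const)
    exact h1.comp measurable_edgeDet
  · rw [affineIndependent_iff_edgeDet, not_not] at hv
    simp [ofDistr, hv]
  · rw [ofDistr, ofDistr, edgeDet_comp_perm, hull_comp_perm, sign_intCast_mul, mul_assoc]
  · have h1 : ∀ i, SignType.sign (edgeDet (w i)) = SignType.sign (edgeDet v) := fun i => by
      obtain ⟨r, hr, h⟩ := sameOrientation_edgeDet (hw.sameOrientation i)
      rw [h, sign_mul, sign_pos hr, one_mul]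
    have h2 : ∀ n, regInt F n (hull v) = ∑ i, regInt F n (hull (w i)) := fun n => by
      rw [← hw.iUnion_eq]
      refine regInt_iUnion F n fun i j hij => ?_
      rw [← EuclideanSpace.euclideanHausdorffMeasure_eq_volume]
      exact hw.nonoverlapping i j hij
    have h3 : fill F (hull v) = ∑ i, fill F (hull (w i)) := by
      refine tendsto_nhds_unique (tendsto_fill_hull hd hα hα1 hF hv) ?_
      simp only [h2]
      exact tendsto_finsetSum _ fun i _ =>
        tendsto_fill_hull hd hα hα1 hF (hw.affineIndependent i)
    simp only [ofDistr, h1]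
    rw [h3, Finset.mul_sum]

lemma abs_ofDistr {v : Vertices d d} (hv : AffineIndependent ℝ v) :
    |ofDistr F v| = |fill F (hull v)| := by
  rw [affineIndependent_iff_edgeDet] at hv
  rcases lt_or_gt_of_ne hv with h | h <;> simp [ofDistr, h]

lemma posVal_ofDistr {v : Vertices d d} (hv : AffineIndependent ℝ v) :
    posVal (ofDistr F) v = fill F (hull v) := by
  rw [affineIndependent_iff_edgeDet] at hv
  rcases lt_or_gt_of_ne hv with h | h <;> simp [posVal, ofDistr, h]

end Fill

/-- The inradius of a simplex is at least its height over `d + 1`, so the bound for the integral over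
the simplex is of the order of its `α`-mass. -/
lemma growthNorm_ofDistr_le (hd : 1 ≤ d) {α : ℝ} (hα : 0 < α) (hα1 : α ≤ 1) :
    ∃ C : ℝ≥0, ∀ F : Distr d, distrNorm (α - 1) F ≠ ⊤ →
      growthNorm α (ofDistr F) ≤ C * distrNorm (α - 1) F := by
  have hC := fillConst_nonneg (d := d) hα
  refine ⟨Real.toNNReal (fillConst d α * (d + 1)), fun F hF => iSup₂_le fun v hv => ?_⟩
  obtain ⟨hv, hdiam⟩ := hv
  have hh := height_toReal_pos hd hv
  set H := (height v).toReal with hH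
  set N := (distrNorm (α - 1) F).toReal with hN
  have hH1 : H ≤ 1 := by
    have h := ENNReal.toReal_mono ENNReal.ofReal_ne_top (height_le_diam (v := v) hd)
    rw [ENNReal.toReal_ofReal Metric.diam_nonneg] at h
    exact h.trans hdiam
  obtain ⟨c, hc⟩ := exists_closedBall_subset_hull hd hv
  have h1 := abs_fill_le hα hα1 hF (isCompact_hull v) (convex_hull v)
    (div_pos hh (by positivity))
    ((div_le_self hh.le (by linarith [Nat.cast_nonneg (α := ℝ) d])).trans hH1) hc
  have h2 : (H / (d + 1)) ^ (α - 1) ≤ (d + 1) * H ^ (α - 1) := by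
    rw [Real.div_rpow hh.le (by positivity), div_eq_mul_inv, ← Real.rpow_neg (by positivity),
      mul_comm]
    refine mul_le_mul_of_nonneg_right ?_ (Real.rpow_pos_of_pos hh _).le
    calc ((d : ℝ) + 1) ^ (-(α - 1)) ≤ (d + 1) ^ (1 : ℝ) :=
          Real.rpow_le_rpow_of_exponent_le (by linarith [Nat.cast_nonneg (α := ℝ) d])
            (by linarith)
      _ = d + 1 := Real.rpow_one _
  refine ENNReal.div_le_of_le_mul ?_
  refine le_trans ?_ (mul_le_mul_right (le_mass hd hv hα) _)
  rw [← ofReal_norm, Real.norm_eq_abs, abs_ofDistr hv, ← ENNReal.ofReal_toReal hF,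
    ENNReal.ofNNReal_toNNReal, ← ENNReal.ofReal_mul (by positivity),
    ← ENNReal.ofReal_mul (by positivity)]
  refine ENNReal.ofReal_le_ofReal (h1.trans ?_)
  calc _ ≤ fillConst d α * N * volume.real (hull v) * ((d + 1) * H ^ (α - 1)) :=
        mul_le_mul_of_nonneg_left h2 (by positivity)
    _ = _ := by ring

/-! ### Recovering a distribution from its cochain -/

lemma volumeReal_cube (y : E d) {ε : ℝ} (hε : 0 ≤ ε) : volume.real (cube y ε) = ε ^ d := by
  have h : cube y ε = WithLp.ofLp ⁻¹' Icc (fun i => y i) (fun i => y i + ε) := by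
    ext x
    simp only [cube, Set.mem_ofPred_eq, mem_preimage, mem_Icc, Pi.le_def, forall_and]
  rw [h, measureReal_def, (PiLp.volume_preserving_ofLp (Fin d)).measure_preimage
    measurableSet_Icc.nullMeasurableSet, Real.volume_Icc_pi]
  simp [ENNReal.toReal_pow, ENNReal.toReal_ofReal hε]

lemma isCompact_cube (y : E d) {ε : ℝ} (hε : 0 ≤ ε) : IsCompact (cube y ε) :=
  Metric.isCompact_of_isClosed_isBounded (isClosed_cube y ε)
    (Metric.isBounded_closedBall.subset (cube_subset_closedBall y hε))

lemma closedBall_subset_cube (y : E d) (ε : ℝ) :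
    Metric.closedBall (y + diag d (ε / 2)) (ε / 2) ⊆ cube y ε := by
  intro x hx i
  rw [Metric.mem_closedBall, dist_eq_norm] at hx
  have h1 := (PiLp.norm_apply_le (x - (y + diag d (ε / 2))) i).trans hx
  rw [PiLp.sub_apply, PiLp.add_apply, diag_apply, Real.norm_eq_abs, abs_le] at h1
  constructor <;> linarith [h1.1, h1.2]

section Recover

variable {α : ℝ} {F : Distr d} {ε : ℝ}

lemma regInt_cube_eq_sum (F : Distr d) (n : ℕ) (y : E d) (hε : 0 < ε) :
    regInt F n (cube y ε) =
      ∑ s : Equiv.Perm (Fin d), regInt F n (hull (boxVertices y (y + diag d ε) s)) := by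
  have hU := continuous_apply_translate F (mollifier d n)
  have h1 : ∀ {K : Set (E d)}, MeasurableSet K → regInt F n K =
      ∫ z, K.indicator 1 z * F (translate z (mollifier d n)) := fun {K} hK => by
    rw [regInt, ← integral_indicator hK]
    refine integral_congr_ae (Filter.Eventually.of_forall fun z => ?_)
    by_cases hz : z ∈ K <;> simp [hz]
  have h2 : ∀ v : Vertices d d,
      Integrable fun z => ind v z * F (translate z (mollifier d n)) := fun v => by
    refine (((hU.locallyIntegrable (μ := volume)).integrableOn_isCompact
      (isCompact_hull v)).integrable_indicator (measurableSet_hull v)).congr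
      (Filter.Eventually.of_forall fun z => ?_)
    by_cases hz : z ∈ hull v <;> simp [ind, hz]
  rw [h1 (isClosed_cube y ε).measurableSet,
    Finset.sum_congr rfl fun s _ => h1 (measurableSet_hull _)]
  change _ = ∑ s : Equiv.Perm (Fin d), ∫ z, ind _ z * _
  rw [← integral_finsetSum _ fun s _ => h2 _]
  refine integral_congr_ae ?_
  filter_upwards [ae_linearCombination_boxChain y (y + diag d ε), boxFun_cube_ae y hε]
    with z h3 h4
  rw [← Finset.sum_mul, ← h4, ← h3]
  congr 1
  simp [boxChain, map_sum, Finsupp.linearCombination_single, Finset.sum_apply, hε]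

lemma boxValue_ofDistr_cube (hd : 1 ≤ d) (hα : 0 < α) (hα1 : α ≤ 1)
    (hF : distrNorm (α - 1) F ≠ ⊤) (y : E d) (hε : 0 < ε) :
    boxValue (ofDistr F) y (y + diag d ε) = fill F (cube y ε) := by
  have h1 : ∀ s, AffineIndependent ℝ (boxVertices y (y + diag d ε) s) := fun s => by
    rw [affineIndependent_iff_edgeDet, edgeDet_boxVertices]
    simp [hε.ne']
  rw [boxValue_eq_posVal (ofDistr_mem_cochain hd hα hα1 hF)]
  simp only [posVal_ofDistr (h1 _)]
  refine tendsto_nhds_unique ?_ (tendsto_fill hα hα1 hF (isCompact_cube y hε.le)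
    (convex_cube y ε) (half_pos hε) (closedBall_subset_cube y ε))
  simp only [regInt_cube_eq_sum F _ y hε]
  refine tendsto_finsetSum _ fun s _ => ?_
  have h2 : (SignType.sign (∏ i, ((y + diag d ε) i - y i)) : ℝ) = 1 := by simp [hε]
  rw [h2, one_mul]
  exact tendsto_fill_hull hd hα hα1 hF (h1 s)

lemma isSpread_test (ψ : Test d) : IsSpread (ψ : E d → ℝ) id where
  integrable := ψ.integrable
  measurable := measurable_id
  bounded := by
    obtain ⟨R, -, hR⟩ := ψ.exists_tsupport_subset
    refine ⟨R, fun t ht => ?_⟩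
    simpa using hR (subset_tsupport _ ht)

lemma integral_mul_apply_translate_comm (F : Distr d) (φ ψ : Test d) :
    ∫ y, ψ y * F (translate y φ) = ∫ t, φ t * F (translate t ψ) := by
  have h : superpose (isSpread_test ψ) φ = superpose (isSpread_test φ) ψ := by
    ext x
    rw [superpose_apply, superpose_apply, ← integral_sub_left_eq_self _ volume x]
    refine integral_congr_ae (Filter.Eventually.of_forall fun t => ?_)
    simp [mul_comm]
  have h1 := (apply_superpose F (isSpread_test ψ) φ).2
  rw [h, (apply_superpose F (isSpread_test φ) ψ).2] at h1
  exact h1.symm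

/-- The integral over a translated cube is the pairing with a translated test function, hence depends
continuously on the translation. -/
lemma regInt_cube (F : Distr d) (n : ℕ) (y : E d) (hε : 0 ≤ ε) :
    regInt F n (cube y ε) = F (translate y (smoothInd (isCompact_cube 0 hε) n)) := by
  have hK := isCompact_cube (0 : E d) hε
  have h : translate y (smoothInd hK n) =
      superpose (isSpread_indicator hK.measurableSet hK.isBounded)
        (translate y (mollifier d n)) := by
    ext x
    simp only [smoothInd, translate_apply, superpose_apply, id, sub_right_comm]
  rw [h, apply_superpose_indicator F hK.measurableSet hK.isBounded, regInt,
    ← integral_indicator (isClosed_cube y ε).measurableSet,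
    ← integral_indicator hK.measurableSet, ← integral_add_right_eq_self _ y]
  refine integral_congr_ae (Filter.Eventually.of_forall fun t => ?_)
  have h1 : t + y ∈ cube y ε ↔ t ∈ cube 0 ε := by
    refine forall_congr' fun i => ?_
    simp only [PiLp.add_apply, PiLp.zero_apply, zero_add]
    constructor <;> rintro ⟨h1, h2⟩ <;> constructor <;> linarith
  beta_reduce
  by_cases ht : t ∈ cube 0 ε
  · rw [indicator_of_mem (h1.2 ht), indicator_of_mem ht, translate_translate]
  · rw [indicator_of_notMem (fun h => ht (h1.1 h)), indicator_of_notMem ht]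

lemma tendsto_rad : Filter.Tendsto rad Filter.atTop (nhds 0) :=
  tendsto_pow_atTop_nhds_zero_of_lt_one (by norm_num) (by norm_num)

lemma smoothInd_mem_Icc {K : Set (E d)} (hK : IsCompact K) (n : ℕ) (x : E d) :
    smoothInd hK n x ∈ Icc (0 : ℝ) 1 :=
  superpose_mollifier_mem_Icc hK.measurableSet hK.isBounded n x

/-- Regularised indicator functions converge off the boundary, which is a null set. -/
lemma tendsto_integral_smoothInd {K : Set (E d)} (hK : IsCompact K) (hKc : Convex ℝ K)
    {U : E d → ℝ} (hU : Continuous U) :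
    Filter.Tendsto (fun n => ∫ t, smoothInd hK n t * U t) Filter.atTop
      (nhds (∫ t in K, U t)) := by
  rw [← integral_indicator hK.measurableSet]
  have hN : IsCompact {x | ∃ y ∈ K, dist x y ≤ 1} :=
    Metric.isCompact_of_isClosed_isBounded (isClosed_near hK zero_le_one) (isBounded_near hK 1)
  refine tendsto_integral_filter_of_dominated_convergence
    ({x | ∃ y ∈ K, dist x y ≤ 1}.indicator fun t => |U t|)
    (Filter.Eventually.of_forall fun n =>
      ((smoothInd hK n).continuous.mul hU).aestronglyMeasurable)
    (Filter.Eventually.of_forall fun n => Filter.Eventually.of_forall fun t => ?_) ?_ ?_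
  · by_cases ht : t ∈ {x | ∃ y ∈ K, dist x y ≤ 1}
    · rw [indicator_of_mem ht, norm_mul, Real.norm_eq_abs, Real.norm_eq_abs]
      obtain ⟨h1, h2⟩ := smoothInd_mem_Icc hK n t
      rw [abs_of_nonneg h1]
      exact mul_le_of_le_one_left (abs_nonneg _) h2
    · rw [indicator_of_notMem ht, smoothInd_eq_zero hK, zero_mul, norm_zero]
      intro y hy
      by_contra h
      exact ht ⟨y, hy, (not_lt.1 h).trans (rad_le_one n)⟩
  · exact (hU.abs.locallyIntegrable.integrableOn_isCompact hN).integrable_indicator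
      hN.measurableSet
  · have h0 : ∀ᵐ t : E d, t ∉ frontier K := by
      rw [ae_iff]
      simpa using hKc.addHaar_frontier volume
    filter_upwards [h0] with t ht
    refine tendsto_nhds_of_eventually_eq ?_
    by_cases htK : t ∈ K
    · have hti : t ∈ interior K := by
        by_contra h
        exact ht ⟨subset_closure htK, h⟩
      obtain ⟨δ, hδ, hball⟩ := Metric.isOpen_iff.1 isOpen_interior t hti
      filter_upwards [tendsto_rad.eventually_lt_const hδ] with n hn
      rw [indicator_of_mem htK, smoothInd_eq_one hK, one_mul]
      exact (Metric.closedBall_subset_ball hn).trans (hball.trans interior_subset)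
    · obtain ⟨δ, hδ, hball⟩ := Metric.isOpen_iff.1 hK.isClosed.isOpen_compl t htK
      filter_upwards [tendsto_rad.eventually_lt_const hδ] with n hn
      rw [indicator_of_notMem htK, smoothInd_eq_zero hK, zero_mul]
      intro y hy
      by_contra h
      refine hball ?_ hy
      rw [Metric.mem_ball, dist_comm]
      linarith

/-- Integrating the values of the cochain of `F` on the cubes of side `ε` against `ψ` amounts to
averaging `F` over the translates of `ψ` by vectors of a cube of side `ε`. -/
lemma cubeIntegral_ofDistr (hd : 1 ≤ d) (hα : 0 < α) (hα1 : α ≤ 1)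
    (hF : distrNorm (α - 1) F ≠ ⊤) (hε : 0 < ε) (ψ : Test d) :
    cubeIntegral (ofDistr F) ε ψ = ∫ t in cube 0 ε, F (translate t ψ) := by
  have hK := isCompact_cube (0 : E d) hε.le
  refine tendsto_nhds_unique ?_ (tendsto_integral_smoothInd hK (convex_cube 0 ε)
    (continuous_apply_translate F ψ))
  simp only [cubeIntegral, boxValue_ofDistr_cube hd hα hα1 hF _ hε]
  have h1 : ∀ n, ∫ t, smoothInd hK n t * F (translate t ψ) =
      ∫ y, regInt F n (cube y ε) * ψ y := fun n => by
    rw [← integral_mul_apply_translate_comm]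
    simp only [regInt_cube F n _ hε.le, mul_comm]
  simp only [h1]
  obtain ⟨n₀, h2⟩ := exists_tendsto_regInt hα hα1 hF (r := min (ε / 2) 1) (by positivity)
    (min_le_right _ _)
  refine tendsto_integral_filter_of_dominated_convergence
    (fun y => fillConst d α * (distrNorm (α - 1) F).toReal * ε ^ d *
      min (ε / 2) 1 ^ (α - 1) * |ψ y|)
    (Filter.Eventually.of_forall fun n => ?_)
    ((Filter.eventually_ge_atTop n₀).mono fun n hn => Filter.Eventually.of_forall fun y => ?_) ?_
    (Filter.Eventually.of_forall fun y => ?_)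
  · simp only [regInt_cube F n _ hε.le]
    exact ((continuous_apply_translate F _).mul ψ.continuous).aestronglyMeasurable
  · obtain ⟨-, -, -, h3⟩ := h2 (cube y ε) _ (isCompact_cube y hε.le) (convex_cube y ε)
      ((Metric.closedBall_subset_closedBall (min_le_left _ _)).trans (closedBall_subset_cube y ε))
    have h4 := h3 n hn
    rw [volumeReal_cube y hε.le] at h4
    rw [norm_mul]
    exact mul_le_mul_of_nonneg_right h4 (abs_nonneg _)
  · exact ψ.integrable.abs.const_mul _
  · exact (tendsto_fill hα hα1 hF (isCompact_cube y hε.le) (convex_cube y ε) (half_pos hε)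
      (closedBall_subset_cube y ε)).mul_const _

/-- The cochain of a Hölder distribution `F` has distribution `F`. -/
lemma toDistr_ofDistr (hd : 1 ≤ d) (hα : 0 < α) (hα1 : α ≤ 1) (hF : distrNorm (α - 1) F ≠ ⊤)
    (hG : growthNorm α (ofDistr F) ≠ ⊤) : toDistr (ofDistr F) = F := by
  have hA := ofDistr_mem_cochain hd hα hα1 hF
  ext ψ
  have h1 := tendsto_toDistr_avgs (isLocBounded_primitive hd hα hA hG) ψ
    (fun k => (rad_pos k).le) tendsto_rad
  refine tendsto_nhds_unique h1 ?_
  have hU := continuous_apply_translate F ψ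
  have h2 : ∀ k, toDistr (ofDistr F) (avgs (fun i => i) (rad k) ψ) - F ψ =
      (rad k ^ d)⁻¹ * ∫ t in cube 0 (rad k), (F (translate t ψ) - F ψ) := fun k => by
    have hr := rad_pos k
    have hK := isCompact_cube (0 : E d) hr.le
    have h3 := integral_cube_mul hd hα hA hG (rad k) ψ
    change cubeIntegral (ofDistr F) (rad k) ψ = _ at h3
    rw [cubeIntegral_ofDistr hd hα hα1 hF hr] at h3
    rw [integral_sub (hU.locallyIntegrable.integrableOn_isCompact hK)
      (integrableOn_const hK.measure_lt_top.ne), h3, setIntegral_const, volumeReal_cube 0 hr.le,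
      smul_eq_mul]
    field_simp
  rw [tendsto_iff_norm_sub_tendsto_zero]
  simp only [h2]
  rw [Metric.tendsto_atTop]
  intro η hη
  obtain ⟨δ, hδ, h3⟩ := Metric.continuous_iff.1 hU 0 (η / 2) (half_pos hη)
  have h4 : Filter.Tendsto (fun k => d * rad k) Filter.atTop (nhds (d * 0)) :=
    tendsto_rad.const_mul (d : ℝ)
  rw [mul_zero] at h4
  obtain ⟨k₀, hk₀⟩ := Filter.eventually_atTop.1 (h4.eventually_lt_const hδ)
  refine ⟨k₀, fun k hk => ?_⟩
  have hr := rad_pos k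
  have hK := isCompact_cube (0 : E d) hr.le
  have h5 : ‖∫ t in cube (0 : E d) (rad k), (F (translate t ψ) - F ψ)‖ ≤
      η / 2 * volume.real (cube (0 : E d) (rad k)) := by
    refine norm_setIntegral_le_of_norm_le_const hK.measure_lt_top fun t ht => ?_
    have h6 := h3 t ((Metric.mem_closedBall.1 (cube_subset_closedBall 0 hr.le ht)).trans_lt
      (hk₀ k hk))
    rw [translate_zero, dist_eq_norm] at h6
    exact h6.le
  rw [volumeReal_cube 0 hr.le] at h5
  rw [dist_zero_right, norm_norm, norm_mul, Real.norm_of_nonneg (by positivity)]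
  calc _ ≤ (rad k ^ d)⁻¹ * (η / 2 * rad k ^ d) :=
        mul_le_mul_of_nonneg_left h5 (by positivity)
    _ = η / 2 := by field_simp
    _ < η := half_lt_self hη

end Recover

/-! ### The isomorphism -/

/-- There are no nondegenerate `(d + 1)`-simplices in `ℝ^d`. -/
lemma coboundary_eq_zero (A : Vertices d d → ℝ) : coboundary A = 0 := by
  funext v
  refine if_neg fun h => ?_
  have h1 := h.card_le_finrank_succ
  have h2 := Submodule.finrank_le (vectorSpan ℝ (range v))
  rw [Fintype.card_fin] at h1
  rw [finrank_euclideanSpace_fin] at h2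
  omega

lemma formNorm_eq_growthNorm (α : ℝ) (A : Vertices d d → ℝ) :
    formNorm α 0 A = growthNorm α A := by
  rw [formNorm, coboundary_eq_zero, growthNorm_zero, add_zero]

section Linear

variable {α : ℝ} (A : HolderForm d d α 0)

lemma HolderForm.growthNorm_ne_top : growthNorm α (A : Vertices d d → ℝ) ≠ ⊤ := by
  rw [← formNorm_eq_growthNorm]
  exact A.2.2.ne

lemma HolderForm.isLocBounded_primitive (hd : 1 ≤ d) (hα : 0 < α) :
    IsLocBounded (primitive (A : Vertices d d → ℝ)) :=
  HolderForms.isLocBounded_primitive hd hα A.2.1 (HolderForm.growthNorm_ne_top A)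

/-- The map sending a Hölder cochain to its distribution. -/
def distrMap (hd : 1 ≤ d) (hα : 0 < α) : HolderForm d d α 0 →ₗ[ℝ] HolderDistr d (α - 1) where
  toFun A := ⟨toDistr A, by
    obtain ⟨C, hC⟩ := distrNorm_toDistr_le hd hα
    have h := HolderForm.growthNorm_ne_top A
    exact (hC A A.2.1 h).trans_lt (ENNReal.mul_lt_top ENNReal.coe_lt_top h.lt_top)⟩
  map_add' A B := by
    refine Subtype.ext (DFunLike.ext _ _ fun ψ => ?_)
    have hA := HolderForm.isLocBounded_primitive A hd hα
    have hB := HolderForm.isLocBounded_primitive B hd hα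
    change toDistr ((A + B : HolderForm d d α 0) : Vertices d d → ℝ) ψ =
      toDistr (A : Vertices d d → ℝ) ψ + toDistr (B : Vertices d d → ℝ) ψ
    rw [toDistr_apply (HolderForm.isLocBounded_primitive _ hd hα), toDistr_apply hA,
      toDistr_apply hB, ← mul_add, ← integral_add (hA.integrable_mul _) (hB.integrable_mul _)]
    simp only [primitive, boxValue, Submodule.coe_add, Pi.add_apply, mul_add,
      Finset.sum_add_distrib, add_mul]
  map_smul' c A := by
    refine Subtype.ext (DFunLike.ext _ _ fun ψ => ?_)
    have hA := HolderForm.isLocBounded_primitive A hd hα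
    change toDistr ((c • A : HolderForm d d α 0) : Vertices d d → ℝ) ψ =
      c * toDistr (A : Vertices d d → ℝ) ψ
    have h : ∀ v, primitive ((c • A : HolderForm d d α 0) : Vertices d d → ℝ) v =
        c * primitive (A : Vertices d d → ℝ) v := fun v => by
      simp only [primitive, boxValue, Submodule.coe_smul, Pi.smul_apply, smul_eq_mul,
        mul_left_comm _ c, ← Finset.mul_sum]
    rw [toDistr_apply (HolderForm.isLocBounded_primitive _ hd hα), toDistr_apply hA]
    simp only [h, mul_assoc, integral_const_mul]
    ring

lemma injective_distrMap (hd : 1 ≤ d) (hα : 0 < α) :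
    Function.Injective (distrMap (α := α) hd hα) := by
  rw [injective_iff_map_eq_zero]
  intro A h
  exact Subtype.ext (eq_zero_of_toDistr_eq_zero hd hα A.2.1 (HolderForm.growthNorm_ne_top A)
    (congrArg Subtype.val h))

/-- The cochain of a Hölder distribution is a Hölder cochain. -/
def formOfDistr (hd : 1 ≤ d) (hα : 0 < α) (hα1 : α ≤ 1) (F : HolderDistr d (α - 1)) :
    HolderForm d d α 0 :=
  ⟨ofDistr F, ofDistr_mem_cochain hd hα hα1 F.2.ne, by
    obtain ⟨C, hC⟩ := growthNorm_ofDistr_le hd hα hα1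
    rw [formNorm_eq_growthNorm]
    exact (hC F F.2.ne).trans_lt (ENNReal.mul_lt_top ENNReal.coe_lt_top F.2)⟩

lemma distrMap_formOfDistr (hd : 1 ≤ d) (hα : 0 < α) (hα1 : α ≤ 1) (F : HolderDistr d (α - 1)) :
    distrMap hd hα (formOfDistr hd hα hα1 F) = F :=
  Subtype.ext (toDistr_ofDistr hd hα hα1 F.2.ne
    (HolderForm.growthNorm_ne_top (formOfDistr hd hα hα1 F)))

end Linear

end HolderForms

end

open HolderForms
theorem proposition6p2 (d : ℕ) (hd : 1 ≤ d) (α : ℝ) (hα₀ : 0 < α) (hα₁ : α ≤ 1) :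
    ∃ π : HolderForm d d α 0 ≃ₗ[ℝ] HolderDistr d (α - 1),
      (∀ (A : HolderForm d d α 0) (ψ : Test d),
        Integrable (fun v : E d => boxValue (A : Vertices d d → ℝ) 0 v * mixedDeriv ψ v) ∧
        (π A : Distr d) ψ =
          (-1) ^ d * ∫ v : E d, boxValue (A : Vertices d d → ℝ) 0 v * mixedDeriv ψ v) ∧
      (∃ C : ℝ≥0, ∀ A : HolderForm d d α 0,
        distrNorm (α - 1) (π A : Distr d) ≤ C * formNorm α 0 (A : Vertices d d → ℝ)) ∧
      (∃ C : ℝ≥0, ∀ F : HolderDistr d (α - 1),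
        formNorm α 0 (π.symm F : Vertices d d → ℝ) ≤ C * distrNorm (α - 1) (F : Distr d)) := by
  have hsurj : Function.Surjective (distrMap (α := α) hd hα₀) := fun F =>
    ⟨formOfDistr hd hα₀ hα₁ F, distrMap_formOfDistr hd hα₀ hα₁ F⟩
  refine ⟨LinearEquiv.ofBijective (distrMap hd hα₀) ⟨injective_distrMap hd hα₀, hsurj⟩,
    fun A ψ => ?_, ?_, ?_⟩
  · have hA := HolderForm.isLocBounded_primitive A hd hα₀
    exact ⟨hA.integrable_mul _, toDistr_apply hA ψ⟩
  · obtain ⟨C, hC⟩ := distrNorm_toDistr_le hd hα₀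
    refine ⟨C, fun A => ?_⟩
    rw [formNorm_eq_growthNorm]
    exact hC A A.2.1 (HolderForm.growthNorm_ne_top A)
  · obtain ⟨C, hC⟩ := growthNorm_ofDistr_le hd hα₀ hα₁
    refine ⟨C, fun F => ?_⟩
    have h : (LinearEquiv.ofBijective (distrMap hd hα₀) ⟨injective_distrMap hd hα₀, hsurj⟩).symm F =
        formOfDistr hd hα₀ hα₁ F := by
      rw [LinearEquiv.symm_apply_eq]
      exact (distrMap_formOfDistr hd hα₀ hα₁ F).symm
    rw [formNorm_eq_growthNorm, h]
    exact hC F F.2.ne
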